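/- Let $M$ be a smooth connected (Hausdorff) manifold of dimension $n>2$, with tangent bundle $\pi:TM\to M$, and let $T_0M$ be $TM$ with the zero section removed. A Finsler metric on $M$ is a continuous function $F:TM\to\mathbb R$ which is positive and smooth on $T_0M$, satisfies $F(x,\lambda y)=\lambda F(x,y)$ for all $\lambda>0$, and whose Hessian $g_{ij}=\frac12\,\partial^2F^2/\partial y^i\partial y^j$ is non-degenerate at every point of $T_0M$. Let $J=dx^i\otimes\partial/\partial y^i$ be the tangent structure of $TM$ (the vertical endomorphism), let $S$ be the geodesic spray of $F$, i.e. the unique smooth vector field on $T_0M$ with $i_S\,dd_JF^2=-dF^2$, where $d_JF^2=dF^2\circ J$, let $h=\frac12(\mathrm{Id}-[S,J])$ be the induced horizontal projector and let $R=\frac12[h,h]$ be its curvature, with Frölicher–Nijenhuis brackets, that is $$[S,J](X)=[S,JX]-J[S,X],\qquad R(X,Y)=[hX,hY]+h^2[X,Y]-h[hX,Y]-h[X,hY].$$ In the local coordinates $(x^i,y^i)$ of $TM$ induced by local coordinates $(x^i)$ of $M$, write $R(\partial/\partial x^j,\partial/\partial x^k)=R^m_{jk}\,\partial/\partial y^m$.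 $F$ has constant flag curvature if there is a constant $\kappa\in\mathbb R$ such that $$\frac{X^ig_{il}R^l_{jk}y^jX^k}{g_{ij}y^iy^j\,g_{ij}X^iX^j-(g_{ij}y^iX^j)^2}=\kappa$$ for all $(x,y)\in T_0M$ and all $X\in T_xM$ linearly independent of $y$. For a smooth $2$-form $\omega$ on $T_0M$ put $$i_J\omega(X,Y)=\omega(JX,Y)+\omega(X,JY),$$ $$i_R\omega(X,Y,Z)=\omega(R(X,Y),Z)+\omega(R(Z,X),Y)+\omega(R(Y,Z),X).$$ Theorem. For every Finsler metric $F$ on $M$ the following are equivalent: (a) $F$ has constant flag curvature; (b) $i_R\omega=0$ for every smooth $2$-form $\omega$ on $T_0M$ with $i_J\omega=0$; (c) in all induced local coordinates, at every point of $T_0M$ in their domain, $$b_{im}R^m_{jk}+b_{km}R^m_{ij}+b_{jm}R^m_{ki}=0\qquad(1\le i,j,k\le n,\ \text{summed over } m)$$ for every symmetric matrix $(b_{ij})$. -/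

import Mathlib

open scoped Manifold ContDiff

-- These instances would be found (they are defeq) in place of `chartedSpaceSelf`, and block rewriting.
attribute [-instance] TopCat.of.chartedSpace TopCat.of.hasGroupoid

noncomputable section

namespace FinslerGeom

/-- The tangent bundle of an `n`-dimensional smooth manifold. -/
abbrev TM (n : ℕ) (M : Type*) [TopologicalSpace M] [ChartedSpace (EuclideanSpace ℝ (Fin n)) M]
    [IsManifold (𝓡 n) ∞ M] := TangentBundle (𝓡 n) M

/-- The tangent space of the manifold `TM` at `u`. -/
abbrev TTM {n : ℕ} {M : Type*} [TopologicalSpace M] [ChartedSpace (EuclideanSpace ℝ (Fin n)) M]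
    [IsManifold (𝓡 n) ∞ M] (u : TM n M) := TangentSpace (𝓡 n).tangent u

section

variable {n : ℕ} {M : Type*} [TopologicalSpace M] [ChartedSpace (EuclideanSpace ℝ (Fin n)) M]
  [IsManifold (𝓡 n) ∞ M]

variable (n M) in
/-- The slit tangent bundle `T₀M`: the tangent bundle with the zero section removed, an open
subset of `TM`. Objects on `T₀M` are represented below by objects on `TM` whose values outside
`T₀M` are irrelevant. -/
def slit : Set (TM n M) := {u | u.2 ≠ 0}

variable (n M) in
/-- (Not necessarily smooth) vector fields. -/
abbrev VField := (u : TM n M) → TTM u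

/-- `X` is a smooth vector field on `T₀M`. -/
def SmoothField (X : VField n M) : Prop :=
  ContMDiffOn (𝓡 n).tangent (𝓡 n).tangent.tangent ∞
    (fun u => (⟨u, X u⟩ : TangentBundle (𝓡 n).tangent (TM n M))) (slit n M)

/-- The Lie bracket of vector fields on the manifold `TM`. -/
def lie (X Y : VField n M) : VField n M := VectorField.mlieBracket (𝓡 n).tangent X Y

/-- The differential of a function on `TM`, evaluated on a tangent vector. -/
def dfun (f : TM n M → ℝ) (u : TM n M) (v : TTM u) : ℝ :=
  mfderiv (𝓡 n).tangent 𝓘(ℝ, ℝ) f u v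

/-- The point `(x, y)` of `TM` with `y ∈ T_xM`; the vector space `T_xM` is, in Mathlib, a copy of
the model space, and is used here with its norm topology and smooth structure. -/
def fibrePt (x : M) (y : EuclideanSpace ℝ (Fin n)) : TM n M := ⟨x, y⟩

/-- The vertical lift of `w ∈ T_xM` at `u ∈ T_xM`, i.e. the velocity of `t ↦ u + t w` at `t = 0`,
written as the differential at `u` of the inclusion of the fibre `T_xM` in `TM`. -/
def vlift (u : TM n M) : TangentSpace (𝓡 n) u.proj →L[ℝ] TTM u :=
  mfderiv (𝓡 n) (𝓡 n).tangent (fibrePt u.proj) u.2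

/-- The tangent structure (vertical endomorphism): the vertical lift of the projection `Dπ(v)`. -/
def vertEnd (u : TM n M) : TTM u →L[ℝ] TTM u :=
  (vlift u).comp (mfderiv (𝓡 n).tangent (𝓡 n) (fun p : TM n M => p.proj) u)

/-- The tangent structure as an operator on vector fields. -/
def J (X : VField n M) : VField n M := fun u => vertEnd u (X u)

/-- Frölicher-Nijenhuis bracket `[S, K]` of a vector field `S` with a vector valued `1`-form `K`
(given by its action on vector fields): `[S, K](X) = [S, KX] - K[S, X]`. -/
def fnBracketField (S : VField n M) (K : VField n M → VField n M) (X : VField n M) : VField n M :=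
  lie S (K X) - K (lie S X)

/-- Frölicher-Nijenhuis bracket `[K, L]` of two vector valued `1`-forms. -/
def fnBracket (K L : VField n M → VField n M) (X Y : VField n M) : VField n M :=
  lie (K X) (L Y) + lie (L X) (K Y) + K (L (lie X Y)) + L (K (lie X Y))
    - K (lie (L X) Y + lie X (L Y)) - L (lie (K X) Y + lie X (K Y))

/-- The Hessian at `u = (x, y)` of `½ f` along the fibre, `½ ∂²f/∂yⁱ∂yʲ vⁱ wʲ`, for
`v, w ∈ T_xM`. -/
def fibreHess (f : TM n M → ℝ) (u : TM n M) (v w : TangentSpace (𝓡 n) u.proj) : ℝ :=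
  (1 / 2) * fderiv ℝ (fun z : EuclideanSpace ℝ (Fin n) =>
    fderiv ℝ (fun y : EuclideanSpace ℝ (Fin n) => f (fibrePt u.proj y)) z) u.2 v w

variable (n M) in
/-- Finsler metrics. Positivity is required off the zero section: by homogeneity, `F` vanishes on
the zero section. -/
structure FinslerMetric where
  toFun : TM n M → ℝ
  continuous_toFun : Continuous toFun
  pos : ∀ u ∈ slit n M, 0 < toFun u
  smooth : ContMDiffOn (𝓡 n).tangent 𝓘(ℝ, ℝ) ∞ toFun (slit n M)
  homog : ∀ (u : TM n M) (c : ℝ), 0 < c → toFun ⟨u.proj, c • u.2⟩ = c * toFun u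
  nondeg : ∀ u ∈ slit n M, ∀ v : TangentSpace (𝓡 n) u.proj,
    (∀ w : TangentSpace (𝓡 n) u.proj, fibreHess (fun p => toFun p ^ 2) u v w = 0) → v = 0

variable (n M) in
/-- Smooth differential `2`-forms on `T₀M`. Smoothness is tested on smooth vector fields. -/
structure TwoForm where
  toFun : (u : TM n M) → TTM u [⋀^Fin 2]→L[ℝ] ℝ
  smooth : ∀ X Y : VField n M, SmoothField X → SmoothField Y →
    ContMDiffOn (𝓡 n).tangent 𝓘(ℝ, ℝ) ∞ (fun u => toFun u ![X u, Y u]) (slit n M)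

/-- `i_J η (v, w) = η(Jv, w) + η(v, Jw)`. -/
def iJ (η : TwoForm n M) (u : TM n M) (v w : TTM u) : ℝ :=
  η.toFun u ![vertEnd u v, w] + η.toFun u ![v, vertEnd u w]

/-- The coordinates `(x, y)` on `TM` induced by a chart `e` of `M`: `u ↦ (e(π u), De(u))`. -/
def tangentCoord (e : OpenPartialHomeomorph M (EuclideanSpace ℝ (Fin n))) (u : TM n M) :
    EuclideanSpace ℝ (Fin n) × EuclideanSpace ℝ (Fin n) :=
  (e u.proj, mfderiv (𝓡 n) (𝓡 n) e u.proj u.2)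

/-- The coordinate vector field `aⁱ ∂/∂xⁱ + bⁱ ∂/∂yⁱ` with constant coefficients `c = (a, b)`,
over the domain of the chart `e`. -/
def coordField (e : OpenPartialHomeomorph M (EuclideanSpace ℝ (Fin n)))
    (c : EuclideanSpace ℝ (Fin n) × EuclideanSpace ℝ (Fin n)) : VField n M :=
  VectorField.mpullback (𝓡 n).tangent
    𝓘(ℝ, EuclideanSpace ℝ (Fin n) × EuclideanSpace ℝ (Fin n)) (tangentCoord e) (fun _ => c)

namespace FinslerMetric

variable (F : FinslerMetric n M)

/-- The function `F²`. -/
def sq (u : TM n M) : ℝ := F.toFun u ^ 2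

/-- The metric tensor `g_{ij}(x, y)`. -/
def g (u : TM n M) (v w : TangentSpace (𝓡 n) u.proj) : ℝ := fibreHess F.sq u v w

/-- The `1`-form `d_J F²`, on vector fields. -/
def dJsq (X : VField n M) (u : TM n M) : ℝ := dfun F.sq u (J X u)

/-- The `2`-form `d d_J F²`, on vector fields. -/
def ddJsq (X Y : VField n M) (u : TM n M) : ℝ :=
  dfun (F.dJsq Y) u (X u) - dfun (F.dJsq X) u (Y u) - F.dJsq (lie X Y) u

/-- `S` is a smooth vector field on `T₀M` with `i_S d d_J F² = - d F²`. -/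
def IsGeodesicSpray (S : VField n M) : Prop :=
  SmoothField S ∧ ∀ Y : VField n M, SmoothField Y → ∀ u ∈ slit n M,
    F.ddJsq S Y u = - dfun F.sq u (Y u)

/-- The geodesic spray: the vector field on `T₀M` (it exists and is unique) such that
`i_S d d_J F² = - d F²`. -/
def spray : VField n M := Classical.epsilon F.IsGeodesicSpray

/-- The horizontal projector `h = ½ (Id - [S, J])`. -/
def h (X : VField n M) : VField n M := (1 / 2 : ℝ) • (X - fnBracketField F.spray J X)

/-- The curvature `R = ½ [h, h]` of the nonlinear connection. -/
def R (X Y : VField n M) : VField n M := (1 / 2 : ℝ) • fnBracket F.h F.h X Y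

/-- `i_R η (X, Y, Z) = η(R(X, Y), Z) + η(R(Z, X), Y) + η(R(Y, Z), X)`. -/
def iR (η : TwoForm n M) (X Y Z : VField n M) (u : TM n M) : ℝ :=
  η.toFun u ![F.R X Y u, Z u] + η.toFun u ![F.R Z X u, Y u] + η.toFun u ![F.R Y Z u, X u]

/-- `R^l_{jk} aʲ bᵏ` in the coordinates `(x, y)` induced by the chart `e`: the `∂/∂y` components
of `R(aʲ ∂/∂xʲ, bᵏ ∂/∂xᵏ)`. -/
def coordR (e : OpenPartialHomeomorph M (EuclideanSpace ℝ (Fin n))) (u : TM n M)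
    (a b : EuclideanSpace ℝ (Fin n)) : EuclideanSpace ℝ (Fin n) :=
  (mfderiv (𝓡 n).tangent 𝓘(ℝ, EuclideanSpace ℝ (Fin n) × EuclideanSpace ℝ (Fin n))
    (tangentCoord e) u (F.R (coordField e (a, 0)) (coordField e (b, 0)) u)).2

/-- The component `R^m_{jk}` of the curvature. -/
def Rcomp (e : OpenPartialHomeomorph M (EuclideanSpace ℝ (Fin n))) (u : TM n M)
    (m j k : Fin n) : ℝ :=
  F.coordR e u (EuclideanSpace.single j 1) (EuclideanSpace.single k 1) m

/-- The vector `R^l_{jk} yʲ Xᵏ ∂/∂xˡ ∈ T_xM`, for `u = (x, y)` and `X ∈ T_xM`; it does not depend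
on the coordinates, and is computed in the preferred chart at `x`. -/
def jacobi (u : TM n M) (X : TangentSpace (𝓡 n) u.proj) : TangentSpace (𝓡 n) u.proj :=
  let D : TangentSpace (𝓡 n) u.proj →L[ℝ] EuclideanSpace ℝ (Fin n) :=
    mfderiv (𝓡 n) (𝓡 n) (chartAt (EuclideanSpace ℝ (Fin n)) u.proj) u.proj
  D.inverse (F.coordR (chartAt (EuclideanSpace ℝ (Fin n)) u.proj) u (D u.2) (D X))

/-- The flag curvature of the flag with flagpole `y` and plane `span {y, X}`, at `u = (x, y)`. -/
def flagCurvature (u : TM n M) (X : TangentSpace (𝓡 n) u.proj) : ℝ :=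
  F.g u X (F.jacobi u X) / (F.g u u.2 u.2 * F.g u X X - F.g u u.2 X ^ 2)

/-- `F` has constant flag curvature. -/
def HasConstantFlagCurvature : Prop :=
  ∃ κ : ℝ, ∀ u ∈ slit n M, ∀ X : TangentSpace (𝓡 n) u.proj,
    LinearIndependent ℝ ![u.2, X] → F.flagCurvature u X = κ

/-- `i_R η = 0` for every `2`-form `η` on `T₀M` with `i_J η = 0`. -/
def AlgebraicCondition : Prop :=
  ∀ η : TwoForm n M, (∀ u ∈ slit n M, ∀ v w : TTM u, iJ η u v w = 0) →
    ∀ X Y Z : VField n M, SmoothField X → SmoothField Y → SmoothField Z →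
      ∀ u ∈ slit n M, F.iR η X Y Z u = 0

/-- `b_{im} R^m_{jk} + b_{km} R^m_{ij} + b_{jm} R^m_{ki} = 0` for all symmetric `b`, in the
coordinates induced by any smooth chart. -/
def LocalAlgebraicCondition : Prop :=
  ∀ e ∈ IsManifold.maximalAtlas (𝓡 n) ∞ M, ∀ u ∈ slit n M, u.proj ∈ e.source →
    ∀ b : Matrix (Fin n) (Fin n) ℝ, b.IsSymm → ∀ i j k : Fin n,
      ∑ m, (b i m * F.Rcomp e u m j k + b k m * F.Rcomp e u m i j
        + b j m * F.Rcomp e u m k i) = 0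

end FinslerMetric

end

end FinslerGeom

end

/-!
All three conditions are shown to be equivalent to *isotropy*: in every chart the curvature has the
form `R(a, b) = ρ (p(a) b - p(b) a)`, where `p = ∂L/∂y` is the momentum of the energy `L = F²` and
`ρ` is a function on `T₀M` (`FinslerMetric.IsIsotropic`).

**Local theory.** Let `L` be an energy on an open set of a vector space. The spray equation is
equivalent to the Euler-Lagrange equations, which are solved by inverting the Hessian of `L` along
the fibres; the horizontal lift `δ` of the resulting connection satisfies `δL = 0`
(`fderiv_horLift`). Differentiating this once more and antisymmetrizing gives `p(R(a, b)) = 0`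
(`momentum_curv`). The other ingredients are the vertical and horizontal Bianchi identities,
consequences of the symmetry of second derivatives, and Euler's identity for functions which are
homogeneous along the fibres.

**Constant flag curvature implies isotropy.** Differentiating `p(R(a, b)) = 0` along the fibre and
inserting the vertical Bianchi identity shows that the Jacobi endomorphism `v ↦ R(y, v)` is
self-adjoint for the metric tensor `g` (`vertHess_curv_comm`), so that it is recovered from the
quadratic form `g(v, R(y, v))`, that is, from the flag curvature (`curv_eq_of_quadratic`). A
vertical derivative of the resulting formula, with the vertical Bianchi identity and homogeneity,
recovers `R(a, b)` itself (`curv_eq_of_fibre`). Here the denominators of the flag curvature must not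
vanish: `g` is positive definite, because it is so at a minimum of `L` on a sphere in the fibre, and
the fibre without its origin is connected, so that the nondegenerate form `g` keeps its signature
(`vertHess_pos`).

**Isotropy implies constant flag curvature.** This is a Schur lemma (`factor_locally_const`): by the
Bianchi identities `dρ ∧ p ∧ Id` vanishes along vertical and along horizontal directions, and in
dimension at least three `Id` may be cancelled. Vertically, homogeneity of degree zero gives
`∂ρ/∂y = 0`; horizontally, `dρ` is a multiple of the momentum at *every* `y` over the same point,
and choosing `y` in the kernel of `dρ` gives `dρ = 0`. Connectedness of `M` does the rest.

**The algebraic conditions.** If `i_J ω = 0`, then `ω(JX, Y)` is symmetric in `X` and `Y`, and for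
an isotropic curvature, `R(X, Y) = ρ (p(X) JY - p(Y) JX)`, the terms of `i_R ω` cancel in pairs.
Conversely, for a symmetric matrix `b` the form `b_{ij} dyⁱ ∧ dxʲ`, cut off outside a chart, is
annihilated by `i_J`, and evaluating `i_R` of it on the fields `∂/∂xⁱ` gives the condition in
coordinates. Testing that condition on elementary symmetric matrices forces, in dimension at least
three, `R(a, b) = λ(a) b - λ(b) a` for a covector `λ` (`exists_covector_of_cyclic_components`), and
`p(R(a, b)) = 0` makes `λ` a multiple of `p`.

The transfer between the manifold and the charts consists in computing the coordinate expression
(`rep`) of Lie brackets, of `J`, and successively of `S`, `h` and `R` (`rep_spray`, `rep_h`,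
`rep_R`); brackets require the expressions of the fields to be differentiable in a neighbourhood of
a point, so the smoothness of all fields involved is tracked as well.
-/

noncomputable section

open Set Filter Topology

set_option linter.unusedSectionVars false

namespace FinslerGeom

/-! ### Geometry of a Finsler metric on a vector space chart -/

section Flat

variable {E : Type*} [NormedAddCommGroup E] [NormedSpace ℝ E]
variable {G : Type*} [NormedAddCommGroup G] [NormedSpace ℝ G]
variable {H : Type*} [NormedAddCommGroup H] [NormedSpace ℝ H]

/-- The pairs `(x, y)` with `x ∈ O` and `y ≠ 0`: the slit tangent bundle of `O`. -/
def slitDomain (O : Set E) : Set (E × E) := O ×ˢ {0}ᶜ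

/-- The momentum of the energy `L`: the covector `∂L/∂yⁱ`. -/
def momentum (L : E × E → ℝ) (z : E × E) : E →L[ℝ] ℝ :=
  (fderiv ℝ L z).comp (ContinuousLinearMap.inr ℝ E E)

/-- The Hessian `∂²L/∂yⁱ∂yʲ` along the fibre; for `L = F²` this is `2 g_{ij}`. -/
def vertHess (L : E × E → ℝ) (z : E × E) : E →L[ℝ] E →L[ℝ] ℝ :=
  (fderiv ℝ (momentum L) z).comp (ContinuousLinearMap.inr ℝ E E)

/-- The vertical part `-2 Gⁱ` of the spray `yⁱ ∂/∂xⁱ - 2 Gⁱ ∂/∂yⁱ` of `L`, obtained by solving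
the Euler-Lagrange equations. -/
def accel (L : E × E → ℝ) (z : E × E) : E :=
  (vertHess L z).inverse ((fderiv ℝ L z).comp (ContinuousLinearMap.inl ℝ E E) -
    fderiv ℝ (momentum L) z (z.2, 0))

/-- The coefficients `∂Gⁱ/∂yʲ` of the nonlinear connection of `L`. -/
def conn (L : E × E → ℝ) (z : E × E) : E →L[ℝ] E :=
  (-(1 / 2) : ℝ) • (fderiv ℝ (accel L) z).comp (ContinuousLinearMap.inr ℝ E E)

/-- The horizontal lift of `a`, as a vector field: `aʲ (∂/∂xʲ - ∂Gⁱ/∂yʲ ∂/∂yⁱ)`. -/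
def horLift (L : E × E → ℝ) (a : E) (z : E × E) : E × E := (a, -conn L z a)

/-- The curvature `Rˡ_{jk} aʲ bᵏ` of the nonlinear connection of `L`: the vertical component of
the Lie bracket of the horizontal lifts of `a` and `b`. -/
def curv (L : E × E → ℝ) (z : E × E) (a b : E) : E :=
  fderiv ℝ (conn L) z (horLift L b z) a - fderiv ℝ (conn L) z (horLift L a z) b

/-- `L` is the square of a Finsler metric on the open set `O`. Nothing is required of its values on
the zero section. -/
structure IsFinslerEnergy (O : Set E) (L : E × E → ℝ) : Prop where
  isOpen : IsOpen O
  smooth : ∀ z ∈ slitDomain O, ContDiffAt ℝ ∞ L z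
  pos : ∀ z ∈ slitDomain O, 0 < L z
  homog : ∀ z ∈ slitDomain O, ∀ c : ℝ, 0 < c → L (z.1, c • z.2) = c ^ 2 * L z
  nondeg : ∀ z ∈ slitDomain O, ∀ v, (∀ w, vertHess L z v w = 0) → v = 0

lemma fderiv_clm_apply_const {A : H → E →L[ℝ] G} {z : H} (hA : DifferentiableAt ℝ A z) (w : E)
    (c : H) : fderiv ℝ (fun z => A z w) z c = fderiv ℝ A z c w := by
  rw [(hA.hasFDerivAt.clm_apply (hasFDerivAt_const w z)).fderiv]
  simp

lemma contDiffAt_fderiv_infty {f : H → G} {z : H} (hf : ContDiffAt ℝ ∞ f z) :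
    ContDiffAt ℝ ∞ (fderiv ℝ f) z := hf.fderiv_right (by simp)

lemma fderiv_fderiv_comm {f : H → G} {z : H} (hf : ContDiffAt ℝ ∞ f z) (c d : H) :
    fderiv ℝ (fderiv ℝ f) z c d = fderiv ℝ (fderiv ℝ f) z d c :=
  hf.isSymmSndFDerivAt (by
    rw [minSmoothness_of_isRCLikeNormedField]
    change ((2 : ℕ∞) : WithTop ℕ∞) ≤ ((⊤ : ℕ∞) : WithTop ℕ∞)
    exact WithTop.coe_le_coe.2 le_top) c d

lemma differentiableAt_of_infty {f : H → G} {z : H} (hf : ContDiffAt ℝ ∞ f z) :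
    DifferentiableAt ℝ f z := hf.differentiableAt (by simp)

/-- The scaling `(x, y) ↦ (x, c y)`. -/
def fibreScale (c : ℝ) : E × E →L[ℝ] E × E :=
  (ContinuousLinearMap.fst ℝ E E).prod (c • ContinuousLinearMap.snd ℝ E E)

@[simp] lemma fibreScale_apply (c : ℝ) (z : E × E) : fibreScale c z = (z.1, c • z.2) := rfl

lemma fibreScale_mem {O : Set E} {c : ℝ} (hc : 0 < c) {z : E × E} (hz : z ∈ slitDomain O) :
    fibreScale c z ∈ slitDomain O :=
  ⟨hz.1, smul_ne_zero hc.ne' hz.2⟩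

lemma eventually_mem_slitDomain {O : Set E} (hO : IsOpen O) {z : E × E} (hz : z ∈ slitDomain O) :
    ∀ᶠ w in 𝓝 z, w ∈ slitDomain O :=
  (hO.prod isOpen_compl_singleton).mem_nhds hz

/-- The differential of a function which is homogeneous of degree `k` in `y`. -/
lemma fderiv_fibreScale {O : Set E} (hO : IsOpen O) {f : E × E → G} {k : ℕ} {c : ℝ} (hc : 0 < c)
    (hf : ∀ z ∈ slitDomain O, f (fibreScale c z) = c ^ k • f z)
    (hd : ∀ z ∈ slitDomain O, DifferentiableAt ℝ f z) {z : E × E} (hz : z ∈ slitDomain O)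
    (d : E × E) :
    fderiv ℝ f (fibreScale c z) (fibreScale c d) = c ^ k • fderiv ℝ f z d := by
  have h1 : HasFDerivAt (fun z => f (fibreScale c z))
      ((fderiv ℝ f (fibreScale c z)).comp (fibreScale c)) z :=
    (hd _ (fibreScale_mem hc hz)).hasFDerivAt.comp z
      (fibreScale c : E × E →L[ℝ] E × E).hasFDerivAt
  have h2 : HasFDerivAt (fun z => f (fibreScale c z)) (c ^ k • fderiv ℝ f z) z :=
    ((hd z hz).hasFDerivAt.const_smul (c ^ k)).congr_of_eventuallyEq (by
      filter_upwards [eventually_mem_slitDomain hO hz] with w hw using hf w hw)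
  exact congrArg (fun A => A d) (h1.unique h2)

/-- Euler's identity for functions which are homogeneous of degree `k` in `y`. -/
lemma fderiv_liouville {f : E × E → G} {k : ℕ} {z : E × E}
    (hf : ∀ c : ℝ, 0 < c → f (fibreScale c z) = c ^ k • f z) (hd : DifferentiableAt ℝ f z) :
    fderiv ℝ f z (0, z.2) = (k : ℝ) • f z := by
  have h0 : HasDerivAt (fun c : ℝ => fibreScale c z) ((0 : E), z.2) 1 := by
    simp only [fibreScale_apply]
    simpa using (hasDerivAt_const (1 : ℝ) z.1).prodMk ((hasDerivAt_id (1 : ℝ)).smul_const z.2)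
  have h1 : HasDerivAt (fun c : ℝ => f (fibreScale c z)) (fderiv ℝ f z (0, z.2)) 1 := by
    refine HasFDerivAt.comp_hasDerivAt (1 : ℝ) ?_ h0
    simpa using hd.hasFDerivAt
  have h2 : HasDerivAt (fun c : ℝ => f (fibreScale c z)) ((k : ℝ) • f z) 1 := by
    have := ((hasDerivAt_pow k (1 : ℝ)).smul_const (f z))
    simp only [one_pow, mul_one] at this
    refine this.congr_of_eventuallyEq ?_
    filter_upwards [lt_mem_nhds (zero_lt_one' ℝ)] with c hc using hf c hc
  exact h1.unique h2

namespace IsFinslerEnergy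

variable {O : Set E} {L : E × E → ℝ} (hL : IsFinslerEnergy O L) {z : E × E}

include hL

lemma eventually_mem (hz : z ∈ slitDomain O) : ∀ᶠ w in 𝓝 z, w ∈ slitDomain O :=
  eventually_mem_slitDomain hL.isOpen hz

lemma smooth_momentum (hz : z ∈ slitDomain O) : ContDiffAt ℝ ∞ (momentum L) z :=
  (contDiffAt_fderiv_infty (hL.smooth z hz)).clm_comp contDiffAt_const

lemma smooth_vertHess (hz : z ∈ slitDomain O) : ContDiffAt ℝ ∞ (vertHess L) z :=
  (contDiffAt_fderiv_infty (hL.smooth_momentum hz)).clm_comp contDiffAt_const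

lemma fderiv_momentum (hz : z ∈ slitDomain O) (c : E × E) (w : E) :
    fderiv ℝ (momentum L) z c w = fderiv ℝ (fderiv ℝ L) z c (0, w) := by
  rw [← fderiv_clm_apply_const (differentiableAt_of_infty (hL.smooth_momentum hz)),
    ← fderiv_clm_apply_const
      (differentiableAt_of_infty (contDiffAt_fderiv_infty (hL.smooth z hz)))]
  rfl

lemma vertHess_apply (hz : z ∈ slitDomain O) (v w : E) :
    vertHess L z v w = fderiv ℝ (fderiv ℝ L) z (0, v) (0, w) := hL.fderiv_momentum hz _ _

lemma vertHess_comm (hz : z ∈ slitDomain O) (v w : E) : vertHess L z v w = vertHess L z w v := by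
  rw [hL.vertHess_apply hz, hL.vertHess_apply hz, fderiv_fderiv_comm (hL.smooth z hz)]

lemma momentum_scale (hz : z ∈ slitDomain O) {c : ℝ} (hc : 0 < c) :
    momentum L (fibreScale c z) = c ^ 1 • momentum L z := by
  ext w
  have h := fderiv_fibreScale hL.isOpen hc (k := 2) (fun z hz => hL.homog z hz c hc)
    (fun z hz => differentiableAt_of_infty (hL.smooth z hz)) hz (0, c⁻¹ • w)
  have h1 : fibreScale c ((0 : E), c⁻¹ • w) = (0, w) := by simp [hc.ne']
  have h2 : ((0 : E), c⁻¹ • w) = c⁻¹ • ((0 : E), w) := by simp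
  rw [h1, h2, map_smul] at h
  simp only [momentum, ContinuousLinearMap.comp_apply, ContinuousLinearMap.inr_apply,
    smul_apply] at h ⊢
  rw [h]
  simp only [smul_eq_mul]
  field_simp

lemma fderiv_momentum_scale (hz : z ∈ slitDomain O) {c : ℝ} (hc : 0 < c) (d : E × E) :
    fderiv ℝ (momentum L) (fibreScale c z) (fibreScale c d) = c ^ 1 • fderiv ℝ (momentum L) z d :=
  fderiv_fibreScale hL.isOpen hc (fun _ hz => hL.momentum_scale hz hc)
    (fun _ hz => differentiableAt_of_infty (hL.smooth_momentum hz)) hz d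

/-- Euler's identity for `L`. -/
lemma momentum_self (hz : z ∈ slitDomain O) : momentum L z z.2 = 2 * L z := by
  have := fderiv_liouville (k := 2) (fun c hc => hL.homog z hz c hc)
    (differentiableAt_of_infty (hL.smooth z hz))
  simp only [Nat.cast_ofNat, smul_eq_mul] at this
  exact this

/-- Euler's identity for the momentum. -/
lemma vertHess_self (hz : z ∈ slitDomain O) (w : E) : vertHess L z z.2 w = momentum L z w := by
  have := fderiv_liouville (k := 1) (fun c hc => hL.momentum_scale hz hc)
    (differentiableAt_of_infty (hL.smooth_momentum hz))
  have h := congrArg (fun A => A w) this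
  simp only [Nat.cast_one, one_smul] at h
  exact h

lemma vertHess_self_right (hz : z ∈ slitDomain O) (w : E) :
    vertHess L z w z.2 = momentum L z w := by
  rw [hL.vertHess_comm hz, hL.vertHess_self hz]

/-- The derivative of Euler's identity in the direction of the base. -/
lemma fderiv_momentum_self (hz : z ∈ slitDomain O) (a : E) :
    fderiv ℝ (momentum L) z (a, 0) z.2 = 2 * fderiv ℝ L z (a, 0) := by
  have h1 := (differentiableAt_of_infty (hL.smooth_momentum hz)).hasFDerivAt.clm_apply
    (hasFDerivAt_snd (𝕜 := ℝ) (E := E) (F := E) (p := z))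
  have h2 : HasFDerivAt (fun z : E × E => momentum L z z.2) ((2 : ℝ) • fderiv ℝ L z) z :=
    ((differentiableAt_of_infty (hL.smooth z hz)).hasFDerivAt.const_mul 2).congr_of_eventuallyEq (by
      filter_upwards [hL.eventually_mem hz] with w hw using hL.momentum_self hw)
  simpa using congrArg (fun A => A (a, 0)) (h1.unique h2)

variable [FiniteDimensional ℝ E]

lemma vertHess_isInvertible (hz : z ∈ slitDomain O) : (vertHess L z).IsInvertible := by
  have hinj : Function.Injective (vertHess L z) := by
    rw [injective_iff_map_eq_zero]
    intro v hv
    exact hL.nondeg z hz v fun w => by rw [hv]; rfl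
  have hdim : Module.finrank ℝ E = Module.finrank ℝ (E →L[ℝ] ℝ) := by
    rw [← (LinearMap.toContinuousLinearMap (𝕜 := ℝ) (E := E) (F' := ℝ)).finrank_eq]
    exact Subspace.dual_finrank_eq.symm
  exact ⟨(LinearEquiv.ofInjectiveOfFinrankEq (vertHess L z).toLinearMap hinj
    hdim).toContinuousLinearEquiv, by ext; rfl⟩

lemma vertHess_accel (hz : z ∈ slitDomain O) (w : E) :
    vertHess L z (accel L z) w = fderiv ℝ L z (w, 0) - fderiv ℝ (momentum L) z (z.2, 0) w := by
  have h : vertHess L z (accel L z) = (fderiv ℝ L z).comp (ContinuousLinearMap.inl ℝ E E) -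
    fderiv ℝ (momentum L) z (z.2, 0) := by
    obtain ⟨A, hA⟩ := hL.vertHess_isInvertible hz
    rw [accel, ← hA, ContinuousLinearMap.inverse_equiv]
    exact A.apply_symm_apply _
  rw [h]
  simp

lemma vertHess_injective (hz : z ∈ slitDomain O) {v w : E}
    (h : ∀ a, vertHess L z v a = vertHess L z w a) : v = w := by
  rw [← sub_eq_zero]
  refine hL.nondeg z hz _ fun a => ?_
  rw [map_sub, sub_apply, h, sub_self]

/-- The Euler-Lagrange equations. -/
lemma fderiv_momentum_spray (hz : z ∈ slitDomain O) (w : E) :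
    fderiv ℝ (momentum L) z (z.2, accel L z) w = fderiv ℝ L z (w, 0) := by
  have h := hL.vertHess_accel hz w
  have h2 : (z.2, accel L z) = (z.2, (0 : E)) + ((0 : E), accel L z) := by simp
  rw [h2, map_add, add_apply]
  change _ + vertHess L z (accel L z) w = _
  rw [h]; ring

/-- The spray is the only solution of `i_S dd_J L = -dL`. -/
lemma spray_equation_iff (hz : z ∈ slitDomain O) (S : E × E) :
    (∀ c : E × E, fderiv ℝ (momentum L) z S c.1 - fderiv ℝ (momentum L) z c S.1 =
      -fderiv ℝ L z c) ↔ S = (z.2, accel L z) := by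
  constructor
  · intro h
    obtain ⟨s, t⟩ := S
    have hs : s = z.2 := by
      refine hL.vertHess_injective hz fun b => ?_
      have := h (0, b)
      simp only [map_zero, zero_sub, neg_inj] at this
      rw [hL.vertHess_comm hz, hL.vertHess_self hz]
      exact this
    subst hs
    refine Prod.ext rfl (hL.vertHess_injective hz fun w => ?_)
    have h1 := h (w, 0)
    simp only at h1
    rw [hL.fderiv_momentum_self hz] at h1
    have h2 : (z.2, t) = (z.2, (0 : E)) + ((0 : E), t) := by simp
    rw [h2, map_add, add_apply] at h1
    change _ + vertHess L z t w - _ = _ at h1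
    rw [hL.vertHess_accel hz]
    linarith
  · rintro rfl ⟨a, b⟩
    simp only
    rw [hL.fderiv_momentum_spray hz]
    have h2 : (a, b) = (a, (0 : E)) + ((0 : E), b) := by simp
    rw [h2, map_add, map_add, add_apply, hL.fderiv_momentum_self hz]
    change _ - (_ + vertHess L z b z.2) = -(_ + momentum L z b)
    rw [hL.vertHess_comm hz, hL.vertHess_self hz]
    ring

lemma smooth_accel (hz : z ∈ slitDomain O) : ContDiffAt ℝ ∞ (accel L) z := by
  obtain ⟨A, hA⟩ := hL.vertHess_isInvertible hz
  have h1 : ContDiffAt ℝ ∞ ContinuousLinearMap.inverse (vertHess L z) := by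
    rw [← hA]; exact contDiffAt_map_inverse A
  have h2 : ContDiffAt ℝ ∞ (fun z => (vertHess L z).inverse) z := h1.comp z (hL.smooth_vertHess hz)
  exact h2.clm_apply (((contDiffAt_fderiv_infty (hL.smooth z hz)).clm_comp contDiffAt_const).sub
    ((contDiffAt_fderiv_infty (hL.smooth_momentum hz)).clm_apply
      (contDiffAt_snd.prodMk contDiffAt_const)))

lemma smooth_conn (hz : z ∈ slitDomain O) : ContDiffAt ℝ ∞ (conn L) z :=
  ((contDiffAt_fderiv_infty (hL.smooth_accel hz)).clm_comp contDiffAt_const).const_smul _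

lemma smooth_horLift (hz : z ∈ slitDomain O) (a : E) : ContDiffAt ℝ ∞ (horLift L a) z :=
  contDiffAt_const.prodMk ((hL.smooth_conn hz).clm_apply contDiffAt_const).neg

lemma smooth_curv (hz : z ∈ slitDomain O) (a b : E) :
    ContDiffAt ℝ ∞ (fun z => curv L z a b) z :=
  have h := contDiffAt_fderiv_infty (hL.smooth_conn hz)
  ((h.clm_apply (hL.smooth_horLift hz b)).clm_apply contDiffAt_const).sub
    ((h.clm_apply (hL.smooth_horLift hz a)).clm_apply contDiffAt_const)

/-- The vertical part of the spray is homogeneous of degree two along the fibres, by uniqueness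
of the solution of the Euler-Lagrange equations. -/
lemma accel_scale (hz : z ∈ slitDomain O) {c : ℝ} (hc : 0 < c) :
    accel L (fibreScale c z) = c ^ 2 • accel L z := by
  have hz' := fibreScale_mem hc hz
  refine hL.vertHess_injective hz' fun w => ?_
  have h0 : vertHess L (fibreScale c z) (c ^ 2 • accel L z) w =
      c ^ 2 * vertHess L z (accel L z) w := by
    have h := hL.fderiv_momentum_scale hz hc (0, c • accel L z)
    have h1 : fibreScale c ((0 : E), c • accel L z) = (0, c ^ 2 • accel L z) := by
      simp [smul_smul, sq]
    have h2 : ((0 : E), c • accel L z) = c • ((0 : E), accel L z) := by simp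
    rw [h1, h2, map_smul] at h
    refine (congrArg (fun A => A w) h).trans ?_
    simp only [smul_apply, smul_eq_mul]
    rw [← mul_assoc, ← pow_succ]
    rfl
  rw [h0, hL.vertHess_accel hz, hL.vertHess_accel hz']
  have h3 := fderiv_fibreScale hL.isOpen hc (k := 2) (fun z hz => hL.homog z hz c hc)
    (fun z hz => differentiableAt_of_infty (hL.smooth z hz)) hz (w, 0)
  have h4 := hL.fderiv_momentum_scale hz hc (c • z.2, 0)
  have h5 : ((c • z.2, (0 : E))) = c • (z.2, (0 : E)) := by simp
  rw [h5, map_smul, map_smul] at h4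
  have h6 := congrArg (fun A => A w) h4
  simp only [fibreScale_apply, smul_zero, smul_apply, smul_eq_mul,
    Prod.smul_mk] at h3 h6 ⊢
  simp only [h5, map_smul, smul_apply, smul_eq_mul] at h6 ⊢
  rw [h3, h6]
  ring

lemma conn_scale (hz : z ∈ slitDomain O) {c : ℝ} (hc : 0 < c) :
    conn L (fibreScale c z) = c ^ 1 • conn L z := by
  ext1 w
  have h := fderiv_fibreScale hL.isOpen hc (fun z hz => hL.accel_scale hz hc)
    (fun z hz => differentiableAt_of_infty (hL.smooth_accel hz)) hz (0, c⁻¹ • w)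
  have h1 : fibreScale c ((0 : E), c⁻¹ • w) = (0, w) := by simp [hc.ne']
  have h2 : ((0 : E), c⁻¹ • w) = c⁻¹ • ((0 : E), w) := by simp
  rw [h1, h2, map_smul] at h
  simp only [conn, ContinuousLinearMap.comp_apply, ContinuousLinearMap.inr_apply,
    smul_apply] at h ⊢
  rw [h, smul_smul, smul_smul, smul_smul]
  congr 1
  field_simp

/-- The curvature is homogeneous of degree one along the fibres. -/
lemma curv_scale (hz : z ∈ slitDomain O) {c : ℝ} (hc : 0 < c) (a b : E) :
    curv L (fibreScale c z) a b = c ^ 1 • curv L z a b := by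
  have h := fderiv_fibreScale hL.isOpen hc (fun z hz => hL.conn_scale hz hc)
    (fun z hz => differentiableAt_of_infty (hL.smooth_conn hz)) hz
  have h1 : ∀ a, horLift L a (fibreScale c z) = fibreScale c (horLift L a z) := by
    intro a
    simp only [horLift, hL.conn_scale hz hc, pow_one]
    simp
  rw [curv, h1, h1, h, h, curv, smul_sub]
  rfl

/-- Symmetry of `∂²Gⁱ/∂yʲ∂yᵏ`. -/
lemma fderiv_conn_comm (hz : z ∈ slitDomain O) (a b : E) :
    fderiv ℝ (conn L) z (0, a) b = fderiv ℝ (conn L) z (0, b) a := by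
  have h : ∀ a b, fderiv ℝ (conn L) z (0, a) b =
      (-(1 / 2) : ℝ) • fderiv ℝ (fderiv ℝ (accel L)) z (0, a) (0, b) := by
    intro a b
    have hd := differentiableAt_of_infty (contDiffAt_fderiv_infty (hL.smooth_accel hz))
    rw [← fderiv_clm_apply_const (differentiableAt_of_infty (hL.smooth_conn hz)),
      ← fderiv_clm_apply_const hd]
    change fderiv ℝ (fun z => (-(1 / 2) : ℝ) • fderiv ℝ (accel L) z (0, b)) z (0, a) = _
    rw [fderiv_fun_const_smul (hd.clm_apply (differentiableAt_const _))]
    rfl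
  rw [h, h, fderiv_fderiv_comm (hL.smooth_accel hz)]

/-- The spray is tangent to the level sets of `L`. -/
lemma fderiv_spray (hz : z ∈ slitDomain O) : fderiv ℝ L z (z.2, accel L z) = 0 := by
  have h2 : (z.2, accel L z) = (z.2, (0 : E)) + ((0 : E), accel L z) := by simp
  rw [h2, map_add]
  change _ + momentum L z (accel L z) = 0
  rw [← hL.vertHess_self hz, hL.vertHess_comm hz, hL.vertHess_accel hz, hL.fderiv_momentum_self hz]
  ring

/-- `L` is constant along horizontal curves. -/
lemma fderiv_horLift (hz : z ∈ slitDomain O) (a : E) : fderiv ℝ L z (horLift L a z) = 0 := by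
  have h1 := (differentiableAt_of_infty
    (contDiffAt_fderiv_infty (hL.smooth z hz))).hasFDerivAt.clm_apply
    ((hasFDerivAt_snd (𝕜 := ℝ) (E := E) (F := E) (p := z)).prodMk
      (differentiableAt_of_infty (hL.smooth_accel hz)).hasFDerivAt)
  have h2 : HasFDerivAt (fun z : E × E => fderiv ℝ L z (z.2, accel L z))
      (0 : E × E →L[ℝ] ℝ) z :=
    (hasFDerivAt_const (0 : ℝ) z).congr_of_eventuallyEq (by
      filter_upwards [hL.eventually_mem hz] with w hw using hL.fderiv_spray hw)
  have h3 := congrArg (fun A => A (0, a)) (h1.unique h2)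
  have h4 := hL.fderiv_momentum_spray hz a
  rw [hL.fderiv_momentum hz, fderiv_fderiv_comm (hL.smooth z hz)] at h4
  simp only [add_apply, ContinuousLinearMap.comp_apply,
    ContinuousLinearMap.flip_apply, ContinuousLinearMap.prod_apply,
    ContinuousLinearMap.coe_snd', zero_apply] at h3
  rw [h4] at h3
  -- the vertical derivative of `S L = 0` and the Euler-Lagrange equations add up to `2 δL = 0`
  have h5 : (a, fderiv ℝ (accel L) z (0, a)) + (a, (0 : E)) = (2 : ℝ) • horLift L a z := by
    simp only [horLift, conn, two_smul, smul_apply, ContinuousLinearMap.comp_apply,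
      ContinuousLinearMap.inr_apply, Prod.mk_add_mk, add_zero]
    congr 1
    module
  have h6 := congrArg (fderiv ℝ L z) h5
  rw [map_add, map_smul, h3, smul_eq_mul] at h6
  linarith

lemma fderiv_horLift_apply (hz : z ∈ slitDomain O) (a : E) (d : E × E) :
    fderiv ℝ (horLift L a) z d = (0, -fderiv ℝ (conn L) z d a) := by
  have h : HasFDerivAt (horLift L a) _ z := (hasFDerivAt_const (𝕜 := ℝ) a z).prodMk
    ((differentiableAt_of_infty (hL.smooth_conn hz)).hasFDerivAt.clm_apply
      (hasFDerivAt_const (𝕜 := ℝ) a z)).neg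
  rw [h.fderiv]
  simp

/-- The derivative of `fderiv_horLift`. -/
lemma fderiv_fderiv_horLift (hz : z ∈ slitDomain O) (a : E) (d : E × E) :
    fderiv ℝ (fderiv ℝ L) z d (horLift L a z) = momentum L z (fderiv ℝ (conn L) z d a) := by
  have h1 := (differentiableAt_of_infty
    (contDiffAt_fderiv_infty (hL.smooth z hz))).hasFDerivAt.clm_apply
    (differentiableAt_of_infty (hL.smooth_horLift hz a)).hasFDerivAt
  have h2 : HasFDerivAt (fun z : E × E => fderiv ℝ L z (horLift L a z)) (0 : E × E →L[ℝ] ℝ) z :=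
    (hasFDerivAt_const (0 : ℝ) z).congr_of_eventuallyEq (by
      filter_upwards [hL.eventually_mem hz] with w hw using hL.fderiv_horLift hw a)
  have h3 := congrArg (fun A => A d) (h1.unique h2)
  simp only [add_apply, ContinuousLinearMap.comp_apply,
    ContinuousLinearMap.flip_apply, zero_apply, hL.fderiv_horLift_apply hz] at h3
  have h4 : fderiv ℝ L z ((0 : E), -fderiv ℝ (conn L) z d a) =
      -momentum L z (fderiv ℝ (conn L) z d a) := by
    rw [show ((0 : E), -fderiv ℝ (conn L) z d a) = -((0 : E), fderiv ℝ (conn L) z d a) by simp,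
      map_neg]
    rfl
  rw [h4] at h3
  linarith

/-- `yₘ Rᵐ_{jk} = 0`. -/
lemma momentum_curv (hz : z ∈ slitDomain O) (a b : E) : momentum L z (curv L z a b) = 0 := by
  rw [curv, map_sub, ← hL.fderiv_fderiv_horLift hz, ← hL.fderiv_fderiv_horLift hz,
    fderiv_fderiv_comm (hL.smooth z hz), sub_self]

/-- The derivatives of the momentum along horizontal lifts are symmetric. -/
lemma fderiv_momentum_horLift (hz : z ∈ slitDomain O) (a c : E) :
    fderiv ℝ (momentum L) z (horLift L c z) a = momentum L z (fderiv ℝ (conn L) z (0, a) c) := by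
  rw [hL.fderiv_momentum hz, fderiv_fderiv_comm (hL.smooth z hz), hL.fderiv_fderiv_horLift hz]

lemma fderiv_curv (hz : z ∈ slitDomain O) (a b : E) (d : E × E) :
    fderiv ℝ (fun z => curv L z a b) z d =
      fderiv ℝ (fderiv ℝ (conn L)) z d (horLift L b z) a -
        fderiv ℝ (conn L) z (0, fderiv ℝ (conn L) z d b) a -
      (fderiv ℝ (fderiv ℝ (conn L)) z d (horLift L a z) b -
        fderiv ℝ (conn L) z (0, fderiv ℝ (conn L) z d a) b) := by
  have h := differentiableAt_of_infty (contDiffAt_fderiv_infty (hL.smooth_conn hz))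
  have key : ∀ a b, HasFDerivAt (fun z => fderiv ℝ (conn L) z (horLift L b z) a) _ z := fun a b =>
    (h.hasFDerivAt.clm_apply
      (differentiableAt_of_infty (hL.smooth_horLift hz b)).hasFDerivAt).clm_apply
      (hasFDerivAt_const (𝕜 := ℝ) a z)
  have h2 := ((key a b).sub (key b a)).fderiv
  have h3 : ∀ w : E, ((0 : E), -w) = -((0 : E), w) := by intro w; simp
  rw [show (fun z => curv L z a b) = fun z => fderiv ℝ (conn L) z (horLift L b z) a -
    fderiv ℝ (conn L) z (horLift L a z) b from rfl]
  refine (congrArg (fun A => A d) h2).trans ?_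
  simp only [sub_apply, add_apply, ContinuousLinearMap.comp_apply, ContinuousLinearMap.flip_apply,
    zero_apply, map_zero, zero_add, hL.fderiv_horLift_apply hz, h3, map_neg, neg_apply]
  abel

lemma fderiv_fderiv_conn_comm (hz : z ∈ slitDomain O) (a c : E) (d : E × E) :
    fderiv ℝ (fderiv ℝ (conn L)) z d (0, c) a = fderiv ℝ (fderiv ℝ (conn L)) z d (0, a) c := by
  have h := differentiableAt_of_infty (contDiffAt_fderiv_infty (hL.smooth_conn hz))
  have key : ∀ a c, fderiv ℝ (fderiv ℝ (conn L)) z d (0, c) a =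
      fderiv ℝ (fun z => fderiv ℝ (conn L) z (0, c) a) z d := by
    intro a c
    rw [fderiv_clm_apply_const (h.clm_apply (differentiableAt_const _)),
      fderiv_clm_apply_const h]
  rw [key, key]
  have : (fun z => fderiv ℝ (conn L) z (0, c) a) =ᶠ[𝓝 z] fun z => fderiv ℝ (conn L) z (0, a) c := by
    filter_upwards [hL.eventually_mem hz] with w hw using hL.fderiv_conn_comm hw c a
  rw [this.fderiv_eq]

/-- The vertical Bianchi identity. -/
lemma bianchi_vertical (hz : z ∈ slitDomain O) (a b c : E) :
    fderiv ℝ (fun z => curv L z a b) z (0, c) + fderiv ℝ (fun z => curv L z b c) z (0, a) +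
      fderiv ℝ (fun z => curv L z c a) z (0, b) = 0 := by
  have hs := fderiv_fderiv_comm (hL.smooth_conn hz)
  have h1 : ∀ a b c, fderiv ℝ (fderiv ℝ (conn L)) z (0, c) (horLift L b z) a =
      fderiv ℝ (fderiv ℝ (conn L)) z (0, a) (horLift L b z) c := by
    intro a b c
    rw [hs, hL.fderiv_fderiv_conn_comm hz, hs]
  rw [hL.fderiv_curv hz, hL.fderiv_curv hz, hL.fderiv_curv hz, h1 a b c, h1 b a c, h1 b c a,
    hL.fderiv_conn_comm hz c b, hL.fderiv_conn_comm hz c a, hL.fderiv_conn_comm hz b a]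
  abel

/-- The horizontal Bianchi identity. -/
lemma bianchi_horizontal (hz : z ∈ slitDomain O) (a b c : E) :
    (fderiv ℝ (fun z => curv L z a b) z (horLift L c z) +
        fderiv ℝ (conn L) z (0, curv L z a b) c) +
      (fderiv ℝ (fun z => curv L z b c) z (horLift L a z) +
        fderiv ℝ (conn L) z (0, curv L z b c) a) +
      (fderiv ℝ (fun z => curv L z c a) z (horLift L b z) +
        fderiv ℝ (conn L) z (0, curv L z c a) b) = 0 := by
  have hs := fderiv_fderiv_comm (hL.smooth_conn hz)
  have h3 : ∀ v w : E, ((0 : E), v - w) = ((0 : E), v) - ((0 : E), w) := by intro v w; simp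
  rw [hL.fderiv_curv hz, hL.fderiv_curv hz, hL.fderiv_curv hz]
  simp only [curv, h3, map_sub, sub_apply]
  rw [hs (horLift L c z) (horLift L b z), hs (horLift L c z) (horLift L a z),
    hs (horLift L b z) (horLift L a z)]
  abel

end IsFinslerEnergy

end Flat

/-! ### The Jacobi endomorphism determines the curvature -/

section Flat

variable {E : Type*} [NormedAddCommGroup E] [NormedSpace ℝ E]

section

variable (L : E × E → ℝ) (z : E × E)

lemma curv_swap (a b : E) : curv L z b a = -curv L z a b := by simp [curv]

lemma curv_self (a : E) : curv L z a a = 0 := by simp [curv]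

lemma horLift_add (a b : E) : horLift L (a + b) z = horLift L a z + horLift L b z := by
  simp [horLift, add_comm]

lemma horLift_smul (c : ℝ) (a : E) : horLift L (c • a) z = c • horLift L a z := by
  simp [horLift]

lemma curv_add_right (a b c : E) : curv L z a (b + c) = curv L z a b + curv L z a c := by
  simp only [curv, horLift_add, map_add, add_apply]
  abel

lemma curv_smul_right (r : ℝ) (a b : E) : curv L z a (r • b) = r • curv L z a b := by
  simp only [curv, horLift_smul, map_smul, smul_apply, smul_sub]

lemma curv_add_left (a b c : E) : curv L z (a + b) c = curv L z a c + curv L z b c := by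
  rw [curv_swap, curv_add_right, curv_swap L z a, curv_swap L z b, neg_add]
  simp

lemma curv_smul_left (r : ℝ) (a b : E) : curv L z (r • a) b = r • curv L z a b := by
  rw [curv_swap, curv_smul_right, curv_swap L z a]
  simp

/-- The linear map `a ↦ curv L z a b`. -/
def curvRight (b : E) : E →L[ℝ] E :=
  fderiv ℝ (conn L) z (horLift L b z) -
    ((ContinuousLinearMap.apply ℝ E b).comp (fderiv ℝ (conn L) z)).comp
      (ContinuousLinearMap.inl ℝ E E -
      (ContinuousLinearMap.inr ℝ E E).comp (conn L z))

lemma curvRight_apply (a b : E) : curvRight L z b a = curv L z a b := by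
  have h : horLift L a z = (a, 0) - (0, conn L z a) := by simp [horLift]
  simp only [curv, h, map_sub]
  simp [curvRight]

end

namespace IsFinslerEnergy

variable {O : Set E} {L : E × E → ℝ} (hL : IsFinslerEnergy O L) {z : E × E}

include hL

variable [FiniteDimensional ℝ E]

lemma differentiableAt_curvRight (hz : z ∈ slitDomain O) (b : E) :
    DifferentiableAt ℝ (fun z => curvRight L z b) z := by
  have h := differentiableAt_of_infty (contDiffAt_fderiv_infty (hL.smooth_conn hz))
  exact (h.clm_apply (differentiableAt_of_infty (hL.smooth_horLift hz b))).sub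
    (((differentiableAt_const _).clm_comp h).clm_comp ((differentiableAt_const _).sub
      ((differentiableAt_const _).clm_comp (differentiableAt_of_infty (hL.smooth_conn hz)))))

/-- The vertical derivative of the Jacobi endomorphism `curv L z z.2 b`, in which `z` occurs
twice. -/
lemma hasFDerivAt_curv_snd (hz : z ∈ slitDomain O) (b : E) :
    ∃ A : E × E →L[ℝ] E, HasFDerivAt (fun z => curv L z z.2 b) A z ∧
      ∀ a, A (0, a) = fderiv ℝ (fun w => curv L w z.2 b) z (0, a) + curv L z a b := by
  have h := hL.differentiableAt_curvRight hz b
  have h1 := h.hasFDerivAt.clm_apply (hasFDerivAt_snd (𝕜 := ℝ) (E := E) (F := E) (p := z))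
  simp only [curvRight_apply] at h1
  refine ⟨_, h1, fun a => ?_⟩
  have h2 := fderiv_clm_apply_const h z.2 (0, a)
  simp only [curvRight_apply] at h2
  rw [h2]
  simp [curvRight_apply, add_comm]

/-- The cyclic identity `g_{ml} Rᵐ_{jk} + g_{mj} Rᵐ_{kl} + g_{mk} Rᵐ_{lj} = 0`. -/
lemma vertHess_curv_cyclic (hz : z ∈ slitDomain O) (a b c : E) :
    vertHess L z c (curv L z a b) + vertHess L z a (curv L z b c) +
      vertHess L z b (curv L z c a) = 0 := by
  have key : ∀ a b c, vertHess L z c (curv L z a b) +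
      momentum L z (fderiv ℝ (fun z => curv L z a b) z (0, c)) = 0 := by
    intro a b c
    have h1 := (differentiableAt_of_infty (hL.smooth_momentum hz)).hasFDerivAt.clm_apply
      (differentiableAt_of_infty (hL.smooth_curv hz a b)).hasFDerivAt
    have h2 : HasFDerivAt (fun z : E × E => momentum L z (curv L z a b)) (0 : E × E →L[ℝ] ℝ) z :=
      (hasFDerivAt_const (0 : ℝ) z).congr_of_eventuallyEq (by
        filter_upwards [hL.eventually_mem hz] with w hw using hL.momentum_curv hw a b)
    have h3 := congrArg (fun A => A (0, c)) (h1.unique h2)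
    simp only [add_apply, ContinuousLinearMap.comp_apply, ContinuousLinearMap.flip_apply,
      zero_apply] at h3
    rw [add_comm]
    exact h3
  have hb := congrArg (momentum L z) (hL.bianchi_vertical hz a b c)
  rw [map_add, map_add, map_zero] at hb
  linarith [key a b c, key b c a, key c a b]

/-- The Jacobi endomorphism is self-adjoint. -/
lemma vertHess_curv_comm (hz : z ∈ slitDomain O) (v w : E) :
    vertHess L z v (curv L z z.2 w) = vertHess L z w (curv L z z.2 v) := by
  have h := hL.vertHess_curv_cyclic hz z.2 w v
  rw [hL.vertHess_self hz, hL.momentum_curv hz, curv_swap L z z.2 v, map_neg] at h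
  linarith

/-- By polarization, the flag curvature at a point determines the Jacobi endomorphism there. -/
lemma curv_eq_of_quadratic (hz : z ∈ slitDomain O) {κ : ℝ}
    (h : ∀ v, LinearIndependent ℝ ![z.2, v] → vertHess L z v (curv L z z.2 v) =
      κ * (L z * vertHess L z v v - momentum L z v ^ 2 / 2)) (v : E) :
    curv L z z.2 v = κ • (L z • v - (momentum L z v / 2) • z.2) := by
  have h' : ∀ v, vertHess L z v (curv L z z.2 v) =
      κ * (L z * vertHess L z v v - momentum L z v ^ 2 / 2) := by
    intro v
    by_cases hv : LinearIndependent ℝ ![z.2, v]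
    · exact h v hv
    · rw [LinearIndependent.pair_iff' hz.2] at hv
      push Not at hv
      obtain ⟨c, rfl⟩ := hv
      simp only [curv_smul_right, curv_self, smul_zero, map_zero, map_smul, smul_apply,
        hL.vertHess_self hz, hL.momentum_self hz, smul_eq_mul]
      ring
  refine hL.vertHess_injective hz fun w => ?_
  have h1 := h' (v + w)
  have h2 := h' v
  have h3 := h' w
  have h4 := hL.vertHess_curv_comm hz v w
  have h5 := hL.vertHess_comm hz v w
  simp only [curv_add_right, map_add, add_apply] at h1
  rw [hL.vertHess_comm hz]
  simp only [map_smul, map_sub, smul_apply, sub_apply, hL.vertHess_self hz, smul_eq_mul]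
  linear_combination (h1 - h2 - h3 - h4 - κ * L z * h5) / 2

/-- The curvature is determined by the Jacobi endomorphism on the fibre. -/
lemma curv_eq_of_fibre {κ : ℝ} {x : E} (hx : x ∈ O)
    (h : ∀ y : E, y ≠ 0 → ∀ v, curv L (x, y) y v =
      κ • (L (x, y) • v - (momentum L (x, y) v / 2) • y)) {y : E} (hy : y ≠ 0) (a b : E) :
    curv L (x, y) a b =
      (κ / 2) • (momentum L (x, y) a • b - momentum L (x, y) b • a) := by
  have hz : (x, y) ∈ slitDomain O := ⟨hx, hy⟩
  have key : ∀ a b, fderiv ℝ (fun w => curv L w y b) (x, y) (0, a) + curv L (x, y) a b =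
      κ • (momentum L (x, y) a • b - ((vertHess L (x, y) a b / 2) • y +
        (momentum L (x, y) b / 2) • a)) := by
    intro a b
    obtain ⟨A, hA, hA'⟩ := hL.hasFDerivAt_curv_snd hz b
    have hι : HasFDerivAt (fun y : E => (x, y)) (ContinuousLinearMap.inr ℝ E E) y := by
      have := (hasFDerivAt_const (𝕜 := ℝ) x y).prodMk (hasFDerivAt_id y)
      convert! this using 1
    have h1 : HasFDerivAt (fun y => curv L (x, y) y b)
      (A.comp (ContinuousLinearMap.inr ℝ E E)) y := HasFDerivAt.comp y hA hι
    have hLd : HasFDerivAt (fun y => L (x, y)) ((fderiv ℝ L (x, y)).comp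
      (ContinuousLinearMap.inr ℝ E E)) y :=
      HasFDerivAt.comp y (differentiableAt_of_infty (hL.smooth _ hz)).hasFDerivAt hι
    have hpd : HasFDerivAt (fun y => momentum L (x, y)) ((fderiv ℝ (momentum L) (x, y)).comp
      (ContinuousLinearMap.inr ℝ E E)) y :=
      HasFDerivAt.comp y (differentiableAt_of_infty (hL.smooth_momentum hz)).hasFDerivAt hι
    have h2 := ((hLd.smul_const b).sub (((hpd.clm_apply
      (hasFDerivAt_const b y)).mul_const (2⁻¹ : ℝ)).smul (hasFDerivAt_id y))).const_smul κ
    have h3 : (fun y => curv L (x, y) y b) =ᶠ[𝓝 y]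
        fun y => κ • (L (x, y) • b - (momentum L (x, y) b * 2⁻¹) • y) := by
      filter_upwards [isOpen_compl_singleton.mem_nhds hy] with y' hy'
      rw [h y' hy', div_eq_mul_inv]
    have h4 := congrArg (fun A => A a) ((h1.congr_of_eventuallyEq h3.symm).unique h2)
    simp only [ContinuousLinearMap.comp_apply, ContinuousLinearMap.inr_apply, hA'] at h4
    rw [h4]
    simp only [smul_apply, sub_apply, add_apply, ContinuousLinearMap.smulRight_apply,
      ContinuousLinearMap.comp_apply, ContinuousLinearMap.inr_apply, zero_apply, map_zero,
      ContinuousLinearMap.flip_apply, zero_add, id_eq, ContinuousLinearMap.id_apply]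
    change κ • (momentum L (x, y) a • b - ((momentum L (x, y) b * 2⁻¹) • a +
      ((2⁻¹ : ℝ) • vertHess L (x, y) a b) • y)) = _
    simp only [smul_eq_mul, div_eq_mul_inv, mul_comm]
    module
  have hb := hL.bianchi_vertical hz a b y
  have hab := key a b
  have hba := key b a
  have he : fderiv ℝ (fun z => curv L z a b) (x, y) (0, y) = curv L (x, y) a b := by
    have := fderiv_liouville (k := 1) (fun c hc => hL.curv_scale hz hc a b)
      (differentiableAt_of_infty (hL.smooth_curv hz a b))
    simpa using this
  have hs : fderiv ℝ (fun z => curv L z b y) (x, y) (0, a) =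
      -fderiv ℝ (fun w => curv L w y b) (x, y) (0, a) := by
    have : (fun z => curv L z b y) = fun z => -curv L z y b := by
      ext1 z; rw [curv_swap]
    rw [this, fderiv_fun_neg]
    rfl
  rw [he, hs] at hb
  rw [curv_swap L _ a b, hL.vertHess_comm hz b a] at hba
  -- the vertical Bianchi identity for `a`, `b`, `y` contributes one `curv` by homogeneity and two
  -- more from the derivatives of `curv z z.2 b` and `curv z z.2 a`
  have h3 : (3 : ℝ) • curv L (x, y) a b =
      κ • (momentum L (x, y) a • b - ((vertHess L (x, y) a b / 2) • y +
        (momentum L (x, y) b / 2) • a)) -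
      κ • (momentum L (x, y) b • a - ((vertHess L (x, y) a b / 2) • y +
        (momentum L (x, y) a / 2) • b)) := by
    rw [← hab, ← hba]
    linear_combination (norm := module) hb
  have h4 : curv L (x, y) a b = (3⁻¹ : ℝ) • ((3 : ℝ) • curv L (x, y) a b) := by
    rw [smul_smul]; norm_num
  rw [h4, h3]
  module

end IsFinslerEnergy

end Flat

/-! ### Positive definiteness and the Schur lemma -/

/-- The second order necessary condition for a local minimum. -/
lemma deriv_deriv_nonneg_of_isLocalMin {f : ℝ → ℝ} {x : ℝ} (hf : IsLocalMin f x)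
    (hc : ContinuousAt f x) : 0 ≤ deriv (deriv f) x := by
  by_contra! h
  have hmax := isLocalMax_of_deriv_deriv_neg h hf.deriv_eq_zero hc
  have heq : f =ᶠ[𝓝 x] fun _ => f x := by
    filter_upwards [hf, hmax] with y h1 h2 using le_antisymm h2 h1
  have h1 : deriv f =ᶠ[𝓝 x] fun _ => 0 := by
    filter_upwards [heq.eventuallyEq_nhds] with y hy
    rw [hy.deriv_eq, deriv_const]
  rw [h1.deriv_eq, deriv_const] at h
  exact lt_irrefl _ h

section PosDef

variable {E : Type*} [NormedAddCommGroup E] [InnerProductSpace ℝ E]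

namespace IsFinslerEnergy

variable {O : Set E} {L : E × E → ℝ} (hL : IsFinslerEnergy O L)

include hL

/-- The restriction of `L` to a line in a fibre has the expected derivatives. -/
lemma hasDerivAt_fibre_line {x y : E} (hx : x ∈ O) (v : E) (s : ℝ)
    (hs : y + s • v ≠ 0) :
    HasDerivAt (fun s : ℝ => L (x, y + s • v)) (momentum L (x, y + s • v) v) s ∧
    HasDerivAt (fun s : ℝ => momentum L (x, y + s • v) v) (vertHess L (x, y + s • v) v v) s := by
  have hz : (x, y + s • v) ∈ slitDomain O := ⟨hx, hs⟩
  have h0 : HasDerivAt (fun s : ℝ => (x, y + s • v)) ((0 : E), v) s := by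
    simpa using (hasDerivAt_const s x).prodMk (((hasDerivAt_id s).smul_const v).const_add y)
  refine ⟨(differentiableAt_of_infty (hL.smooth _ hz)).hasFDerivAt.comp_hasDerivAt s h0, ?_⟩
  have h1 := (differentiableAt_of_infty (hL.smooth_momentum hz)).hasFDerivAt.comp_hasDerivAt s h0
  have h2 := h1.clm_apply (hasDerivAt_const s v)
  simp only [map_zero, add_zero] at h2
  exact h2

/-- The Hessian is positive definite at a point of the fibre where `L / |y|²` is minimal. -/
lemma exists_vertHess_pos [FiniteDimensional ℝ E] [Nontrivial E] {x : E} (hx : x ∈ O) :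
    ∃ y : E, y ≠ 0 ∧ ∀ v, v ≠ 0 → 0 < vertHess L (x, y) v v := by
  have hne : ∀ y ∈ Metric.sphere (0 : E) 1, y ≠ 0 := by
    rintro y hy rfl
    simp at hy
  have hcont : ContinuousOn (fun y => L (x, y)) (Metric.sphere (0 : E) 1) := by
    intro y hy
    refine ContinuousAt.continuousWithinAt ?_
    exact ContinuousAt.comp (f := fun y : E => (x, y))
      (hL.smooth (x, y) ⟨hx, hne y hy⟩).continuousAt (by fun_prop)
  obtain ⟨y, hy, hmin⟩ := (isCompact_sphere (0 : E) 1).exists_isMinOn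
    (NormedSpace.sphere_nonempty.2 zero_le_one) hcont
  have hy0 := hne y hy
  have hyn : ‖y‖ = 1 := by simpa using hy
  set m := L (x, y) with hm
  have hmpos : 0 < m := hL.pos _ ⟨hx, hy0⟩
  have hmin' : ∀ w : E, w ≠ 0 → m * ‖w‖ ^ 2 ≤ L (x, w) := by
    intro w hw
    have hw' : 0 < ‖w‖ := norm_pos_iff.2 hw
    have h1 : ‖w‖⁻¹ • w ∈ Metric.sphere (0 : E) 1 := by
      simp [norm_smul, hw'.ne']
    have h2 : m ≤ L (x, ‖w‖⁻¹ • w) := hmin h1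
    have h3 := hL.homog (x, ‖w‖⁻¹ • w) ⟨hx, hne _ h1⟩ ‖w‖ hw'
    rw [smul_smul, mul_inv_cancel₀ hw'.ne', one_smul] at h3
    rw [h3]
    nlinarith [sq_nonneg ‖w‖]
  refine ⟨y, hy0, fun v hv => ?_⟩
  have hev : ∀ᶠ s : ℝ in 𝓝 0, y + s • v ≠ 0 := by
    have : ContinuousAt (fun s : ℝ => y + s • v) 0 := by fun_prop
    exact this.eventually_ne (by simpa using hy0)
  -- the function `k` has a minimum at `0`, as `m` is the minimum of `L / ‖y‖ ^ 2`
  set k : ℝ → ℝ := fun s => L (x, y + s • v) - m * ‖y + s • v‖ ^ 2 with hk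
  have hk1 : ∀ᶠ s : ℝ in 𝓝 0, HasDerivAt k
      (momentum L (x, y + s • v) v - m * (2 * inner ℝ (y + s • v) v)) s := by
    filter_upwards [hev] with s hs
    have h0 : HasDerivAt (fun s : ℝ => y + s • v) v s := by
      simpa using ((hasDerivAt_id s).smul_const v).const_add y
    exact (hL.hasDerivAt_fibre_line hx v s hs).1.sub (h0.norm_sq.const_mul m)
  have hk2 : HasDerivAt (deriv k) (vertHess L (x, y) v v - m * (2 * inner ℝ v v)) 0 := by
    have h0 : HasDerivAt (fun s : ℝ => y + s • v) v 0 := by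
      simpa using ((hasDerivAt_id (0 : ℝ)).smul_const v).const_add y
    have h1 := (hL.hasDerivAt_fibre_line hx v 0 (by simpa using hy0)).2.sub
      (((h0.inner ℝ (hasDerivAt_const (0 : ℝ) v)).const_mul 2).const_mul m)
    simp only [zero_smul, add_zero, inner_zero_right, zero_add] at h1
    refine h1.congr_of_eventuallyEq ?_
    filter_upwards [hk1] with s hs
    rw [hs.deriv]
    rfl
  have hmin0 : IsLocalMin k 0 := by
    filter_upwards [hev] with s hs
    have h1 := hmin' _ hs
    simp only [hk, zero_smul, add_zero, hyn, ← hm]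
    linarith
  have h2 := deriv_deriv_nonneg_of_isLocalMin hmin0 (hk1.self_of_nhds).continuousAt
  rw [hk2.deriv, real_inner_self_eq_norm_sq] at h2
  have h3 : 0 < ‖v‖ ^ 2 := by positivity
  nlinarith

variable [FiniteDimensional ℝ E]

/-- The metric tensor is positive definite: it is so somewhere in each fibre, and does not
degenerate along the connected slit fibre. -/
theorem vertHess_pos (hE : 1 < Module.finrank ℝ E) {z : E × E} (hz : z ∈ slitDomain O) {v : E}
    (hv : v ≠ 0) : 0 < vertHess L z v v := by
  obtain ⟨x, y⟩ := z
  have hx : x ∈ O := hz.1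
  have : Nontrivial E := Module.nontrivial_of_finrank_pos (R := ℝ) (by omega)
  have hconn : IsPreconnected ({0}ᶜ : Set E) :=
    (isConnected_compl_singleton_of_one_lt_rank
      (by rw [← Module.finrank_eq_rank]; exact_mod_cast hE) 0).isPreconnected
  have hcont : ∀ y : E, y ≠ 0 → ∀ w : E, ContinuousAt (fun p : E × E => vertHess L (x, p.1) p.2 p.2)
      (y, w) := by
    intro y hy w
    have h1 : ContinuousAt (fun p : E × E => vertHess L (x, p.1)) (y, w) :=
      ContinuousAt.comp (f := fun p : E × E => (x, p.1)) (g := vertHess L)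
        (hL.smooth_vertHess (z := (x, y)) ⟨hx, hy⟩).continuousAt (by fun_prop)
    exact (h1.clm_apply continuousAt_snd).clm_apply continuousAt_snd
  -- the sets where the Hessian is positive definite and where it takes a negative value are open
  -- and disjoint, and cover the fibre by nondegeneracy
  let A : Set E := {y | y ≠ 0 ∧ ∀ w ∈ Metric.sphere (0 : E) 1, 0 < vertHess L (x, y) w w}
  let B : Set E := {y | y ≠ 0 ∧ ∃ w, vertHess L (x, y) w w < 0}
  have hA : IsOpen A := by
    rw [isOpen_iff_mem_nhds]
    rintro y ⟨hy, hw⟩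
    filter_upwards [isOpen_compl_singleton.mem_nhds hy,
      (isCompact_sphere (0 : E) 1).eventually_forall_of_forall_eventually
      (P := fun y w => 0 < vertHess L (x, y) w w) (x₀ := y)
      fun w h => (hcont y hy w).eventually (lt_mem_nhds (hw w h))] with y' h1 h2 using ⟨h1, h2⟩
  have hB : IsOpen B := by
    rw [isOpen_iff_mem_nhds]
    rintro y ⟨hy, w, hw⟩
    have h := ContinuousAt.comp (f := fun y : E => (y, w)) (hcont y hy w) (by fun_prop)
    filter_upwards [isOpen_compl_singleton.mem_nhds hy, h.eventually (gt_mem_nhds hw)] with y' h1 h2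
      using ⟨h1, w, h2⟩
  have hsc : ∀ y : E, ∀ w : E, w ≠ 0 → ∃ w' ∈ Metric.sphere (0 : E) 1, ∃ c : ℝ, 0 < c ∧
      vertHess L (x, y) w w = c * vertHess L (x, y) w' w' := by
    intro y w hw
    have hw' : 0 < ‖w‖ := norm_pos_iff.2 hw
    refine ⟨‖w‖⁻¹ • w, by simp [norm_smul, hw'.ne'], ‖w‖ ^ 2, by positivity, ?_⟩
    simp only [map_smul, smul_apply, smul_eq_mul]
    field_simp
  have hAB : ({0}ᶜ : Set E) ⊆ A ∪ B := by
    intro y hy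
    by_cases hyB : y ∈ B
    · exact Or.inr hyB
    refine Or.inl ⟨hy, fun w hw => ?_⟩
    have hnn : ∀ w, 0 ≤ vertHess L (x, y) w w := by
      intro w
      by_contra! h
      exact hyB ⟨hy, w, h⟩
    refine lt_of_le_of_ne (hnn w) fun h0 => ?_
    have hz' : (x, y) ∈ slitDomain O := ⟨hx, hy⟩
    -- a null vector of a semidefinite form is in its kernel
    have hw0 : w = 0 := by
      refine hL.nondeg _ hz' w fun a => ?_
      have h1 : ∀ t : ℝ, 0 ≤ 2 * t * vertHess L (x, y) w a + t ^ 2 * vertHess L (x, y) a a := by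
        intro t
        have := hnn (w + t • a)
        simp only [map_add, map_smul, add_apply, smul_apply, smul_eq_mul, ← h0,
          hL.vertHess_comm hz' a w] at this
        linarith
      by_contra hne
      set p := vertHess L (x, y) w a
      set q := vertHess L (x, y) a a
      have hq : 0 ≤ q := hnn a
      have h2 := h1 (-p / (q + 1))
      have h3 : 2 * (-p / (q + 1)) * p + (-p / (q + 1)) ^ 2 * q =
          -(p ^ 2 * (q + 2)) / (q + 1) ^ 2 := by
        field_simp
        ring
      rw [h3] at h2
      have h4 : 0 < p ^ 2 * (q + 2) / (q + 1) ^ 2 := by positivity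
      rw [neg_div] at h2
      linarith
    rw [hw0] at hw
    simp at hw
  obtain ⟨y₀, hy₀, hpos⟩ := hL.exists_vertHess_pos hx
  have hyA : y ∈ A := by
    rcases hAB hz.2 with h | h
    · exact h
    exfalso
    obtain ⟨y', -, hy'A, hy'B⟩ := hconn A B hA hB hAB
      ⟨y₀, hy₀, hy₀, fun w hw => hpos w (by rintro rfl; simp at hw)⟩ ⟨y, hz.2, h⟩
    obtain ⟨-, w, hw⟩ := hy'B
    have hw0 : w ≠ 0 := by rintro rfl; simp at hw
    obtain ⟨w', hw', c, hc, h⟩ := hsc y' w hw0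
    rw [h] at hw
    have := mul_pos hc (hy'A.2 w' hw')
    linarith
  obtain ⟨w', hw', c, hc, h⟩ := hsc y v hv
  rw [h]
  exact mul_pos hc (hyA.2 w' hw')

/-- The denominator of the flag curvature is positive. -/
lemma flag_denominator_pos (hE : 1 < Module.finrank ℝ E) {z : E × E} (hz : z ∈ slitDomain O) {v : E}
    (hv : LinearIndependent ℝ ![z.2, v]) :
    0 < L z * vertHess L z v v - momentum L z v ^ 2 / 2 := by
  have hLz := hL.pos z hz
  -- the denominator is a multiple of the square of the part of `v` orthogonal to `y`
  have hne : (2 * L z) • v - momentum L z v • z.2 ≠ 0 := by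
    intro h
    rw [LinearIndependent.pair_iff] at hv
    have := (hv (-momentum L z v) (2 * L z) (by rw [neg_smul, ← h]; abel)).2
    linarith
  have h := hL.vertHess_pos hE hz hne
  simp only [map_sub, map_smul, sub_apply, smul_apply, smul_eq_mul, hL.vertHess_self hz,
    hL.vertHess_self_right hz, hL.momentum_self hz] at h
  have h2 : 0 < (4 * L z) * (L z * vertHess L z v v - momentum L z v ^ 2 / 2) := by linarith
  exact (pos_iff_pos_of_mul_pos h2).1 (by linarith)

end IsFinslerEnergy

end PosDef

section Schur

variable {E : Type*} [NormedAddCommGroup E] [NormedSpace ℝ E]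

/-- If `q ∧ p ∧ Id = 0` in dimension at least three, then `q ∧ p = 0`. -/
lemma wedge_eq_zero_of_cyclic [FiniteDimensional ℝ E] (hE : 2 < Module.finrank ℝ E) {p q : E → ℝ}
    (h : ∀ a b c : E, q c • (p a • b - p b • a) + q a • (p b • c - p c • b) +
      q b • (p c • a - p a • c) = 0) (a c : E) : q c * p a = q a * p c := by
  classical
  obtain ⟨b, hb⟩ : ∃ b, b ∉ Submodule.span ℝ (({a, c} : Finset E) : Set E) := by
    by_contra! hall
    have htop : Submodule.span ℝ (({a, c} : Finset E) : Set E) = ⊤ := by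
      rw [eq_top_iff]
      intro x _
      exact hall x
    have h1 := finrank_span_finset_le_card (R := ℝ) ({a, c} : Finset E)
    rw [Set.finrank, htop, finrank_top] at h1
    have h2 : ({a, c} : Finset E).card ≤ 2 := Finset.card_le_two
    omega
  by_contra hne
  have hd : q c * p a - q a * p c ≠ 0 := sub_ne_zero.2 hne
  apply hb
  have h1 : (q c * p a - q a * p c) • b =
      (q c * p b - q b * p c) • a + (q b * p a - q a * p b) • c := by
    linear_combination (norm := module) h a b c
  have h2 : b = (q c * p a - q a * p c)⁻¹ • ((q c * p b - q b * p c) • a +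
      (q b * p a - q a * p b) • c) := by
    rw [← h1, smul_smul, inv_mul_cancel₀ hd, one_smul]
  rw [h2]
  refine Submodule.smul_mem _ _ (Submodule.add_mem _ (Submodule.smul_mem _ _ ?_)
    (Submodule.smul_mem _ _ ?_)) <;> exact Submodule.subset_span (by simp)

lemma exists_ne_zero_apply_eq_zero [FiniteDimensional ℝ E] (hE : 1 < Module.finrank ℝ E)
    (p : E →L[ℝ] ℝ) : ∃ b, b ≠ 0 ∧ p b = 0 := by
  have h : p.toLinearMap.ker ≠ ⊥ := LinearMap.ker_ne_bot_of_finrank_lt (by simpa using hE)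
  obtain ⟨b, hb, hb0⟩ := Submodule.exists_mem_ne_zero_of_ne_bot h
  exact ⟨b, hb0, hb⟩

namespace IsFinslerEnergy

variable {O : Set E} {L : E × E → ℝ} (hL : IsFinslerEnergy O L) [FiniteDimensional ℝ E]
  {ρ : E × E → ℝ}

include hL

/-- The factor is differentiable, being a quotient of differentiable functions after the equation
is paired with a suitable covector. -/
lemma differentiableAt_curvature_factor (hE : 1 < Module.finrank ℝ E)
    (h : ∀ z ∈ slitDomain O, ∀ a b,
      curv L z a b = ρ z • (momentum L z a • b - momentum L z b • a)) {z : E × E}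
    (hz : z ∈ slitDomain O) : DifferentiableAt ℝ ρ z := by
  obtain ⟨b, hb0, hb⟩ := exists_ne_zero_apply_eq_zero hE (momentum L z)
  obtain ⟨ℓ, -, hℓ⟩ := exists_dual_vector ℝ b (norm_ne_zero_iff.2 hb0)
  have hden : DifferentiableAt ℝ
      (fun w => ℓ (momentum L w z.2 • b - momentum L w b • z.2)) z := by
    have hp := differentiableAt_of_infty (hL.smooth_momentum hz)
    exact ℓ.differentiableAt.comp z
      (((hp.clm_apply (differentiableAt_const _)).smul_const _).sub
        ((hp.clm_apply (differentiableAt_const _)).smul_const _))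
  have hne : ℓ (momentum L z z.2 • b - momentum L z b • z.2) ≠ 0 := by
    rw [hb, zero_smul, sub_zero, map_smul, hL.momentum_self hz, hℓ]
    have := hL.pos z hz
    have : 0 < ‖b‖ := norm_pos_iff.2 hb0
    simp only [smul_eq_mul, RCLike.ofReal_real_eq_id, id_eq]
    positivity
  have hnum : DifferentiableAt ℝ (fun w => ℓ (curv L w z.2 b)) z :=
    ℓ.differentiableAt.comp z (differentiableAt_of_infty (hL.smooth_curv hz z.2 b))
  refine (hnum.mul (hden.inv hne)).congr_of_eventuallyEq ?_
  filter_upwards [hL.eventually_mem hz, hden.continuousAt.eventually_ne hne] with w hw hw'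
  change ρ w = ℓ (curv L w z.2 b) * (ℓ (momentum L w z.2 • b - momentum L w b • z.2))⁻¹
  rw [h w hw, map_smul, smul_eq_mul, mul_inv_cancel_right₀ hw']

lemma fderiv_curv_of_factor (hE : 1 < Module.finrank ℝ E)
    (h : ∀ z ∈ slitDomain O, ∀ a b,
      curv L z a b = ρ z • (momentum L z a • b - momentum L z b • a)) {z : E × E}
    (hz : z ∈ slitDomain O) (a b : E) (d : E × E) :
    fderiv ℝ (fun z => curv L z a b) z d =
      fderiv ℝ ρ z d • (momentum L z a • b - momentum L z b • a) +
      ρ z • (fderiv ℝ (momentum L) z d a • b - fderiv ℝ (momentum L) z d b • a) := by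
  have hp := (differentiableAt_of_infty (hL.smooth_momentum hz)).hasFDerivAt
  have hρ := (hL.differentiableAt_curvature_factor hE h hz).hasFDerivAt
  have h1 := hρ.smul (((hp.clm_apply (hasFDerivAt_const a z)).smul_const b).sub
    ((hp.clm_apply (hasFDerivAt_const b z)).smul_const a))
  have h2 : (fun z => curv L z a b) =ᶠ[𝓝 z]
      fun z => ρ z • (momentum L z a • b - momentum L z b • a) := by
    filter_upwards [hL.eventually_mem hz] with w hw using h w hw a b
  rw [h2.fderiv_eq]
  refine (congrArg (fun A => A d) h1.fderiv).trans ?_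
  simp [add_comm]

/-- The factor does not depend on the direction, by the vertical Bianchi identity. -/
lemma fderiv_factor_vertical (hE : 2 < Module.finrank ℝ E)
    (h : ∀ z ∈ slitDomain O, ∀ a b,
      curv L z a b = ρ z • (momentum L z a • b - momentum L z b • a)) {z : E × E}
    (hz : z ∈ slitDomain O) (c : E) : fderiv ℝ ρ z (0, c) = 0 := by
  have hE1 : 1 < Module.finrank ℝ E := by omega
  have hw : ∀ a c, fderiv ℝ ρ z (0, c) * momentum L z a = fderiv ℝ ρ z (0, a) * momentum L z c := by
    refine wedge_eq_zero_of_cyclic hE (q := fun c => fderiv ℝ ρ z (0, c)) fun a b c => ?_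
    have hb := hL.bianchi_vertical hz a b c
    simp only [hL.fderiv_curv_of_factor hE1 h hz] at hb
    change _ + ρ z • (vertHess L z c a • b - vertHess L z c b • a) +
      (_ + ρ z • (vertHess L z a b • c - vertHess L z a c • b)) +
      (_ + ρ z • (vertHess L z b c • a - vertHess L z b a • c)) = 0 at hb
    rw [hL.vertHess_comm hz c a, hL.vertHess_comm hz b a, hL.vertHess_comm hz c b] at hb
    linear_combination (norm := module) hb
  have hLz := hL.pos z hz
  -- the factor is homogeneous of degree zero, as the curvature and the momentum
  -- both have degree one
  have h0 : fderiv ℝ ρ z (0, z.2) = 0 := by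
    have hρ : ∀ c : ℝ, 0 < c → ρ (fibreScale c z) = c ^ 0 • ρ z := by
      intro c hc
      obtain ⟨b, hb⟩ : ∃ b, momentum L z z.2 • b - momentum L z b • z.2 ≠ 0 := by
        obtain ⟨b, hb0, hb⟩ := exists_ne_zero_apply_eq_zero hE1 (momentum L z)
        refine ⟨b, ?_⟩
        rw [hb, zero_smul, sub_zero, hL.momentum_self hz]
        exact smul_ne_zero (by positivity) hb0
      have h1 := hL.curv_scale hz hc z.2 b
      rw [h z hz, h _ (fibreScale_mem hc hz), hL.momentum_scale hz hc] at h1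
      simp only [pow_one, smul_apply, smul_assoc, ← smul_sub] at h1
      rw [smul_comm] at h1
      have h2 := smul_right_injective E hc.ne' h1
      simpa using smul_left_injective ℝ hb h2
    have := fderiv_liouville hρ (hL.differentiableAt_curvature_factor hE1 h hz)
    simpa using this
  have h1 := hw z.2 c
  rw [h0, zero_mul, hL.momentum_self hz] at h1
  rcases mul_eq_zero.1 h1 with h2 | h2
  · exact h2
  · linarith

/-- Along horizontal directions the differential of the factor is proportional to the momentum,
by the horizontal Bianchi identity. -/
lemma fderiv_factor_horizontal (hE : 2 < Module.finrank ℝ E)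
    (h : ∀ z ∈ slitDomain O, ∀ a b,
      curv L z a b = ρ z • (momentum L z a • b - momentum L z b • a)) {z : E × E}
    (hz : z ∈ slitDomain O) (a c : E) :
    fderiv ℝ ρ z (c, 0) * momentum L z a = fderiv ℝ ρ z (a, 0) * momentum L z c := by
  have hE1 : 1 < Module.finrank ℝ E := by omega
  have hh : ∀ c, fderiv ℝ ρ z (horLift L c z) = fderiv ℝ ρ z (c, 0) := by
    intro c
    have : horLift L c z = (c, 0) + (0, -conn L z c) := by simp [horLift]
    rw [this, map_add, hL.fderiv_factor_vertical hE h hz, add_zero]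
  revert a c
  refine wedge_eq_zero_of_cyclic hE (q := fun c => fderiv ℝ ρ z (c, 0)) fun a b c => ?_
  have hb := hL.bianchi_horizontal hz a b c
  have hsm : ∀ (r s t : ℝ) (a b : E), ((0 : E), r • (s • b - t • a)) =
      r • (s • ((0 : E), b) - t • ((0 : E), a)) := by intros; simp
  simp only [hL.fderiv_curv_of_factor hE1 h hz, hL.fderiv_momentum_horLift hz, hh,
    h z hz, hsm, map_smul, map_sub, smul_apply, sub_apply] at hb
  rw [hL.fderiv_conn_comm hz c a, hL.fderiv_conn_comm hz c b, hL.fderiv_conn_comm hz b a] at hb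
  linear_combination (norm := module) hb

/-- **Schur's lemma**: the curvature factor is locally constant. -/
theorem factor_locally_const (hE : 2 < Module.finrank ℝ E)
    (h : ∀ z ∈ slitDomain O, ∀ a b,
      curv L z a b = ρ z • (momentum L z a • b - momentum L z b • a)) {x : E} (hx : x ∈ O) :
    ∃ W ∈ 𝓝 x, ∃ k : ℝ, ∀ x' ∈ W, ∀ y ≠ 0, ρ (x', y) = k := by
  have hE1 : 1 < Module.finrank ℝ E := by omega
  have : Nontrivial E := Module.nontrivial_of_finrank_pos (R := ℝ) (by omega)
  have hconn : IsPreconnected ({0}ᶜ : Set E) :=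
    (isConnected_compl_singleton_of_one_lt_rank
      (by rw [← Module.finrank_eq_rank]; exact_mod_cast hE1) 0).isPreconnected
  have hd := fun z (hz : z ∈ slitDomain O) =>
    (hL.differentiableAt_curvature_factor hE1 h hz).hasFDerivAt
  have hfib : ∀ x ∈ O, ∀ y y' : E, y ≠ 0 → y' ≠ 0 → ρ (x, y) = ρ (x, y') := by
    intro x hx y y' hy hy'
    have hι : ∀ y ∈ ({0}ᶜ : Set E), HasFDerivAt (fun y => ρ (x, y)) (0 : E →L[ℝ] ℝ) y := by
      intro y hy
      have h1 := (hd (x, y) ⟨hx, hy⟩).comp y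
        ((hasFDerivAt_const (𝕜 := ℝ) x y).prodMk (hasFDerivAt_id y))
      convert! h1 using 1
      ext c
      exact (hL.fderiv_factor_vertical hE h ⟨hx, hy⟩ c).symm
    exact isOpen_compl_singleton.is_const_of_fderiv_eq_zero hconn
      (fun y hy => (hι y hy).differentiableAt.differentiableWithinAt)
      (fun y hy => (hι y hy).fderiv) hy hy'
  have hbase : ∀ x ∈ O, ∀ y ≠ 0, HasFDerivAt (fun x => ρ (x, y))
      ((fderiv ℝ ρ (x, y)).comp (ContinuousLinearMap.inl ℝ E E)) x := by
    intro x hx y hy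
    have h1 := (hd (x, y) ⟨hx, hy⟩).comp x
      ((hasFDerivAt_id x).prodMk (hasFDerivAt_const (𝕜 := ℝ) y x))
    convert! h1 using 1
  have hind : ∀ x ∈ O, ∀ y y' : E, y ≠ 0 → y' ≠ 0 → ∀ c,
      fderiv ℝ ρ (x, y) (c, 0) = fderiv ℝ ρ (x, y') (c, 0) := by
    intro x hx y y' hy hy' c
    have h1 : (fun x => ρ (x, y)) =ᶠ[𝓝 x] fun x => ρ (x, y') := by
      filter_upwards [hL.isOpen.mem_nhds hx] with w hw using hfib w hw y y' hy hy'
    have h2 := (hbase x hx y hy).unique ((hbase x hx y' hy').congr_of_eventuallyEq h1)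
    exact congrArg (fun A => A c) h2
  have hzero : ∀ x ∈ O, ∀ y ≠ 0, HasFDerivAt (fun x => ρ (x, y)) (0 : E →L[ℝ] ℝ) x := by
    intro x hx y hy
    convert! hbase x hx y hy using 1
    ext c
    -- choose the point of the fibre in the kernel of the horizontal differential of the factor,
    -- which is the same at all points of the fibre
    obtain ⟨y', hy', hker⟩ := exists_ne_zero_apply_eq_zero hE1
      ((fderiv ℝ ρ (x, y)).comp (ContinuousLinearMap.inl ℝ E E))
    have h1 := hL.fderiv_factor_horizontal hE h (z := (x, y')) ⟨hx, hy'⟩ y' c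
    rw [hL.momentum_self (z := (x, y')) ⟨hx, hy'⟩, hind x hx y' y hy' hy y',
      hind x hx y' y hy' hy c] at h1
    have hpos := hL.pos (x, y') ⟨hx, hy'⟩
    change fderiv ℝ ρ (x, y) (y', 0) = 0 at hker
    rw [hker, zero_mul] at h1
    rcases mul_eq_zero.1 h1 with h2 | h2
    · exact h2.symm
    · linarith
  obtain ⟨r, hr, hball⟩ := Metric.isOpen_iff.1 hL.isOpen x hx
  obtain ⟨y₀, hy₀⟩ := exists_ne (0 : E)
  refine ⟨Metric.ball x r, Metric.ball_mem_nhds x hr, ρ (x, y₀), fun x' hx' y hy => ?_⟩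
  rw [hfib x' (hball hx') y y₀ hy hy₀]
  exact Metric.isOpen_ball.is_const_of_fderiv_eq_zero (convex_ball x r).isPreconnected
    (f := fun x => ρ (x, y₀))
    (fun w hw => (hzero w (hball hw) y₀ hy₀).differentiableAt.differentiableWithinAt)
    (fun w hw => (hzero w (hball hw) y₀ hy₀).fderiv) hx' (Metric.mem_ball_self hr)

end IsFinslerEnergy

end Schur

/-! ### The cyclic identity -/

section CyclicAlgebra

/-- The algebraic core: a skew tensor satisfying the cyclic identity against all symmetric
matrices is, in dimension at least three, of the form `λ ∧ Id`. -/
lemma exists_covector_of_cyclic_components {ι : Type*} [Fintype ι] [DecidableEq ι]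
    (hι : 2 < Fintype.card ι) {T : ι → ι → ι → ℝ} (hT : ∀ j k m, T k j m = -T j k m)
    (h : ∀ b : Matrix ι ι ℝ, b.IsSymm → ∀ i j k,
      ∑ m, (b i m * T j k m + b k m * T i j m + b j m * T k i m) = 0) :
    ∃ lam : ι → ℝ, ∀ j k m, T j k m =
      (if m = k then lam j else 0) - (if m = j then lam k else 0) := by
  -- the elementary matrix `E_{ii}` isolates `T j k i` for `i` different from `j` and `k`
  have h1 : ∀ i j k, i ≠ j → i ≠ k → T j k i = 0 := by
    intro i j k hij hik
    have := h (Matrix.single i i 1) (by simp [Matrix.IsSymm]) i j k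
    simpa [Matrix.single_apply, hij, hik, Finset.sum_add_distrib] using this
  -- the matrix `E_{ij} + E_{ji}`, with a third index `k`, compares the remaining components
  have h2 : ∀ i j k, i ≠ j → i ≠ k → j ≠ k → T j k j = T i k i := by
    intro i j k hij hik hjk
    have := h (Matrix.single i j 1 + Matrix.single j i 1)
      (by simp [Matrix.IsSymm, Matrix.transpose_add, add_comm]) i j k
    simp [Matrix.single_apply, hij, hik, hjk, hij.symm, Finset.sum_add_distrib,
      hT i k i] at this
    linarith
  have hf : ∀ k : ι, ∃ i, i ≠ k := by
    have : Nontrivial ι := Fintype.one_lt_card_iff_nontrivial.1 (by omega)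
    exact fun k => exists_ne k
  choose f hf using hf
  have h3 : ∀ i k, i ≠ k → T i k i = T (f k) k (f k) := by
    intro i k hik
    by_cases hi : i = f k
    · rw [← hi]
    · exact h2 (f k) i k (Ne.symm hi) (hf k) hik
  refine ⟨fun k => -T (f k) k (f k), fun j k m => ?_⟩
  by_cases hjk : j = k
  · subst hjk
    have := hT j j m
    rw [sub_self]
    linarith
  by_cases hmk : m = k
  · subst hmk
    have hmj : m ≠ j := fun h => hjk h.symm
    rw [if_pos rfl, if_neg hmj, hT m j m, h3 m j hmj, sub_zero]
  by_cases hmj : m = j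
  · subst hmj
    rw [if_neg hmk, if_pos rfl, h3 m k hmk]
    ring
  · rw [if_neg hmk, if_neg hmj, sub_zero, h1 m j k hmj hmk]

/-- The invariant form of `exists_covector_of_cyclic_components`. -/
lemma exists_covector_of_cyclic {n : ℕ} (hn : 2 < n)
    (R : EuclideanSpace ℝ (Fin n) →ₗ[ℝ] EuclideanSpace ℝ (Fin n) →ₗ[ℝ] EuclideanSpace ℝ (Fin n))
    (hR : ∀ a b, R b a = -R a b)
    (h : ∀ b : Matrix (Fin n) (Fin n) ℝ, b.IsSymm → ∀ i j k,
      ∑ m, (b i m * R (EuclideanSpace.single j 1) (EuclideanSpace.single k 1) m +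
        b k m * R (EuclideanSpace.single i 1) (EuclideanSpace.single j 1) m +
        b j m * R (EuclideanSpace.single k 1) (EuclideanSpace.single i 1) m) = 0) :
    ∃ lam : EuclideanSpace ℝ (Fin n) →ₗ[ℝ] ℝ, ∀ a b, R a b = lam a • b - lam b • a := by
  obtain ⟨lam, hlam⟩ := exists_covector_of_cyclic_components (by simpa using hn)
    (T := fun j k m => R (EuclideanSpace.single j 1) (EuclideanSpace.single k 1) m)
    (fun j k m => by rw [hR]; rfl) h
  let B := (EuclideanSpace.basisFun (Fin n) ℝ).toBasis
  have hB : ∀ j, B j = EuclideanSpace.single j 1 := fun j => by simp [B]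
  let Λ : EuclideanSpace ℝ (Fin n) →ₗ[ℝ] ℝ := B.constr ℝ lam
  have hΛ : ∀ j, Λ (EuclideanSpace.single j 1) = lam j := fun j => by
    rw [← hB]; exact B.constr_basis ℝ lam j
  refine ⟨Λ, fun a b => ?_⟩
  have hext : R = (LinearMap.lsmul ℝ _).comp Λ - ((LinearMap.lsmul ℝ _).comp Λ).flip := by
    refine B.ext fun j => B.ext fun k => ?_
    simp only [LinearMap.sub_apply, LinearMap.comp_apply, LinearMap.flip_apply,
      LinearMap.lsmul_apply, hB, hΛ]
    ext m
    rw [hlam]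
    simp only [PiLp.sub_apply, PiLp.smul_apply, PiLp.single_apply, smul_eq_mul,
      mul_ite, mul_one, mul_zero]
  rw [hext]
  rfl

end CyclicAlgebra

section Flat

variable {E : Type*} [NormedAddCommGroup E] [NormedSpace ℝ E]

/-- The curvature as a bilinear map. -/
def curvBilin (L : E × E → ℝ) (z : E × E) : E →ₗ[ℝ] E →ₗ[ℝ] E :=
  LinearMap.mk₂ ℝ (curv L z) (curv_add_left L z) (curv_smul_left L z) (curv_add_right L z)
    (curv_smul_right L z)

/-- If the curvature satisfies the cyclic identity against all symmetric matrices, it is a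
multiple of `p ∧ Id`, `p` being the momentum. -/
lemma IsFinslerEnergy.exists_factor {n : ℕ} (hn : 2 < n)
    {O : Set (EuclideanSpace ℝ (Fin n))}
    {L : EuclideanSpace ℝ (Fin n) × EuclideanSpace ℝ (Fin n) → ℝ} (hL : IsFinslerEnergy O L)
    {z : EuclideanSpace ℝ (Fin n) × EuclideanSpace ℝ (Fin n)} (hz : z ∈ slitDomain O)
    (h : ∀ b : Matrix (Fin n) (Fin n) ℝ, b.IsSymm → ∀ i j k,
      ∑ m, (b i m * curv L z (EuclideanSpace.single j 1) (EuclideanSpace.single k 1) m +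
        b k m * curv L z (EuclideanSpace.single i 1) (EuclideanSpace.single j 1) m +
        b j m * curv L z (EuclideanSpace.single k 1) (EuclideanSpace.single i 1) m) = 0) :
    ∃ ρ : ℝ, ∀ a b, curv L z a b = ρ • (momentum L z a • b - momentum L z b • a) := by
  obtain ⟨lam, hlam⟩ := exists_covector_of_cyclic hn (curvBilin L z)
    (fun a b => curv_swap L z a b) h
  have hpos := hL.pos z hz
  have h1 : ∀ a, lam a = (lam z.2 / (2 * L z)) * momentum L z a := by
    intro a
    have h2 := hL.momentum_curv hz a z.2
    rw [show curv L z a z.2 = _ from hlam a z.2, map_sub, map_smul, map_smul,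
      hL.momentum_self hz, smul_eq_mul, smul_eq_mul] at h2
    field_simp
    linarith
  refine ⟨lam z.2 / (2 * L z), fun a b => ?_⟩
  rw [show curv L z a b = _ from hlam a b, h1 a, h1 b]
  module

end Flat

/-! ### Coordinates on the tangent bundle -/

section Coordinates

variable {n : ℕ} {M : Type*} [TopologicalSpace M] [ChartedSpace (EuclideanSpace ℝ (Fin n)) M]
  [IsManifold (𝓡 n) ∞ M]

/-- The inverse of `tangentCoord e`. -/
def tangentCoordSymm (e : OpenPartialHomeomorph M (EuclideanSpace ℝ (Fin n)))
    (z : EuclideanSpace ℝ (Fin n) × EuclideanSpace ℝ (Fin n)) : TM n M :=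
  ⟨e.symm z.1, mfderiv (𝓡 n) (𝓡 n) e.symm z.1 z.2⟩

variable {e : OpenPartialHomeomorph M (EuclideanSpace ℝ (Fin n))}

lemma contMDiffOn_chart (he : e ∈ IsManifold.maximalAtlas (𝓡 n) ∞ M) :
    ContMDiffOn (𝓡 n) (𝓡 n) ∞ e e.source := contMDiffOn_of_mem_maximalAtlas he

lemma contMDiffOn_chart_symm (he : e ∈ IsManifold.maximalAtlas (𝓡 n) ∞ M) :
    ContMDiffOn (𝓡 n) (𝓡 n) ∞ e.symm e.target := contMDiffOn_symm_of_mem_maximalAtlas he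

lemma isOpen_proj_preimage {s : Set M} (hs : IsOpen s) : IsOpen {u : TM n M | u.proj ∈ s} :=
  hs.preimage (FiberBundle.continuous_proj (EuclideanSpace ℝ (Fin n))
    (TangentSpace (𝓡 n) : M → Type _))

lemma contMDiff_tangentProj :
    ContMDiff (𝓡 n).tangent (𝓡 n) ∞ (fun u : TM n M => u.proj) :=
  Bundle.contMDiff_proj (TangentSpace (𝓡 n) : M → Type _)

/-- The induced coordinates are smooth. -/
lemma contMDiffAt_tangentCoord (he : e ∈ IsManifold.maximalAtlas (𝓡 n) ∞ M) {u : TM n M}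
    (hu : u.proj ∈ e.source) :
    ContMDiffAt (𝓡 n).tangent 𝓘(ℝ, EuclideanSpace ℝ (Fin n) × EuclideanSpace ℝ (Fin n)) ∞
      (tangentCoord e) u := by
  have h1 := (contMDiffOn_chart he).contMDiffOn_tangentMapWithin (m := ∞) (by norm_num)
    e.open_source.uniqueMDiffOn
  have h2 : ContMDiffAt (𝓡 n).tangent (𝓡 n).tangent ∞
      (tangentMapWithin (𝓡 n) (𝓡 n) e e.source) u :=
    (h1 u hu).contMDiffAt ((isOpen_proj_preimage e.open_source).mem_nhds hu)
  have h3 := (contMDiff_snd_tangentBundle_modelSpace (EuclideanSpace ℝ (Fin n)) (𝓡 n)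
    (n := ∞)).contMDiffAt.comp u h2
  have h4 : ContMDiffAt (𝓡 n).tangent (𝓡 n) ∞ (fun u : TM n M => e u.proj) u :=
    ((contMDiffOn_chart he u.proj hu).contMDiffAt (e.open_source.mem_nhds hu)).comp u
      contMDiff_tangentProj.contMDiffAt
  refine (h4.prodMk_space h3).congr_of_eventuallyEq ?_
  filter_upwards [(isOpen_proj_preimage e.open_source).mem_nhds hu] with v hv
  simp only [tangentCoord, Function.comp, tangentMapWithin]
  rw [mfderivWithin_of_isOpen e.open_source hv]

/-- The inverse of the induced coordinates is smooth. -/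
lemma contMDiffAt_tangentCoordSymm (he : e ∈ IsManifold.maximalAtlas (𝓡 n) ∞ M)
    {z : EuclideanSpace ℝ (Fin n) × EuclideanSpace ℝ (Fin n)} (hz : z.1 ∈ e.target) :
    ContMDiffAt 𝓘(ℝ, EuclideanSpace ℝ (Fin n) × EuclideanSpace ℝ (Fin n)) (𝓡 n).tangent ∞
      (tangentCoordSymm e) z := by
  have h1 := (contMDiffOn_chart_symm he).contMDiffOn_tangentMapWithin (m := ∞) (by norm_num)
    e.open_target.uniqueMDiffOn
  have h0 : ContMDiffAt 𝓘(ℝ, EuclideanSpace ℝ (Fin n) × EuclideanSpace ℝ (Fin n)) (𝓡 n).tangent ∞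
      (fun z => (⟨z.1, z.2⟩ : TangentBundle (𝓡 n) (EuclideanSpace ℝ (Fin n)))) z := by
    rw [Bundle.contMDiffAt_totalSpace]
    refine ⟨contDiff_fst.contMDiff.contMDiffAt, ?_⟩
    have h : ContMDiffAt 𝓘(ℝ, EuclideanSpace ℝ (Fin n) × EuclideanSpace ℝ (Fin n))
        𝓘(ℝ, EuclideanSpace ℝ (Fin n)) ∞ Prod.snd z := contDiff_snd.contMDiff.contMDiffAt
    convert! h using 1
    ext1 y
    simp
  have h2 : ContMDiffAt (𝓡 n).tangent (𝓡 n).tangent ∞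
      (tangentMapWithin (𝓡 n) (𝓡 n) e.symm e.target) ⟨z.1, z.2⟩ :=
    (h1 ⟨z.1, z.2⟩ hz).contMDiffAt ((e.open_target.preimage
      (FiberBundle.continuous_proj (EuclideanSpace ℝ (Fin n))
        (TangentSpace (𝓡 n) : EuclideanSpace ℝ (Fin n) → Type _))).mem_nhds hz)
  have h3 := ContMDiffAt.comp z h2 h0
  refine h3.congr_of_eventuallyEq ?_
  filter_upwards [(e.open_target.preimage continuous_fst).mem_nhds hz] with v hv
  simp only [tangentCoordSymm, Function.comp, tangentMapWithin]
  rw [mfderivWithin_of_isOpen e.open_target hv]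

lemma mdifferentiableAt_chart (he : e ∈ IsManifold.maximalAtlas (𝓡 n) ∞ M) {x : M}
    (hx : x ∈ e.source) : MDifferentiableAt (𝓡 n) (𝓡 n) e x :=
  (((contMDiffOn_chart he) x hx).contMDiffAt
    (e.open_source.mem_nhds hx)).mdifferentiableAt (by simp)

lemma mdifferentiableAt_chart_symm (he : e ∈ IsManifold.maximalAtlas (𝓡 n) ∞ M)
    {x : EuclideanSpace ℝ (Fin n)}
    (hx : x ∈ e.target) : MDifferentiableAt (𝓡 n) (𝓡 n) e.symm x :=
  (((contMDiffOn_chart_symm he) x hx).contMDiffAt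
    (e.open_target.mem_nhds hx)).mdifferentiableAt (by simp)

lemma mfderiv_chart_symm_comp (he : e ∈ IsManifold.maximalAtlas (𝓡 n) ∞ M) {x : M}
    (hx : x ∈ e.source) (v : TangentSpace (𝓡 n) x) :
    mfderiv (𝓡 n) (𝓡 n) e.symm (e x) (mfderiv (𝓡 n) (𝓡 n) e x v) = v := by
  have := mfderiv_comp x (mdifferentiableAt_chart_symm he (e.map_source hx))
    (mdifferentiableAt_chart he hx)
  have h2 : (e.symm ∘ e) =ᶠ[𝓝 x] id := by
    filter_upwards [e.open_source.mem_nhds hx] with y hy using e.left_inv hy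
  rw [h2.mfderiv_eq, mfderiv_id] at this
  exact (congrArg (fun f => f v) this).symm

lemma mfderiv_chart_comp_symm (he : e ∈ IsManifold.maximalAtlas (𝓡 n) ∞ M)
    {x : EuclideanSpace ℝ (Fin n)}
    (hx : x ∈ e.target) (v : EuclideanSpace ℝ (Fin n)) :
    mfderiv (𝓡 n) (𝓡 n) e (e.symm x) (mfderiv (𝓡 n) (𝓡 n) e.symm x v) = v := by
  have := mfderiv_comp x (mdifferentiableAt_chart he (e.map_target hx))
    (mdifferentiableAt_chart_symm he hx)
  have h2 : (e ∘ e.symm) =ᶠ[𝓝 x] id := by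
    filter_upwards [e.open_target.mem_nhds hx] with y hy using e.right_inv hy
  rw [h2.mfderiv_eq, mfderiv_id] at this
  exact (congrArg (fun f => f v) this).symm

lemma tangentCoord_symm (he : e ∈ IsManifold.maximalAtlas (𝓡 n) ∞ M)
    {z : EuclideanSpace ℝ (Fin n) × EuclideanSpace ℝ (Fin n)} (hz : z.1 ∈ e.target) :
    tangentCoord e (tangentCoordSymm e z) = z :=
  Prod.ext (e.right_inv hz) (mfderiv_chart_comp_symm he hz z.2)

lemma tangentCoordSymm_tangentCoord (he : e ∈ IsManifold.maximalAtlas (𝓡 n) ∞ M) {u : TM n M}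
    (hu : u.proj ∈ e.source) : tangentCoordSymm e (tangentCoord e u) = u := by
  obtain ⟨x, y⟩ := u
  have h := mfderiv_chart_symm_comp he hu y
  have h' := e.left_inv hu
  simp only [tangentCoordSymm, tangentCoord] at *
  have : ∀ (x' : M) (y' : EuclideanSpace ℝ (Fin n)), x' = x → y' = y →
    (⟨x', y'⟩ : TM n M) = ⟨x, y⟩ := by rintro _ _ rfl rfl; rfl
  exact this _ _ h' h

end Coordinates

/-! ### Vector fields in coordinates -/

section CoordinateFields

variable {n : ℕ} {M : Type*} [TopologicalSpace M] [ChartedSpace (EuclideanSpace ℝ (Fin n)) M]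
  [IsManifold (𝓡 n) ∞ M]

local notation "𝔼" => EuclideanSpace ℝ (Fin n)

variable {e : OpenPartialHomeomorph M (EuclideanSpace ℝ (Fin n))}

/-- The differential of the induced coordinates, as a map into the vector space of coordinates. -/
def coordDeriv (e : OpenPartialHomeomorph M (EuclideanSpace ℝ (Fin n))) (u : TM n M) :
    TTM u →L[ℝ] 𝔼 × 𝔼 :=
  mfderiv (𝓡 n).tangent 𝓘(ℝ, 𝔼 × 𝔼) (tangentCoord e) u

/-- The differential of a chart, as a map into the vector space of coordinates. -/
def chartDeriv (e : OpenPartialHomeomorph M (EuclideanSpace ℝ (Fin n))) (x : M) :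
    TangentSpace (𝓡 n) x →L[ℝ] 𝔼 :=
  mfderiv (𝓡 n) (𝓡 n) e x

/-- The expression of a vector field on `TM` in the coordinates induced by `e`. -/
def rep (e : OpenPartialHomeomorph M (EuclideanSpace ℝ (Fin n))) (X : VField n M) (z : 𝔼 × 𝔼) :
    𝔼 × 𝔼 :=
  coordDeriv e (tangentCoordSymm e z) (X (tangentCoordSymm e z))

lemma tangentCoord_fst_mem {u : TM n M} (hu : u.proj ∈ e.source) :
    (tangentCoord e u).1 ∈ e.target := e.map_source hu

lemma tangentCoordSymm_proj_mem {z : 𝔼 × 𝔼} (hz : z.1 ∈ e.target) :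
    (tangentCoordSymm e z).proj ∈ e.source := e.map_target hz

lemma eventually_proj_mem {u : TM n M} (hu : u.proj ∈ e.source) :
    ∀ᶠ v : TM n M in 𝓝 u, v.proj ∈ e.source :=
  (isOpen_proj_preimage e.open_source).mem_nhds hu

lemma eventually_fst_mem {z : 𝔼 × 𝔼} (hz : z.1 ∈ e.target) :
    ∀ᶠ w : 𝔼 × 𝔼 in 𝓝 z, w.1 ∈ e.target :=
  (e.open_target.preimage continuous_fst).mem_nhds hz

lemma mdifferentiableAt_tangentCoord (he : e ∈ IsManifold.maximalAtlas (𝓡 n) ∞ M) {u : TM n M}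
    (hu : u.proj ∈ e.source) :
    MDifferentiableAt (𝓡 n).tangent 𝓘(ℝ, 𝔼 × 𝔼) (tangentCoord e) u :=
  (contMDiffAt_tangentCoord he hu).mdifferentiableAt (by simp)

lemma mdifferentiableAt_tangentCoordSymm (he : e ∈ IsManifold.maximalAtlas (𝓡 n) ∞ M)
    {z : 𝔼 × 𝔼} (hz : z.1 ∈ e.target) :
    MDifferentiableAt 𝓘(ℝ, 𝔼 × 𝔼) (𝓡 n).tangent (tangentCoordSymm e) z :=
  (contMDiffAt_tangentCoordSymm he hz).mdifferentiableAt (by simp)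

lemma mfderiv_tangentCoord_comp_symm (he : e ∈ IsManifold.maximalAtlas (𝓡 n) ∞ M)
    {z : 𝔼 × 𝔼} (hz : z.1 ∈ e.target) (v : 𝔼 × 𝔼) :
    coordDeriv e (tangentCoordSymm e z)
      (mfderiv 𝓘(ℝ, 𝔼 × 𝔼) (𝓡 n).tangent (tangentCoordSymm e) z v) = v := by
  have := mfderiv_comp z (mdifferentiableAt_tangentCoord he (tangentCoordSymm_proj_mem hz))
    (mdifferentiableAt_tangentCoordSymm he hz)
  have h2 : (tangentCoord e ∘ tangentCoordSymm e) =ᶠ[𝓝 z] id := by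
    filter_upwards [eventually_fst_mem hz] with y hy using tangentCoord_symm he hy
  rw [h2.mfderiv_eq, mfderiv_id] at this
  exact (congrArg (fun f => f v) this).symm

lemma mfderiv_tangentCoord_symm_comp (he : e ∈ IsManifold.maximalAtlas (𝓡 n) ∞ M) {u : TM n M}
    (hu : u.proj ∈ e.source) (v : TTM u) :
    mfderiv 𝓘(ℝ, 𝔼 × 𝔼) (𝓡 n).tangent (tangentCoordSymm e) (tangentCoord e u)
      (coordDeriv e u v) = v := by
  have := mfderiv_comp u (mdifferentiableAt_tangentCoordSymm he (tangentCoord_fst_mem hu))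
    (mdifferentiableAt_tangentCoord he hu)
  have h2 : (tangentCoordSymm e ∘ tangentCoord e) =ᶠ[𝓝 u] id := by
    filter_upwards [eventually_proj_mem hu] with y hy using tangentCoordSymm_tangentCoord he hy
  rw [h2.mfderiv_eq, mfderiv_id] at this
  exact (congrArg (fun f => f v) this).symm

lemma coordDeriv_injective (he : e ∈ IsManifold.maximalAtlas (𝓡 n) ∞ M) {u : TM n M}
    (hu : u.proj ∈ e.source) : Function.Injective (coordDeriv e u) := by
  intro v w h
  rw [← mfderiv_tangentCoord_symm_comp he hu v, h, mfderiv_tangentCoord_symm_comp he hu w]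

lemma coordDeriv_surjective (he : e ∈ IsManifold.maximalAtlas (𝓡 n) ∞ M) {u : TM n M}
    (hu : u.proj ∈ e.source) : Function.Surjective (coordDeriv e u) := by
  intro v
  have h := mfderiv_tangentCoord_comp_symm he (tangentCoord_fst_mem hu) v
  rw [tangentCoordSymm_tangentCoord he hu] at h
  exact ⟨_, h⟩

lemma coordDeriv_isInvertible (he : e ∈ IsManifold.maximalAtlas (𝓡 n) ∞ M) {u : TM n M}
    (hu : u.proj ∈ e.source) : (coordDeriv e u).IsInvertible := by
  have : FiniteDimensional ℝ (TTM u) := inferInstanceAs (FiniteDimensional ℝ (𝔼 × 𝔼))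
  have : T2Space (TTM u) := inferInstanceAs (T2Space (𝔼 × 𝔼))
  exact ⟨(LinearEquiv.ofBijective (coordDeriv e u).toLinearMap
    ⟨coordDeriv_injective he hu, coordDeriv_surjective he hu⟩).toContinuousLinearEquiv, rfl⟩

lemma chartDeriv_injective (he : e ∈ IsManifold.maximalAtlas (𝓡 n) ∞ M) {x : M}
    (hx : x ∈ e.source) : Function.Injective (chartDeriv e x) := by
  intro v w h
  rw [← mfderiv_chart_symm_comp he hx v, ← mfderiv_chart_symm_comp he hx w]
  exact congrArg _ h

lemma chartDeriv_surjective (he : e ∈ IsManifold.maximalAtlas (𝓡 n) ∞ M) {x : M}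
    (hx : x ∈ e.source) : Function.Surjective (chartDeriv e x) := by
  intro v
  have h := mfderiv_chart_comp_symm he (e.map_source hx) v
  rw [e.left_inv hx] at h
  exact ⟨_, h⟩

lemma chartDeriv_isInvertible (he : e ∈ IsManifold.maximalAtlas (𝓡 n) ∞ M) {x : M}
    (hx : x ∈ e.source) : (chartDeriv e x).IsInvertible := by
  have : FiniteDimensional ℝ (TangentSpace (𝓡 n) x) := inferInstanceAs (FiniteDimensional ℝ 𝔼)
  have : T2Space (TangentSpace (𝓡 n) x) := inferInstanceAs (T2Space 𝔼)
  exact ⟨(LinearEquiv.ofBijective (chartDeriv e x).toLinearMap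
    ⟨chartDeriv_injective he hx, chartDeriv_surjective he hx⟩).toContinuousLinearEquiv, by ext; rfl⟩

lemma rep_tangentCoord (he : e ∈ IsManifold.maximalAtlas (𝓡 n) ∞ M) (X : VField n M) {u : TM n M}
    (hu : u.proj ∈ e.source) : rep e X (tangentCoord e u) = coordDeriv e u (X u) :=
  congrArg (fun u => coordDeriv e u (X u)) (tangentCoordSymm_tangentCoord he hu)

/-- The vector field on `TM` with the given expression in the coordinates induced by `e`. -/
def pull (e : OpenPartialHomeomorph M (EuclideanSpace ℝ (Fin n))) (V : 𝔼 × 𝔼 → 𝔼 × 𝔼) :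
    VField n M :=
  fun u => (coordDeriv e u).inverse (V (tangentCoord e u))

lemma coordDeriv_inverse_apply (he : e ∈ IsManifold.maximalAtlas (𝓡 n) ∞ M) {u : TM n M}
    (hu : u.proj ∈ e.source) (v : TTM u) : (coordDeriv e u).inverse (coordDeriv e u v) = v := by
  obtain ⟨A, hA⟩ := coordDeriv_isInvertible he hu
  rw [← hA, ContinuousLinearMap.inverse_equiv]
  exact A.symm_apply_apply v

lemma coordDeriv_apply_inverse (he : e ∈ IsManifold.maximalAtlas (𝓡 n) ∞ M) {u : TM n M}
    (hu : u.proj ∈ e.source) (c : 𝔼 × 𝔼) : coordDeriv e u ((coordDeriv e u).inverse c) = c := by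
  obtain ⟨A, hA⟩ := coordDeriv_isInvertible he hu
  rw [← hA, ContinuousLinearMap.inverse_equiv]
  exact A.apply_symm_apply c

/-- A vector field is the pullback of its coordinate expression. -/
lemma pull_rep (he : e ∈ IsManifold.maximalAtlas (𝓡 n) ∞ M) (X : VField n M) {u : TM n M}
    (hu : u.proj ∈ e.source) : pull e (rep e X) u = X u := by
  rw [pull, rep_tangentCoord he X hu, coordDeriv_inverse_apply he hu]

lemma coordDeriv_pull (he : e ∈ IsManifold.maximalAtlas (𝓡 n) ∞ M) (V : 𝔼 × 𝔼 → 𝔼 × 𝔼)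
    {u : TM n M} (hu : u.proj ∈ e.source) :
    coordDeriv e u (pull e V u) = V (tangentCoord e u) :=
  coordDeriv_apply_inverse he hu _

lemma rep_pull (he : e ∈ IsManifold.maximalAtlas (𝓡 n) ∞ M) (V : 𝔼 × 𝔼 → 𝔼 × 𝔼)
    {z : 𝔼 × 𝔼} (hz : z.1 ∈ e.target) : rep e (pull e V : VField n M) z = V z := by
  rw [rep, coordDeriv_pull he V (tangentCoordSymm_proj_mem hz), tangentCoord_symm he hz]

lemma rep_eventuallyEq (he : e ∈ IsManifold.maximalAtlas (𝓡 n) ∞ M) {X Y : VField n M}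
    {u : TM n M} (hu : u.proj ∈ e.source) (h : X =ᶠ[𝓝 u] Y) :
    rep e X =ᶠ[𝓝 (tangentCoord e u)] rep e Y := by
  have hc : ContinuousAt (tangentCoordSymm e) (tangentCoord e u) :=
    (contMDiffAt_tangentCoordSymm he (tangentCoord_fst_mem hu)).continuousAt
  have h' : ∀ᶠ v in 𝓝 (tangentCoordSymm e (tangentCoord e u)), X v = Y v := by
    rwa [tangentCoordSymm_tangentCoord he hu]
  filter_upwards [hc.eventually h'] with z hz
  simp only [rep, hz]

lemma eventuallyEq_pull_rep (he : e ∈ IsManifold.maximalAtlas (𝓡 n) ∞ M) (X : VField n M)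
    {u : TM n M} (hu : u.proj ∈ e.source) : X =ᶠ[𝓝 u] pull e (rep e X) := by
  filter_upwards [eventually_proj_mem hu] with v hv using (pull_rep he X hv).symm

lemma mfderiv_tangentCoordSymm_isInvertible (he : e ∈ IsManifold.maximalAtlas (𝓡 n) ∞ M)
    {z : 𝔼 × 𝔼} (hz : z.1 ∈ e.target) :
    (mfderiv 𝓘(ℝ, 𝔼 × 𝔼) (𝓡 n).tangent (tangentCoordSymm e) z).IsInvertible := by
  obtain ⟨A, hA⟩ := coordDeriv_isInvertible he (tangentCoordSymm_proj_mem hz)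
  refine ⟨A.symm, ?_⟩
  ext1 v
  refine A.injective ?_
  have h := mfderiv_tangentCoord_comp_symm he hz v
  rw [← hA] at h
  exact (A.apply_symm_apply v).trans h.symm

/-- The coordinate expression of a vector field is its pullback by the inverse coordinates. -/
lemma rep_eq_mpullback (he : e ∈ IsManifold.maximalAtlas (𝓡 n) ∞ M) (X : VField n M)
    {z : 𝔼 × 𝔼} (hz : z.1 ∈ e.target) :
    rep e X z = VectorField.mpullback 𝓘(ℝ, 𝔼 × 𝔼) (𝓡 n).tangent (tangentCoordSymm e) X z := by
  obtain ⟨A, hA⟩ := mfderiv_tangentCoordSymm_isInvertible he hz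
  rw [VectorField.mpullback_apply, ← hA, ContinuousLinearMap.inverse_equiv]
  refine A.injective ((coordDeriv_injective he (tangentCoordSymm_proj_mem hz)) ?_)
  refine Eq.trans ?_ (congrArg _ (A.apply_symm_apply _).symm)
  have h := mfderiv_tangentCoord_comp_symm he hz (rep e X z)
  rw [← hA] at h
  exact h

/-- A vector field is `C^m` at a point iff its coordinate expression is. -/
lemma contMDiffAt_iff_rep (he : e ∈ IsManifold.maximalAtlas (𝓡 n) ∞ M) (X : VField n M)
    {u : TM n M} (hu : u.proj ∈ e.source) {m : ℕ∞} :
    ContMDiffAt (𝓡 n).tangent (𝓡 n).tangent.tangent m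
      (fun u => (⟨u, X u⟩ : TangentBundle (𝓡 n).tangent (TM n M))) u ↔
    ContDiffAt ℝ m (rep e X) (tangentCoord e u) := by
  have hm : (m : WithTop ℕ∞) + 1 ≤ ∞ := by
    exact_mod_cast (le_top : m + 1 ≤ ⊤)
  constructor
  · intro h
    have hz := tangentCoord_fst_mem hu
    have h' : ContMDiffAt (𝓡 n).tangent (𝓡 n).tangent.tangent m
      (fun u => (⟨u, X u⟩ : TangentBundle (𝓡 n).tangent (TM n M)))
      (tangentCoordSymm e (tangentCoord e u)) := by rwa [tangentCoordSymm_tangentCoord he hu]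
    have key := ContMDiffAt.mpullback_vectorField_preimage (n := ∞) h'
      (contMDiffAt_tangentCoordSymm he hz) (mfderiv_tangentCoordSymm_isInvertible he hz) hm
    refine (contMDiffAt_vectorSpace_iff_contDiffAt.1 key).congr_of_eventuallyEq ?_
    filter_upwards [eventually_fst_mem hz] with z hz using rep_eq_mpullback he X hz
  · intro h
    have key := ContMDiffAt.mpullback_vectorField_preimage (n := ∞)
      (contMDiffAt_vectorSpace_iff_contDiffAt.2 h)
      (contMDiffAt_tangentCoord he hu) (coordDeriv_isInvertible he hu) hm
    refine key.congr_of_eventuallyEq ?_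
    filter_upwards [eventuallyEq_pull_rep he X hu] with v hv
    rw [hv]; rfl

lemma two_le_infty : (2 : WithTop ℕ∞) ≤ ∞ := by
  change ((2 : ℕ∞) : WithTop ℕ∞) ≤ ((⊤ : ℕ∞) : WithTop ℕ∞)
  exact WithTop.coe_le_coe.2 le_top

lemma mlieBracket_vectorSpace {V : Type*} [NormedAddCommGroup V] [NormedSpace ℝ V]
    [CompleteSpace V] (X Y : (x : V) → TangentSpace 𝓘(ℝ, V) x) :
    VectorField.mlieBracket 𝓘(ℝ, V) X Y = VectorField.lieBracket ℝ X Y := by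
  rw [← VectorField.mlieBracketWithin_univ, VectorField.mlieBracketWithin_eq_lieBracketWithin]
  exact VectorField.lieBracketWithin_univ

/-- The Lie bracket in coordinates. -/
lemma rep_lie (he : e ∈ IsManifold.maximalAtlas (𝓡 n) ∞ M) {X Y : VField n M}
    {z : 𝔼 × 𝔼} (hz : z.1 ∈ e.target) (hX : DifferentiableAt ℝ (rep e X) z)
    (hY : DifferentiableAt ℝ (rep e Y) z) :
    rep e (lie X Y) z = VectorField.lieBracket ℝ (rep e X) (rep e Y) z := by
  obtain ⟨u, hu, rfl⟩ : ∃ u : TM n M, u.proj ∈ e.source ∧ tangentCoord e u = z :=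
    ⟨_, tangentCoordSymm_proj_mem hz, tangentCoord_symm he hz⟩
  rw [rep_tangentCoord he _ hu]
  have hmd : ∀ W : 𝔼 × 𝔼 → 𝔼 × 𝔼, DifferentiableAt ℝ W (tangentCoord e u) →
      MDifferentiableAt 𝓘(ℝ, 𝔼 × 𝔼) 𝓘(ℝ, 𝔼 × 𝔼).tangent
      (fun z => (⟨z, W z⟩ : TangentBundle 𝓘(ℝ, 𝔼 × 𝔼) (𝔼 × 𝔼))) (tangentCoord e u) := by
    intro W hW
    rw [mdifferentiableAt_totalSpace]
    refine ⟨mdifferentiableAt_id, ?_⟩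
    convert! hW.mdifferentiableAt using 1
    ext1 y
    simp
  have : IsManifold (𝓡 n).tangent (minSmoothness ℝ 2) (TM n M) := by
    rw [minSmoothness_of_isRCLikeNormedField]
    exact IsManifold.of_le (n := ∞) two_le_infty
  have key := VectorField.mpullback_mlieBracket (n := ∞) (hmd _ hX) (hmd _ hY)
    (contMDiffAt_tangentCoord he hu)
    (by rw [minSmoothness_of_isRCLikeNormedField]; exact two_le_infty)
  have h1 : lie X Y u = VectorField.mpullback (𝓡 n).tangent 𝓘(ℝ, 𝔼 × 𝔼) (tangentCoord e)
      (VectorField.mlieBracket 𝓘(ℝ, 𝔼 × 𝔼) (rep e X) (rep e Y)) u := by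
    rw [key]
    exact Filter.EventuallyEq.mlieBracket_vectorField_eq (eventuallyEq_pull_rep he X hu)
      (eventuallyEq_pull_rep he Y hu)
  rw [h1]
  refine (coordDeriv_pull he _ hu).trans ?_
  exact congrFun (mlieBracket_vectorSpace (rep e X) (rep e Y)) _

/-- The first component of `coordDeriv` is the differential of the base coordinates. -/
lemma coordDeriv_fst (he : e ∈ IsManifold.maximalAtlas (𝓡 n) ∞ M) {u : TM n M}
    (hu : u.proj ∈ e.source) (v : TTM u) :
    (coordDeriv e u v).1 = chartDeriv e u.proj
      (mfderiv (𝓡 n).tangent (𝓡 n) (fun p : TM n M => p.proj) u v) := by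
  have h1 : HasMFDerivAt (𝓡 n).tangent (𝓡 n) (fun p : TM n M => e p.proj) u _ :=
    (mdifferentiableAt_chart he hu).hasMFDerivAt.comp u
      ((contMDiff_tangentProj (M := M)).contMDiffAt.mdifferentiableAt (by simp)).hasMFDerivAt
  have h2 : HasMFDerivAt (𝓡 n).tangent (𝓡 n) (fun p : TM n M => e p.proj) u
      ((ContinuousLinearMap.fst ℝ 𝔼 𝔼).comp (coordDeriv e u)) :=
    ((ContinuousLinearMap.fst ℝ 𝔼 𝔼).hasFDerivAt (x := tangentCoord e u)).hasMFDerivAt.comp u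
      (mdifferentiableAt_tangentCoord he hu).hasMFDerivAt
  exact congrArg (fun f => f v) (hasMFDerivAt_unique h2 h1)

/-- The vertical lift in coordinates. -/
lemma coordDeriv_vlift (he : e ∈ IsManifold.maximalAtlas (𝓡 n) ∞ M) {u : TM n M}
    (hu : u.proj ∈ e.source) (w : TangentSpace (𝓡 n) u.proj) :
    coordDeriv e u (vlift u w) = (0, chartDeriv e u.proj w) := by
  obtain ⟨x, y⟩ := u
  change 𝔼 at y
  change 𝔼 at w
  have h0 : HasFDerivAt (fun y : 𝔼 => (e x, (chartDeriv e x : 𝔼 →L[ℝ] 𝔼) y))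
      ((0 : 𝔼 →L[ℝ] 𝔼).prod (chartDeriv e x)) y :=
    (hasFDerivAt_const _ _).prodMk (chartDeriv e x : 𝔼 →L[ℝ] 𝔼).hasFDerivAt
  have hd : MDifferentiableAt (𝓡 n) (𝓡 n).tangent (fibrePt x : 𝔼 → TM n M) y := by
    have h := (mdifferentiableAt_tangentCoordSymm he (tangentCoord_fst_mem hu)).comp
      (f := fun y : 𝔼 => (e x, (chartDeriv e x : 𝔼 →L[ℝ] 𝔼) y)) y
      h0.hasMFDerivAt.mdifferentiableAt
    refine h.congr_of_eventuallyEq (Eventually.of_forall fun y => ?_)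
    exact (tangentCoordSymm_tangentCoord he (u := fibrePt x y) hu).symm
  have h1 : HasMFDerivAt (𝓡 n) 𝓘(ℝ, 𝔼 × 𝔼) (fun y : 𝔼 => tangentCoord e (fibrePt x y)) y
      ((coordDeriv e (fibrePt x y)).comp (vlift (fibrePt x y))) :=
    (mdifferentiableAt_tangentCoord he (u := fibrePt x y) hu).hasMFDerivAt.comp y hd.hasMFDerivAt
  exact congrArg (fun f : 𝔼 →L[ℝ] 𝔼 × 𝔼 => f w) (hasMFDerivAt_unique h1 h0.hasMFDerivAt)

lemma coordDeriv_vertEnd (he : e ∈ IsManifold.maximalAtlas (𝓡 n) ∞ M) {u : TM n M}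
    (hu : u.proj ∈ e.source) (v : TTM u) :
    coordDeriv e u (vertEnd u v) = (0, (coordDeriv e u v).1) := by
  rw [coordDeriv_fst he hu, ← coordDeriv_vlift he hu]
  rfl

/-- The tangent structure in coordinates: `J(a, b) = (0, a)`. -/
lemma rep_J (he : e ∈ IsManifold.maximalAtlas (𝓡 n) ∞ M) (X : VField n M)
    {z : 𝔼 × 𝔼} (hz : z.1 ∈ e.target) : rep e (J X) z = (0, (rep e X z).1) :=
  coordDeriv_vertEnd he (tangentCoordSymm_proj_mem hz) _

lemma rep_add (X Y : VField n M) (z : 𝔼 × 𝔼) : rep e (X + Y) z = rep e X z + rep e Y z :=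
  map_add (coordDeriv e (tangentCoordSymm e z)) _ _

lemma rep_sub (X Y : VField n M) (z : 𝔼 × 𝔼) : rep e (X - Y) z = rep e X z - rep e Y z :=
  map_sub (coordDeriv e (tangentCoordSymm e z)) _ _

lemma rep_smul (c : ℝ) (X : VField n M) (z : 𝔼 × 𝔼) : rep e (c • X) z = c • rep e X z :=
  map_smul (coordDeriv e (tangentCoordSymm e z)) _ _

/-- Differentials of functions in coordinates. -/
lemma dfun_eq (he : e ∈ IsManifold.maximalAtlas (𝓡 n) ∞ M) {f : TM n M → ℝ} {u : TM n M}
    (hu : u.proj ∈ e.source)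
    (hf : DifferentiableAt ℝ (fun z => f (tangentCoordSymm e z)) (tangentCoord e u)) (v : TTM u) :
    dfun f u v = fderiv ℝ (fun z => f (tangentCoordSymm e z)) (tangentCoord e u)
      (coordDeriv e u v) := by
  have h1 := hf.hasFDerivAt.hasMFDerivAt.comp u (mdifferentiableAt_tangentCoord he hu).hasMFDerivAt
  have h2 : ((fun z => f (tangentCoordSymm e z)) ∘ tangentCoord e) =ᶠ[𝓝 u] f := by
    filter_upwards [eventually_proj_mem hu] with v hv
    simp only [Function.comp, tangentCoordSymm_tangentCoord he hv]
  rw [dfun, (h1.congr_of_eventuallyEq h2.symm).mfderiv]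
  rfl

lemma contDiffAt_comp_tangentCoordSymm (he : e ∈ IsManifold.maximalAtlas (𝓡 n) ∞ M)
    {f : TM n M → ℝ} {u : TM n M} (hu : u.proj ∈ e.source) {m : ℕ∞}
    (hf : ContMDiffAt (𝓡 n).tangent 𝓘(ℝ, ℝ) m f u) :
    ContDiffAt ℝ m (fun z => f (tangentCoordSymm e z)) (tangentCoord e u) := by
  rw [← tangentCoordSymm_tangentCoord he hu] at hf
  exact (ContMDiffAt.comp (tangentCoord e u) hf ((contMDiffAt_tangentCoordSymm he
    (tangentCoord_fst_mem hu)).of_le (by exact_mod_cast le_top))).contDiffAt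

end CoordinateFields

/-! ### The energy of a Finsler metric in coordinates -/

section Energy

variable {n : ℕ} {M : Type*} [TopologicalSpace M] [ChartedSpace (EuclideanSpace ℝ (Fin n)) M]
  [IsManifold (𝓡 n) ∞ M]

local notation "𝔼" => EuclideanSpace ℝ (Fin n)

variable {e : OpenPartialHomeomorph M (EuclideanSpace ℝ (Fin n))}

lemma tangentCoord_snd_ne_zero (he : e ∈ IsManifold.maximalAtlas (𝓡 n) ∞ M) {u : TM n M}
    (hu : u.proj ∈ e.source) : (tangentCoord e u).2 ≠ 0 ↔ u ∈ slit n M := by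
  refine not_congr ⟨fun h => ?_, fun h => ?_⟩
  · exact chartDeriv_injective he hu (h.trans (map_zero (chartDeriv e u.proj)).symm)
  · exact (congrArg (chartDeriv e u.proj) h).trans (map_zero _)

lemma tangentCoord_mem_slitDomain (he : e ∈ IsManifold.maximalAtlas (𝓡 n) ∞ M) {u : TM n M}
    (hu : u.proj ∈ e.source) (hs : u ∈ slit n M) : tangentCoord e u ∈ slitDomain e.target :=
  ⟨tangentCoord_fst_mem hu, (tangentCoord_snd_ne_zero he hu).2 hs⟩

lemma tangentCoordSymm_mem_slit (he : e ∈ IsManifold.maximalAtlas (𝓡 n) ∞ M)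
    {z : 𝔼 × 𝔼} (hz : z ∈ slitDomain e.target) : tangentCoordSymm e z ∈ slit n M := by
  rw [← tangentCoord_snd_ne_zero he (tangentCoordSymm_proj_mem hz.1), tangentCoord_symm he hz.1]
  exact hz.2

lemma chartAt_mem_maximalAtlas (x : M) :
    chartAt 𝔼 x ∈ IsManifold.maximalAtlas (𝓡 n) ∞ M :=
  IsManifold.chart_mem_maximalAtlas (I := 𝓡 n) (n := ∞) x

variable (n M) in
lemma isOpen_slit : IsOpen (slit n M) := by
  rw [isOpen_iff_mem_nhds]
  intro u hu
  have he := chartAt_mem_maximalAtlas (n := n) u.proj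
  have hu' : u.proj ∈ (chartAt 𝔼 u.proj).source := mem_chart_source _ _
  have hc := (contMDiffAt_tangentCoord he hu').continuousAt.snd
  filter_upwards [hc.eventually_ne ((tangentCoord_snd_ne_zero he hu').2 hu),
    eventually_proj_mem hu'] with v hv hv' using (tangentCoord_snd_ne_zero he hv').1 hv

namespace FinslerMetric

variable (F : FinslerMetric n M)

/-- The function `F²` in the coordinates induced by `e`. -/
def localEnergy (e : OpenPartialHomeomorph M (EuclideanSpace ℝ (Fin n))) (z : 𝔼 × 𝔼) : ℝ :=
  F.sq (tangentCoordSymm e z)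

lemma localEnergy_tangentCoord (he : e ∈ IsManifold.maximalAtlas (𝓡 n) ∞ M) {u : TM n M}
    (hu : u.proj ∈ e.source) : F.localEnergy e (tangentCoord e u) = F.sq u := by
  rw [localEnergy, tangentCoordSymm_tangentCoord he hu]

lemma contMDiffAt_sq {u : TM n M} (hu : u ∈ slit n M) :
    ContMDiffAt (𝓡 n).tangent 𝓘(ℝ, ℝ) ∞ F.sq u :=
  ((F.smooth u hu).contMDiffAt ((isOpen_slit n M).mem_nhds hu)).pow 2

lemma contDiffAt_localEnergy (he : e ∈ IsManifold.maximalAtlas (𝓡 n) ∞ M) {z : 𝔼 × 𝔼}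
    (hz : z ∈ slitDomain e.target) : ContDiffAt ℝ ∞ (F.localEnergy e) z := by
  have h := contDiffAt_comp_tangentCoordSymm he (tangentCoordSymm_proj_mem hz.1)
    (F.contMDiffAt_sq (tangentCoordSymm_mem_slit he hz))
  rwa [tangentCoord_symm he hz.1] at h

/-- The Hessian of `F²` along a fibre, in coordinates. -/
lemma fibreHess_eq (he : e ∈ IsManifold.maximalAtlas (𝓡 n) ∞ M) {u : TM n M}
    (hu : u.proj ∈ e.source) (hs : u ∈ slit n M) (v w : TangentSpace (𝓡 n) u.proj) :
    fibreHess F.sq u v w = (1 / 2) * vertHess (F.localEnergy e) (tangentCoord e u)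
      (chartDeriv e u.proj v) (chartDeriv e u.proj w) := by
  obtain ⟨x, y⟩ := u
  change 𝔼 at y
  change 𝔼 at v
  change 𝔼 at w
  let D : 𝔼 →L[ℝ] 𝔼 := chartDeriv e x
  let ι : 𝔼 → 𝔼 × 𝔼 := fun y => (e x, D y)
  have hι : ∀ y, HasFDerivAt ι ((ContinuousLinearMap.inr ℝ 𝔼 𝔼).comp D) y := by
    intro y
    have h := (hasFDerivAt_const (𝕜 := ℝ) (e x) y).prodMk D.hasFDerivAt
    convert! h using 1
  have hmem : ∀ y : 𝔼, y ≠ 0 → ι y ∈ slitDomain e.target := fun y hy =>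
    tangentCoord_mem_slitDomain he (u := fibrePt x y) hu hy
  have h1 : ∀ y : 𝔼, y ≠ 0 → HasFDerivAt (fun y => F.sq (fibrePt x y))
      ((momentum (F.localEnergy e) (ι y)).comp D) y := by
    intro y hy
    have h := (differentiableAt_of_infty (F.contDiffAt_localEnergy he (hmem y hy))).hasFDerivAt.comp
      y (hι y)
    refine h.congr_of_eventuallyEq (Eventually.of_forall fun y' => ?_)
    exact (F.localEnergy_tangentCoord he (u := fibrePt x y') hu).symm
  have hs' : y ≠ 0 := hs
  have hm : ContDiffAt ℝ ∞ (momentum (F.localEnergy e)) (ι y) :=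
    (contDiffAt_fderiv_infty (F.contDiffAt_localEnergy he (hmem y hs'))).clm_comp contDiffAt_const
  have h2 : HasFDerivAt (fun y => (momentum (F.localEnergy e) (ι y)).comp D) _ y :=
    ((differentiableAt_of_infty hm).hasFDerivAt.comp y (hι y)).clm_comp (hasFDerivAt_const D y)
  have h3 : (fun z => fderiv ℝ (fun y => F.sq (fibrePt x y)) z) =ᶠ[𝓝 y]
      fun y => (momentum (F.localEnergy e) (ι y)).comp D := by
    filter_upwards [isOpen_compl_singleton.mem_nhds hs'] with y' hy' using (h1 y' hy').fderiv
  have h4 : fderiv ℝ (fun z => fderiv ℝ (fun y => F.sq (fibrePt x y)) z) y v w =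
      vertHess (F.localEnergy e) (ι y) (D v) (D w) := by
    rw [h3.fderiv_eq, h2.fderiv]
    simp
    rfl
  exact congrArg (fun t : ℝ => (1 / 2) * t) h4

/-- In coordinates, the square of a Finsler metric is a Finsler energy. -/
theorem isFinslerEnergy (he : e ∈ IsManifold.maximalAtlas (𝓡 n) ∞ M) :
    IsFinslerEnergy e.target (F.localEnergy e) where
  isOpen := e.open_target
  smooth _ hz := F.contDiffAt_localEnergy he hz
  pos z hz := pow_pos (F.pos _ (tangentCoordSymm_mem_slit he hz)) 2
  homog z hz c hc := by
    have h := F.homog (tangentCoordSymm e z) c hc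
    have h2 : tangentCoordSymm e (z.1, c • z.2) =
        (⟨(tangentCoordSymm e z).proj, c • (tangentCoordSymm e z).2⟩ : TM n M) :=
      congrArg (fun y => (⟨e.symm z.1, y⟩ : TM n M))
        (map_smul (mfderiv (𝓡 n) (𝓡 n) e.symm z.1) c z.2)
    rw [localEnergy, h2, localEnergy, sq, h, sq, mul_pow]
  nondeg z hz v hv := by
    have hu := tangentCoordSymm_proj_mem hz.1
    have hs := tangentCoordSymm_mem_slit he hz
    obtain ⟨v', rfl⟩ := chartDeriv_surjective he hu v
    have h : v' = 0 := by
      refine F.nondeg _ hs v' fun w => ?_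
      have h1 := F.fibreHess_eq he hu hs v' w
      rw [tangentCoord_symm he hz.1, hv, mul_zero] at h1
      exact h1
    rw [h, map_zero]

/-- The `1`-form `d_J F²` in coordinates. -/
lemma dJsq_eq (he : e ∈ IsManifold.maximalAtlas (𝓡 n) ∞ M) (X : VField n M) {z : 𝔼 × 𝔼}
    (hz : z ∈ slitDomain e.target) :
    F.dJsq X (tangentCoordSymm e z) = momentum (F.localEnergy e) z (rep e X z).1 := by
  have hd := differentiableAt_of_infty (F.contDiffAt_localEnergy he hz)
  have hu := tangentCoordSymm_proj_mem hz.1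
  rw [dJsq, dfun_eq he hu (by rw [tangentCoord_symm he hz.1]; exact hd), tangentCoord_symm he hz.1]
  change fderiv ℝ _ z (rep e (J X) z) = _
  rw [rep_J he X hz.1]
  rfl

/-- The `2`-form `d d_J F²` in coordinates. -/
lemma ddJsq_eq (he : e ∈ IsManifold.maximalAtlas (𝓡 n) ∞ M) {X Y : VField n M} {u : TM n M}
    (hu : u.proj ∈ e.source) (hs : u ∈ slit n M)
    (hX : DifferentiableAt ℝ (rep e X) (tangentCoord e u))
    (hY : DifferentiableAt ℝ (rep e Y) (tangentCoord e u)) :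
    F.ddJsq X Y u =
      fderiv ℝ (momentum (F.localEnergy e)) (tangentCoord e u) (coordDeriv e u (X u))
        (coordDeriv e u (Y u)).1 -
      fderiv ℝ (momentum (F.localEnergy e)) (tangentCoord e u) (coordDeriv e u (Y u))
        (coordDeriv e u (X u)).1 := by
  set z := tangentCoord e u with hzdef
  have hz : z ∈ slitDomain e.target := tangentCoord_mem_slitDomain he hu hs
  have hL := F.isFinslerEnergy he
  have hp := differentiableAt_of_infty (hL.smooth_momentum hz)
  have key : ∀ W : VField n M, DifferentiableAt ℝ (rep e W) z → ∀ v : TTM u,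
      dfun (F.dJsq W) u v =
        fderiv ℝ (momentum (F.localEnergy e)) z (coordDeriv e u v) (rep e W z).1 +
        momentum (F.localEnergy e) z (fderiv ℝ (rep e W) z (coordDeriv e u v)).1 := by
    intro W hW v
    have h1 : (fun z => F.dJsq W (tangentCoordSymm e z)) =ᶠ[𝓝 z]
        fun z => momentum (F.localEnergy e) z (rep e W z).1 := by
      filter_upwards [hL.eventually_mem hz] with w hw using F.dJsq_eq he W hw
    have h2 := (hp.hasFDerivAt.clm_apply hW.hasFDerivAt.fst).congr_of_eventuallyEq h1
    rw [dfun_eq he hu h2.differentiableAt, h2.fderiv]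
    simp [add_comm]
  have hlie : F.dJsq (lie X Y) u = momentum (F.localEnergy e) z
      ((fderiv ℝ (rep e Y) z (rep e X z)).1 - (fderiv ℝ (rep e X) z (rep e Y z)).1) := by
    have h1 := F.dJsq_eq he (lie X Y) hz
    rw [hzdef, tangentCoordSymm_tangentCoord he hu, ← hzdef, rep_lie he hz.1 hX hY] at h1
    rw [h1, VectorField.lieBracket_eq]
    rfl
  rw [ddJsq, key Y hY, key X hX, hlie, ← rep_tangentCoord he X hu, ← rep_tangentCoord he Y hu,
    map_sub, ← hzdef]
  ring

end FinslerMetric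

end Energy

/-! ### The spray, the horizontal projector and the curvature in coordinates -/

section Spray

section FlatBracket

variable {E : Type*} [NormedAddCommGroup E] [NormedSpace ℝ E] [FiniteDimensional ℝ E]
  {O : Set E} {L : E × E → ℝ} {z : E × E} {A C : E × E → E × E}

/-- The horizontal part of a vector field. -/
def horPart (L : E × E → ℝ) (A : E × E → E × E) (z : E × E) : E × E := horLift L (A z).1 z

lemma IsFinslerEnergy.hasFDerivAt_horPart (hL : IsFinslerEnergy O L) (hz : z ∈ slitDomain O)
    (hA : DifferentiableAt ℝ A z) :
    ∃ A' : E × E →L[ℝ] E × E, HasFDerivAt (horPart L A) A' z ∧ ∀ d, A' d =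
      ((fderiv ℝ A z d).1,
        -(fderiv ℝ (conn L) z d (A z).1 + conn L z (fderiv ℝ A z d).1)) := by
  have h : HasFDerivAt (horPart L A) _ z := hA.hasFDerivAt.fst.prodMk
    ((differentiableAt_of_infty (hL.smooth_conn hz)).hasFDerivAt.clm_apply hA.hasFDerivAt.fst).neg
  refine ⟨_, h, fun d => ?_⟩
  simp [add_comm]

lemma IsFinslerEnergy.contDiffAt_horPart (hL : IsFinslerEnergy O L) (hz : z ∈ slitDomain O)
    {m : ℕ∞} (hA : ContDiffAt ℝ m A z) : ContDiffAt ℝ m (horPart L A) z :=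
  hA.fst.prodMk (((hL.smooth_conn hz).of_le (by exact_mod_cast le_top)).clm_apply hA.fst).neg

/-- The curvature is half of the Frölicher-Nijenhuis bracket of the horizontal projector with
itself. -/
lemma IsFinslerEnergy.bracket_horPart (hL : IsFinslerEnergy O L) (hz : z ∈ slitDomain O)
    (hA : DifferentiableAt ℝ A z) (hC : DifferentiableAt ℝ C z) :
    VectorField.lieBracket ℝ (horPart L A) (horPart L C) z +
      horLift L (VectorField.lieBracket ℝ A C z).1 z -
      horLift L (VectorField.lieBracket ℝ (horPart L A) C z +
        VectorField.lieBracket ℝ A (horPart L C) z).1 z =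
    (0, curv L z (A z).1 (C z).1) := by
  obtain ⟨A', hA', hA''⟩ := hL.hasFDerivAt_horPart hz hA
  obtain ⟨C', hC', hC''⟩ := hL.hasFDerivAt_horPart hz hC
  simp only [VectorField.lieBracket_eq, hA'.fderiv, hC'.fderiv, hA'', hC'']
  refine Prod.ext ?_ ?_
  · simp only [horLift, Prod.fst_add, Prod.fst_sub]
    abel
  · simp only [horLift, Prod.fst_add, Prod.fst_sub, Prod.snd_add, Prod.snd_sub, map_add, map_sub,
      curv, horPart]
    abel

end FlatBracket

variable {n : ℕ} {M : Type*} [TopologicalSpace M] [ChartedSpace (EuclideanSpace ℝ (Fin n)) M]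
  [IsManifold (𝓡 n) ∞ M]

local notation "𝔼" => EuclideanSpace ℝ (Fin n)

variable {e e' : OpenPartialHomeomorph M (EuclideanSpace ℝ (Fin n))}

/-- Smooth cut-off functions with support in the domain of a chart. -/
lemma exists_cutoff [T2Space M] (e : OpenPartialHomeomorph M (EuclideanSpace ℝ (Fin n))) {x : M}
    (hx : x ∈ e.source) :
    ∃ χ : M → ℝ, ContMDiff (𝓡 n) 𝓘(ℝ, ℝ) ∞ χ ∧ tsupport χ ⊆ e.source ∧ χ =ᶠ[𝓝 x] 1 := by
  obtain ⟨f, -, hf⟩ := (SmoothBumpFunction.nhds_basis_tsupport (I := 𝓡 n) x).mem_iff.1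
    (e.open_source.mem_nhds hx)
  exact ⟨f, f.contMDiff, hf, f.eventuallyEq_one⟩

lemma eventually_cutoff_eq_zero {χ : M → ℝ} (hχ : tsupport χ ⊆ e.source) {u : TM n M}
    (hu : u.proj ∉ e.source) : ∀ᶠ v : TM n M in 𝓝 u, χ v.proj = 0 := by
  have h : IsOpen {v : TM n M | v.proj ∈ (tsupport χ)ᶜ} :=
    isOpen_proj_preimage (isClosed_tsupport χ).isOpen_compl
  filter_upwards [h.mem_nhds (show u.proj ∈ (tsupport χ)ᶜ from fun h => hu (hχ h))] with v hv
  exact image_eq_zero_of_notMem_tsupport hv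

lemma eventually_cutoff_eq_one {χ : M → ℝ} {u : TM n M} (hχ : χ =ᶠ[𝓝 u.proj] 1) :
    ∀ᶠ v : TM n M in 𝓝 u, χ v.proj = 1 :=
  (FiberBundle.continuous_proj (EuclideanSpace ℝ (Fin n))
    (TangentSpace (𝓡 n) : M → Type _)).continuousAt.eventually hχ

lemma contMDiff_cutoff {χ : M → ℝ} (hχ : ContMDiff (𝓡 n) 𝓘(ℝ, ℝ) ∞ χ) :
    ContMDiff (𝓡 n).tangent 𝓘(ℝ, ℝ) ∞ (fun u : TM n M => χ u.proj) :=
  hχ.comp contMDiff_tangentProj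

lemma smoothField_iff (X : VField n M) : SmoothField X ↔ ∀ u ∈ slit n M,
    ContMDiffAt (𝓡 n).tangent (𝓡 n).tangent.tangent ∞
      (fun u => (⟨u, X u⟩ : TangentBundle (𝓡 n).tangent (TM n M))) u :=
  ⟨fun h u hu => (h u hu).contMDiffAt ((isOpen_slit n M).mem_nhds hu),
    fun h u hu => (h u hu).contMDiffWithinAt⟩

lemma SmoothField.contDiffAt_rep {X : VField n M} (hX : SmoothField X)
    (he : e ∈ IsManifold.maximalAtlas (𝓡 n) ∞ M) {u : TM n M} (hu : u.proj ∈ e.source)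
    (hs : u ∈ slit n M) {m : ℕ∞} : ContDiffAt ℝ m (rep e X) (tangentCoord e u) :=
  ((contMDiffAt_iff_rep he X hu (m := ⊤)).1 ((smoothField_iff X).1 hX u hs)).of_le
    (by exact_mod_cast le_top)

/-- Every coordinate vector field agrees, near a given point, with a globally smooth one. -/
lemma exists_smoothField_eq_coordField [T2Space M] (he : e ∈ IsManifold.maximalAtlas (𝓡 n) ∞ M)
    {u : TM n M} (hu : u.proj ∈ e.source) (c : 𝔼 × 𝔼) :
    ∃ X : VField n M, SmoothField X ∧ X =ᶠ[𝓝 u] coordField e c := by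
  obtain ⟨χ, hχ, hsupp, hone⟩ := exists_cutoff e hu
  refine ⟨fun u => χ u.proj • coordField e c u, ?_, ?_⟩
  · rw [smoothField_iff]
    intro v hv
    by_cases hv' : v.proj ∈ e.source
    · refine (contMDiffAt_iff_rep he _ hv' (m := ⊤)).2 ?_
      have h1 := contDiffAt_comp_tangentCoordSymm he hv' (m := ⊤) (contMDiff_cutoff hχ).contMDiffAt
      refine (h1.smul (contDiffAt_const (c := c))).congr_of_eventuallyEq ?_
      filter_upwards [eventually_fst_mem (tangentCoord_fst_mem hv')] with z hz
      have h2 := rep_pull (M := M) he (fun _ => c) hz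
      exact (map_smul (coordDeriv e (tangentCoordSymm e z)) _ _).trans (congrArg _ h2)
    · have hw : v.proj ∈ (chartAt 𝔼 v.proj).source := mem_chart_source _ _
      refine (contMDiffAt_iff_rep (chartAt_mem_maximalAtlas v.proj) _ hw (m := ⊤)).2 ?_
      refine (contDiffAt_const (c := 0)).congr_of_eventuallyEq
        ((rep_eventuallyEq (chartAt_mem_maximalAtlas v.proj) hw (Y := 0) ?_).trans
          (Eventually.of_forall fun z => map_zero _))
      filter_upwards [eventually_cutoff_eq_zero hsupp hv'] with w hw
      rw [hw, zero_smul]; rfl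
  · filter_upwards [eventually_cutoff_eq_one hone] with v hv
    rw [hv, one_smul]

lemma rep_coordField (he : e ∈ IsManifold.maximalAtlas (𝓡 n) ∞ M) (c : 𝔼 × 𝔼) {z : 𝔼 × 𝔼}
    (hz : z.1 ∈ e.target) : rep e (coordField e c : VField n M) z = c :=
  rep_pull he (fun _ => c) hz

lemma coordDeriv_coordField (he : e ∈ IsManifold.maximalAtlas (𝓡 n) ∞ M) (c : 𝔼 × 𝔼) {u : TM n M}
    (hu : u.proj ∈ e.source) : coordDeriv e u (coordField e c u) = c :=
  coordDeriv_pull he (fun _ => c) hu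

lemma contDiffAt_rep_iff (he : e ∈ IsManifold.maximalAtlas (𝓡 n) ∞ M)
    (he' : e' ∈ IsManifold.maximalAtlas (𝓡 n) ∞ M) (X : VField n M) {u : TM n M}
    (hu : u.proj ∈ e.source) (hu' : u.proj ∈ e'.source) {m : ℕ∞} :
    ContDiffAt ℝ m (rep e X) (tangentCoord e u) ↔
      ContDiffAt ℝ m (rep e' X) (tangentCoord e' u) := by
  rw [← contMDiffAt_iff_rep he X hu, contMDiffAt_iff_rep he' X hu']

lemma contDiffAt_rep_coordField (he : e ∈ IsManifold.maximalAtlas (𝓡 n) ∞ M)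
    (he' : e' ∈ IsManifold.maximalAtlas (𝓡 n) ∞ M) (c : 𝔼 × 𝔼) {u : TM n M}
    (hu : u.proj ∈ e.source) (hu' : u.proj ∈ e'.source) {m : ℕ∞} :
    ContDiffAt ℝ m (rep e (coordField e' c)) (tangentCoord e u) := by
  rw [contDiffAt_rep_iff he he' _ hu hu']
  refine (contDiffAt_const (c := c)).congr_of_eventuallyEq ?_
  filter_upwards [eventually_fst_mem (tangentCoord_fst_mem hu')] with z hz
    using rep_coordField he' c hz

namespace FinslerMetric

variable (F : FinslerMetric n M)

/-- The geodesic spray in the coordinates induced by `e`. -/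
def localSpray (e : OpenPartialHomeomorph M (EuclideanSpace ℝ (Fin n))) (z : 𝔼 × 𝔼) : 𝔼 × 𝔼 :=
  (z.2, accel (F.localEnergy e) z)

lemma contDiffAt_localSpray (he : e ∈ IsManifold.maximalAtlas (𝓡 n) ∞ M) {z : 𝔼 × 𝔼}
    (hz : z ∈ slitDomain e.target) : ContDiffAt ℝ ∞ (F.localSpray e) z :=
  contDiffAt_snd.prodMk ((F.isFinslerEnergy he).smooth_accel hz)

lemma dfun_sq (he : e ∈ IsManifold.maximalAtlas (𝓡 n) ∞ M) {u : TM n M} (hu : u.proj ∈ e.source)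
    (hs : u ∈ slit n M) (v : TTM u) :
    dfun F.sq u v = fderiv ℝ (F.localEnergy e) (tangentCoord e u) (coordDeriv e u v) :=
  dfun_eq he hu (differentiableAt_of_infty
    (F.contDiffAt_localEnergy he (tangentCoord_mem_slitDomain he hu hs))) v

/-- The spray equation at a point, tested on the coordinate vector fields, determines the value of
the field at that point. -/
lemma spray_equation_iff (he : e ∈ IsManifold.maximalAtlas (𝓡 n) ∞ M) {S : VField n M} {u : TM n M}
    (hu : u.proj ∈ e.source) (hs : u ∈ slit n M)
    (hS : DifferentiableAt ℝ (rep e S) (tangentCoord e u)) :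
    (∀ c, F.ddJsq S (coordField e c) u = -dfun F.sq u (coordField e c u)) ↔
      coordDeriv e u (S u) = F.localSpray e (tangentCoord e u) := by
  have hz := tangentCoord_mem_slitDomain he hu hs
  rw [localSpray, ← (F.isFinslerEnergy he).spray_equation_iff hz]
  refine forall_congr' fun c => ?_
  rw [F.ddJsq_eq he hu hs hS ((contDiffAt_rep_coordField he he c hu hu (m := 1)).differentiableAt
    (by simp)), F.dfun_sq he hu hs, coordDeriv_coordField he c hu]

lemma spray_equation (he : e ∈ IsManifold.maximalAtlas (𝓡 n) ∞ M) {S Y : VField n M} {u : TM n M}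
    (hu : u.proj ∈ e.source) (hs : u ∈ slit n M)
    (hS : DifferentiableAt ℝ (rep e S) (tangentCoord e u))
    (hY : DifferentiableAt ℝ (rep e Y) (tangentCoord e u))
    (h : coordDeriv e u (S u) = F.localSpray e (tangentCoord e u)) :
    F.ddJsq S Y u = -dfun F.sq u (Y u) := by
  have hz := tangentCoord_mem_slitDomain he hu hs
  rw [F.ddJsq_eq he hu hs hS hY, F.dfun_sq he hu hs]
  exact ((F.isFinslerEnergy he).spray_equation_iff hz _).2 h _

/-- The local sprays of two charts agree. -/
lemma coordDeriv_pull_localSpray (he : e ∈ IsManifold.maximalAtlas (𝓡 n) ∞ M)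
    (he' : e' ∈ IsManifold.maximalAtlas (𝓡 n) ∞ M) {u : TM n M}
    (hu : u.proj ∈ e.source) (hu' : u.proj ∈ e'.source) (hs : u ∈ slit n M) :
    coordDeriv e' u (pull e (F.localSpray e) u) = F.localSpray e' (tangentCoord e' u) := by
  have hz := tangentCoord_mem_slitDomain he hu hs
  have hS : ContDiffAt ℝ (1 : ℕ∞) (rep e (pull e (F.localSpray e) : VField n M))
      (tangentCoord e u) := by
    refine ((F.contDiffAt_localSpray he hz).of_le
      (by exact_mod_cast le_top)).congr_of_eventuallyEq ?_
    filter_upwards [eventually_fst_mem hz.1] with z hz using rep_pull he _ hz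
  have hS' := (contDiffAt_rep_iff he he' _ hu hu').1 hS
  refine (F.spray_equation_iff he' hu' hs (hS'.differentiableAt (by simp))).1 fun c => ?_
  exact F.spray_equation he hu hs (hS.differentiableAt (by simp))
    ((contDiffAt_rep_coordField he he' c hu hu' (m := 1)).differentiableAt (by simp))
    (coordDeriv_pull he _ hu)

/-- Existence of the geodesic spray. -/
theorem exists_isGeodesicSpray : ∃ S, F.IsGeodesicSpray S := by
  let S : VField n M := fun u => pull (chartAt 𝔼 u.proj) (F.localSpray (chartAt 𝔼 u.proj)) u
  have hS : ∀ e ∈ IsManifold.maximalAtlas (𝓡 n) ∞ M, ∀ u ∈ slit n M, u.proj ∈ e.source →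
      coordDeriv e u (S u) = F.localSpray e (tangentCoord e u) := fun e he u hs hu =>
    F.coordDeriv_pull_localSpray (chartAt_mem_maximalAtlas u.proj) he (mem_chart_source _ _) hu hs
  have hrep : ∀ u ∈ slit n M, ContDiffAt ℝ ∞ (rep (chartAt 𝔼 u.proj) S)
      (tangentCoord (chartAt 𝔼 u.proj) u) := by
    intro u hs
    have he := chartAt_mem_maximalAtlas (n := n) u.proj
    have hz := tangentCoord_mem_slitDomain he (mem_chart_source _ _) hs
    refine (F.contDiffAt_localSpray he hz).congr_of_eventuallyEq ?_
    filter_upwards [(F.isFinslerEnergy he).eventually_mem hz] with z hz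
    have h := hS _ he _ (tangentCoordSymm_mem_slit he hz) (tangentCoordSymm_proj_mem hz.1)
    rwa [tangentCoord_symm he hz.1] at h
  have hsm : SmoothField S := (smoothField_iff S).2 fun u hs =>
    (contMDiffAt_iff_rep (chartAt_mem_maximalAtlas u.proj) S (mem_chart_source _ _) (m := ⊤)).2
      (hrep u hs)
  refine ⟨S, hsm, fun Y hY u hs => ?_⟩
  have he := chartAt_mem_maximalAtlas (n := n) u.proj
  exact F.spray_equation he (mem_chart_source _ _) hs (differentiableAt_of_infty (hrep u hs))
    ((hY.contDiffAt_rep he (mem_chart_source _ _) hs (m := 1)).differentiableAt (by simp))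
    (hS _ he u hs (mem_chart_source _ _))

lemma isGeodesicSpray_spray : F.IsGeodesicSpray F.spray :=
  Classical.epsilon_spec F.exists_isGeodesicSpray

variable [T2Space M]

/-- The geodesic spray in coordinates. -/
lemma rep_spray (he : e ∈ IsManifold.maximalAtlas (𝓡 n) ∞ M) {z : 𝔼 × 𝔼}
    (hz : z ∈ slitDomain e.target) : rep e F.spray z = F.localSpray e z := by
  have hu := tangentCoordSymm_proj_mem hz.1
  have hs := tangentCoordSymm_mem_slit he hz
  obtain ⟨hsm, heq⟩ := F.isGeodesicSpray_spray
  have hd : DifferentiableAt ℝ (rep e F.spray) (tangentCoord e (tangentCoordSymm e z)) :=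
    (hsm.contDiffAt_rep he hu hs (m := 1)).differentiableAt (by simp)
  have h1 : coordDeriv e (tangentCoordSymm e z) (F.spray (tangentCoordSymm e z)) =
      F.localSpray e (tangentCoord e (tangentCoordSymm e z)) := by
    rw [localSpray, ← (F.isFinslerEnergy he).spray_equation_iff
      (tangentCoord_mem_slitDomain he hu hs)]
    intro c
    obtain ⟨Y, hY, hYc⟩ := exists_smoothField_eq_coordField he hu c
    have h2 := heq Y hY _ hs
    rw [F.ddJsq_eq he hu hs hd ((hY.contDiffAt_rep he hu hs (m := 1)).differentiableAt (by simp)),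
      F.dfun_sq he hu hs, hYc.self_of_nhds, coordDeriv_coordField he c hu] at h2
    exact h2
  rw [tangentCoord_symm he hz.1] at h1
  exact h1

/-- The horizontal projector in coordinates. -/
lemma rep_h (he : e ∈ IsManifold.maximalAtlas (𝓡 n) ∞ M) {X : VField n M} {z : 𝔼 × 𝔼}
    (hz : z ∈ slitDomain e.target) (hX : DifferentiableAt ℝ (rep e X) z) :
    rep e (F.h X) z = horPart (F.localEnergy e) (rep e X) z := by
  have hL := F.isFinslerEnergy he
  have hJ : rep e (J X) =ᶠ[𝓝 z] fun z => (0, (rep e X z).1) := by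
    filter_upwards [eventually_fst_mem hz.1] with w hw using rep_J he X hw
  have hJd : HasFDerivAt (rep e (J X)) _ z :=
    ((hasFDerivAt_const (𝕜 := ℝ) (0 : 𝔼) z).prodMk hX.hasFDerivAt.fst).congr_of_eventuallyEq hJ
  have hS : rep e F.spray =ᶠ[𝓝 z] F.localSpray e := by
    filter_upwards [hL.eventually_mem hz] with w hw using F.rep_spray he hw
  have hSd : HasFDerivAt (rep e F.spray) _ z :=
    (hasFDerivAt_snd.prodMk (differentiableAt_of_infty
      (hL.smooth_accel hz)).hasFDerivAt).congr_of_eventuallyEq hS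
  rw [FinslerMetric.h, rep_smul, rep_sub, fnBracketField, rep_sub, rep_J he _ hz.1,
    rep_lie he hz.1 hSd.differentiableAt hJd.differentiableAt,
    rep_lie he hz.1 hSd.differentiableAt hX]
  simp only [VectorField.lieBracket_eq, hJd.fderiv, hSd.fderiv, rep_J he X hz.1]
  refine Prod.ext ?_ ?_
  · simp only [horPart, horLift, ContinuousLinearMap.prod_apply, Prod.smul_fst, Prod.fst_sub,
      zero_apply, ContinuousLinearMap.coe_snd']
    module
  · simp only [horPart, horLift, conn, ContinuousLinearMap.prod_apply, Prod.smul_snd, Prod.snd_sub,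
      Prod.fst_sub, ContinuousLinearMap.coe_snd', ContinuousLinearMap.comp_apply,
      ContinuousLinearMap.coe_fst', ContinuousLinearMap.inr_apply, smul_apply]
    module

/-- The curvature in coordinates. -/
theorem rep_R (he : e ∈ IsManifold.maximalAtlas (𝓡 n) ∞ M) {X Y : VField n M} {z : 𝔼 × 𝔼}
    (hz : z ∈ slitDomain e.target) (hX : ContDiffAt ℝ (2 : ℕ∞) (rep e X) z)
    (hY : ContDiffAt ℝ (2 : ℕ∞) (rep e Y) z) :
    rep e (F.R X Y) z = (0, curv (F.localEnergy e) z (rep e X z).1 (rep e Y z).1) := by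
  have hL := F.isFinslerEnergy he
  have h12 : ∀ {A : 𝔼 × 𝔼 → 𝔼 × 𝔼}, ContDiffAt ℝ (2 : ℕ∞) A z → ContDiffAt ℝ (1 : ℕ∞) A z :=
    fun hA => hA.of_le (by norm_num)
  have hd : ∀ {A : 𝔼 × 𝔼 → 𝔼 × 𝔼}, ContDiffAt ℝ (1 : ℕ∞) A z → DifferentiableAt ℝ A z :=
    fun hA => hA.differentiableAt (by simp)
  have hev : ∀ {X : VField n M}, ContDiffAt ℝ (1 : ℕ∞) (rep e X) z →
      rep e (F.h X) =ᶠ[𝓝 z] horPart (F.localEnergy e) (rep e X) := by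
    intro X hX
    filter_upwards [hL.eventually_mem hz, hX.eventually (by simp)] with w hw hw'
    exact F.rep_h he hw (hw'.differentiableAt (by simp))
  have hh : ∀ {X : VField n M}, ContDiffAt ℝ (2 : ℕ∞) (rep e X) z →
      ContDiffAt ℝ (2 : ℕ∞) (rep e (F.h X)) z := fun hX =>
    (hL.contDiffAt_horPart hz hX).congr_of_eventuallyEq (hev (h12 hX))
  have hh1 : ∀ {X : VField n M}, ContDiffAt ℝ (1 : ℕ∞) (rep e X) z →
      ContDiffAt ℝ (1 : ℕ∞) (rep e (F.h X)) z := fun hX =>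
    (hL.contDiffAt_horPart hz hX).congr_of_eventuallyEq (hev hX)
  have hlie : ∀ {X Y : VField n M}, ContDiffAt ℝ (2 : ℕ∞) (rep e X) z →
      ContDiffAt ℝ (2 : ℕ∞) (rep e Y) z → ContDiffAt ℝ (1 : ℕ∞) (rep e (lie X Y)) z := by
    intro X Y hX hY
    refine (hX.lieBracket_vectorField hY (m := 1) (by norm_num)).congr_of_eventuallyEq ?_
    filter_upwards [eventually_fst_mem hz.1, hX.eventually (by simp), hY.eventually (by simp)]
      with w hw h1 h2
    exact rep_lie he hw (h1.differentiableAt (by simp)) (h2.differentiableAt (by simp))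
  have hlie' : ∀ {X Y : VField n M}, ContDiffAt ℝ (2 : ℕ∞) (rep e X) z →
      ContDiffAt ℝ (2 : ℕ∞) (rep e Y) z →
      rep e (lie X Y) z = VectorField.lieBracket ℝ (rep e X) (rep e Y) z := fun hX hY =>
    rep_lie he hz.1 (hd (h12 hX)) (hd (h12 hY))
  have hW : ContDiffAt ℝ (1 : ℕ∞) (rep e (lie (F.h X) Y + lie X (F.h Y))) z :=
    ((hlie (hh hX) hY).add (hlie hX (hh hY))).congr_of_eventuallyEq
      (Eventually.of_forall fun w => rep_add _ _ w)
  have eX := hev (h12 hX)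
  have eY := hev (h12 hY)
  have key := hL.bracket_horPart hz (hd (h12 hX)) (hd (h12 hY))
  rw [← (eX.lieBracket_vectorField_eq eY), ← (eX.lieBracket_vectorField_eq (EventuallyEq.refl _ _)),
    ← (EventuallyEq.lieBracket_vectorField_eq (EventuallyEq.refl _ _) eY), ← hlie' hX hY,
    ← hlie' (hh hX) (hh hY), ← hlie' (hh hX) hY, ← hlie' hX (hh hY), ← rep_add] at key
  rw [FinslerMetric.R, fnBracket]
  simp only [rep_smul, rep_sub, rep_add]
  rw [F.rep_h he hz (hd hW), F.rep_h he hz (hd (hh1 (hlie hX hY))), horPart,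
    F.rep_h he hz (hd (hlie hX hY)), horPart, ← key]
  simp only [horPart, horLift]
  module

end FinslerMetric

end Spray

/-! ### The three conditions -/

section Equivalence

section AlternatingForms

variable {V : Type*} [AddCommGroup V] [Module ℝ V] [TopologicalSpace V]

lemma update_pair_zero (v v' w : V) : Function.update ![v, w] 0 v' = ![v', w] := by
  ext i
  fin_cases i <;> rfl

lemma alternating_two_add (η : V [⋀^Fin 2]→L[ℝ] ℝ) (v v' w : V) :
    η ![v + v', w] = η ![v, w] + η ![v', w] := by
  have h := η.map_update_add ![v, w] 0 v v'
  rwa [update_pair_zero, update_pair_zero, update_pair_zero] at h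

lemma alternating_two_smul (η : V [⋀^Fin 2]→L[ℝ] ℝ) (c : ℝ) (v w : V) :
    η ![c • v, w] = c * η ![v, w] := by
  have h := η.map_update_smul ![v, w] 0 c v
  rwa [update_pair_zero, update_pair_zero] at h

lemma alternating_two_swap (η : V [⋀^Fin 2]→L[ℝ] ℝ) (v w : V) : η ![v, w] = -η ![w, v] := by
  have h := η.toAlternatingMap.map_swap ![w, v] (show (0 : Fin 2) ≠ 1 by decide)
  have h2 : ![w, v] ∘ Equiv.swap (0 : Fin 2) 1 = ![v, w] := by
    ext i
    fin_cases i <;> rfl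
  rw [h2] at h
  exact h

end AlternatingForms

section FlatForm

variable {n : ℕ}

local notation "𝔼" => EuclideanSpace ℝ (Fin n)

/-- The bilinear form with matrix `b`. -/
def matrixForm (b : Matrix (Fin n) (Fin n) ℝ) (v w : 𝔼) : ℝ := ∑ i, ∑ m, b i m * v i * w m

lemma matrixForm_single_right (b : Matrix (Fin n) (Fin n) ℝ) (v : 𝔼) (k : Fin n) :
    matrixForm b v (EuclideanSpace.single k 1) = ∑ m, b m k * v m := by
  simp [matrixForm]

lemma matrixForm_comm {b : Matrix (Fin n) (Fin n) ℝ} (hb : b.IsSymm) (v w : 𝔼) :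
    matrixForm b v w = matrixForm b w v := by
  rw [matrixForm, Finset.sum_comm, matrixForm]
  refine Finset.sum_congr rfl fun i _ => Finset.sum_congr rfl fun m _ => ?_
  rw [hb.apply i m]
  ring

lemma contDiff_matrixForm (b : Matrix (Fin n) (Fin n) ℝ) :
    ContDiff ℝ ∞ fun p : 𝔼 × 𝔼 => matrixForm b p.1 p.2 := by
  have hc : ∀ i : Fin n, ContDiff ℝ ∞ fun v : 𝔼 => v i := fun i =>
    (EuclideanSpace.proj (𝕜 := ℝ) i).contDiff
  refine ContDiff.sum fun i _ => ContDiff.sum fun m _ => ?_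
  exact (contDiff_const.mul ((hc i).comp contDiff_fst)).mul ((hc m).comp contDiff_snd)

lemma contDiffAt_matrixForm_sub (b : Matrix (Fin n) (Fin n) ℝ) {f g : 𝔼 × 𝔼 → 𝔼 × 𝔼} {z : 𝔼 × 𝔼}
    (hf : ContDiffAt ℝ ∞ f z) (hg : ContDiffAt ℝ ∞ g z) :
    ContDiffAt ℝ ∞ (fun z => matrixForm b (f z).2 (g z).1 - matrixForm b (g z).2 (f z).1) z :=
  ((contDiff_matrixForm b).contDiffAt.comp z (hf.snd.prodMk hg.fst)).sub
    ((contDiff_matrixForm b).contDiffAt.comp z (hg.snd.prodMk hf.fst))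

lemma matrixForm_zero_left (b : Matrix (Fin n) (Fin n) ℝ) (w : 𝔼) : matrixForm b 0 w = 0 := by
  simp [matrixForm]

lemma matrixForm_zero_right (b : Matrix (Fin n) (Fin n) ℝ) (w : 𝔼) : matrixForm b w 0 = 0 := by
  simp [matrixForm]

/-- The form `b_{ij} dyⁱ ∧ dxʲ` with constant coefficients. -/
def flatForm (b : Matrix (Fin n) (Fin n) ℝ) : (𝔼 × 𝔼) [⋀^Fin 2]→L[ℝ] ℝ where
  toFun v := matrixForm b (v 0).2 (v 1).1 - matrixForm b (v 1).2 (v 0).1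
  map_update_add' v i x y := by
    fin_cases i <;>
    · simp [matrixForm, mul_add, add_mul, Finset.sum_add_distrib]
      ring
  map_update_smul' v i c x := by
    fin_cases i <;>
    · simp [matrixForm, mul_sub, Finset.mul_sum]
      congr 1 <;> refine Finset.sum_congr rfl fun i _ => Finset.sum_congr rfl fun m _ => ?_ <;> ring
  cont := by
    simp only [matrixForm]
    fun_prop
  map_eq_zero_of_eq' v i j h hij := by
    have h01 : v 0 = v 1 := by
      fin_cases i <;> fin_cases j <;> simp_all
    rw [h01, sub_self]

lemma flatForm_apply (b : Matrix (Fin n) (Fin n) ℝ) (v w : 𝔼 × 𝔼) :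
    flatForm b ![v, w] = matrixForm b v.2 w.1 - matrixForm b w.2 v.1 := rfl

end FlatForm

variable {n : ℕ} {M : Type*} [TopologicalSpace M] [ChartedSpace (EuclideanSpace ℝ (Fin n)) M]
  [IsManifold (𝓡 n) ∞ M]

local notation "𝔼" => EuclideanSpace ℝ (Fin n)

variable {e e' : OpenPartialHomeomorph M (EuclideanSpace ℝ (Fin n))}

/-- Every constant form `b_{ij} dyⁱ ∧ dxʲ` in a chart agrees, over a neighbourhood of a given point
of the base, with a global form, which is killed by `i_J` if `b` is symmetric. -/
lemma exists_twoForm [T2Space M] (he : e ∈ IsManifold.maximalAtlas (𝓡 n) ∞ M) {u : TM n M}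
    (hu : u.proj ∈ e.source) {b : Matrix (Fin n) (Fin n) ℝ} (hb : b.IsSymm) :
    ∃ η : TwoForm n M, (∀ v w, η.toFun u ![v, w] = flatForm b ![coordDeriv e u v, coordDeriv e u w])
      ∧ ∀ u v w, iJ η u v w = 0 := by
  obtain ⟨χ, hχ, hsupp, hone⟩ := exists_cutoff e hu
  have happ : ∀ (u : TM n M) (v w : TTM u),
      (χ u.proj • (flatForm b).compContinuousLinearMap (coordDeriv e u)) ![v, w] =
        χ u.proj * (matrixForm b (coordDeriv e u v).2 (coordDeriv e u w).1 -
          matrixForm b (coordDeriv e u w).2 (coordDeriv e u v).1) := fun u v w => rfl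
  refine ⟨⟨fun u => χ u.proj • (flatForm b).compContinuousLinearMap (coordDeriv e u), ?_⟩, ?_, ?_⟩
  · intro X Y hX hY v hv
    refine ContMDiffAt.contMDiffWithinAt ?_
    by_cases hv' : v.proj ∈ e.source
    · have hX' := hX.contDiffAt_rep he hv' hv (m := ⊤)
      have hY' := hY.contDiffAt_rep he hv' hv (m := ⊤)
      have h1 : ContDiffAt ℝ ∞ (fun z => matrixForm b (rep e X z).2 (rep e Y z).1 -
          matrixForm b (rep e Y z).2 (rep e X z).1) (tangentCoord e v) := by
        exact contDiffAt_matrixForm_sub b hX' hY'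
      have h2 := (contMDiff_cutoff hχ).contMDiffAt.mul
        (h1.contMDiffAt.comp v (contMDiffAt_tangentCoord he hv'))
      have h3 : ∀ᶠ w in 𝓝 v, (χ w.proj • (flatForm b).compContinuousLinearMap (coordDeriv e w))
          ![X w, Y w] = χ w.proj * (matrixForm b (rep e X (tangentCoord e w)).2
            (rep e Y (tangentCoord e w)).1 - matrixForm b (rep e Y (tangentCoord e w)).2
            (rep e X (tangentCoord e w)).1) := by
        filter_upwards [eventually_proj_mem hv'] with w hw
        rw [happ, rep_tangentCoord he X hw, rep_tangentCoord he Y hw]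
      exact h2.congr_of_eventuallyEq h3
    · refine (contMDiffAt_const (c := (0 : ℝ))).congr_of_eventuallyEq ?_
      filter_upwards [eventually_cutoff_eq_zero hsupp hv'] with w hw
      rw [happ, hw, zero_mul]
  · intro v w
    refine (happ u v w).trans ?_
    rw [hone.self_of_nhds, flatForm_apply]
    simp
  · intro u v w
    refine (congrArg₂ (· + ·) (happ u _ _) (happ u _ _)).trans ?_
    by_cases hu' : u.proj ∈ e.source
    · rw [coordDeriv_vertEnd he hu', coordDeriv_vertEnd he hu', matrixForm_zero_right,
        matrixForm_zero_right, matrixForm_comm hb (coordDeriv e u w).1]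
      ring
    · have h0 := (eventually_cutoff_eq_zero hsupp hu').self_of_nhds
      rw [h0]
      ring

namespace FinslerMetric

variable [T2Space M] (F : FinslerMetric n M)

lemma coordDeriv_R (he : e ∈ IsManifold.maximalAtlas (𝓡 n) ∞ M) {X Y : VField n M} {u : TM n M}
    (hu : u.proj ∈ e.source) (hs : u ∈ slit n M)
    (hX : ContDiffAt ℝ (2 : ℕ∞) (rep e X) (tangentCoord e u))
    (hY : ContDiffAt ℝ (2 : ℕ∞) (rep e Y) (tangentCoord e u)) :
    coordDeriv e u (F.R X Y u) = (0, curv (F.localEnergy e) (tangentCoord e u)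
      (coordDeriv e u (X u)).1 (coordDeriv e u (Y u)).1) := by
  rw [← rep_tangentCoord he _ hu, ← rep_tangentCoord he _ hu, ← rep_tangentCoord he _ hu]
  exact F.rep_R he (tangentCoord_mem_slitDomain he hu hs) hX hY

lemma coordR_eq (he : e ∈ IsManifold.maximalAtlas (𝓡 n) ∞ M) {u : TM n M}
    (hu : u.proj ∈ e.source) (hs : u ∈ slit n M) (a b : 𝔼) :
    F.coordR e u a b = curv (F.localEnergy e) (tangentCoord e u) a b := by
  have h := F.coordDeriv_R he hu hs (contDiffAt_rep_coordField he he (a, 0) hu hu)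
    (contDiffAt_rep_coordField he he (b, 0) hu hu)
  rw [coordDeriv_coordField he _ hu, coordDeriv_coordField he _ hu] at h
  exact congrArg Prod.snd h

/-- The Jacobi endomorphism in an arbitrary chart. -/
lemma chartDeriv_jacobi (he : e ∈ IsManifold.maximalAtlas (𝓡 n) ∞ M) {u : TM n M}
    (hu : u.proj ∈ e.source) (hs : u ∈ slit n M) (X : TangentSpace (𝓡 n) u.proj) :
    chartDeriv e u.proj (F.jacobi u X) = curv (F.localEnergy e) (tangentCoord e u)
      (tangentCoord e u).2 (chartDeriv e u.proj X) := by
  set e₀ := chartAt 𝔼 u.proj with he₀def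
  have he₀ : e₀ ∈ IsManifold.maximalAtlas (𝓡 n) ∞ M := chartAt_mem_maximalAtlas u.proj
  have hu₀ : u.proj ∈ e₀.source := mem_chart_source _ _
  let D := chartDeriv e₀ u.proj
  have hjac : D (F.jacobi u X) = F.coordR e₀ u (D u.2) (D X) := by
    obtain ⟨A, hA⟩ := chartDeriv_isInvertible he₀ hu₀
    have h1 : F.jacobi u X = D.inverse (F.coordR e₀ u (D u.2) (D X)) := rfl
    rw [h1, show D = A from hA.symm, ContinuousLinearMap.inverse_equiv]
    exact A.apply_symm_apply _
  set r := F.R (coordField e₀ (D u.2, 0)) (coordField e₀ (D X, 0)) u with hr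
  -- `jacobi` is characterized without coordinates, by its vertical lift
  have h2 : r = vlift u (F.jacobi u X) := by
    refine coordDeriv_injective he₀ hu₀ ?_
    rw [coordDeriv_vlift he₀ hu₀, show chartDeriv e₀ u.proj (F.jacobi u X) = _ from hjac, hr,
      F.coordR_eq he₀ hu₀ hs, F.coordDeriv_R he₀ hu₀ hs
        (contDiffAt_rep_coordField he₀ he₀ _ hu₀ hu₀) (contDiffAt_rep_coordField he₀ he₀ _ hu₀ hu₀),
      coordDeriv_coordField he₀ _ hu₀, coordDeriv_coordField he₀ _ hu₀]
  have h3 : ∀ v : TangentSpace (𝓡 n) u.proj,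
      (coordDeriv e u (coordField e₀ (D v, 0) u)).1 = chartDeriv e u.proj v := by
    intro v
    rw [coordDeriv_fst he hu]
    congr 1
    refine chartDeriv_injective he₀ hu₀ ?_
    rw [← coordDeriv_fst he₀ hu₀, coordDeriv_coordField he₀ _ hu₀]
  have h4 := F.coordDeriv_R he hu hs
    (contDiffAt_rep_coordField he he₀ (D u.2, 0) hu hu₀)
    (contDiffAt_rep_coordField he he₀ (D X, 0) hu hu₀)
  rw [← hr, h2, coordDeriv_vlift he hu, h3, h3] at h4
  exact congrArg Prod.snd h4

/-- The flag curvature in an arbitrary chart. -/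
lemma flagCurvature_eq (he : e ∈ IsManifold.maximalAtlas (𝓡 n) ∞ M) {u : TM n M}
    (hu : u.proj ∈ e.source) (hs : u ∈ slit n M) (X : TangentSpace (𝓡 n) u.proj) :
    F.flagCurvature u X =
      vertHess (F.localEnergy e) (tangentCoord e u) (chartDeriv e u.proj X)
        (curv (F.localEnergy e) (tangentCoord e u) (tangentCoord e u).2 (chartDeriv e u.proj X)) /
      (F.localEnergy e (tangentCoord e u) *
        vertHess (F.localEnergy e) (tangentCoord e u) (chartDeriv e u.proj X)
          (chartDeriv e u.proj X) -
        momentum (F.localEnergy e) (tangentCoord e u) (chartDeriv e u.proj X) ^ 2 / 2) := by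
  have hz := tangentCoord_mem_slitDomain he hu hs
  have hL := F.isFinslerEnergy he
  have hu2 : chartDeriv e u.proj u.2 = (tangentCoord e u).2 := rfl
  simp only [flagCurvature, g]
  rw [F.fibreHess_eq he hu hs, F.fibreHess_eq he hu hs, F.fibreHess_eq he hu hs,
    F.fibreHess_eq he hu hs, F.chartDeriv_jacobi he hu hs, hu2, hL.vertHess_self hz,
    hL.vertHess_self hz, hL.momentum_self hz]
  rw [← mul_div_mul_left _ (F.localEnergy e (tangentCoord e u) *
        vertHess (F.localEnergy e) (tangentCoord e u) (chartDeriv e u.proj X)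
          (chartDeriv e u.proj X) -
        momentum (F.localEnergy e) (tangentCoord e u) (chartDeriv e u.proj X) ^ 2 / 2)
    (show (1 / 2 : ℝ) ≠ 0 by norm_num)]
  congr 1
  ring

lemma linearIndependent_chartDeriv_iff (he : e ∈ IsManifold.maximalAtlas (𝓡 n) ∞ M) {u : TM n M}
    (hu : u.proj ∈ e.source) (X : TangentSpace (𝓡 n) u.proj) :
    LinearIndependent ℝ ![(tangentCoord e u).2, chartDeriv e u.proj X] ↔
      LinearIndependent ℝ ![u.2, X] := by
  rw [LinearIndependent.pair_iff, LinearIndependent.pair_iff]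
  refine forall_congr' fun s => forall_congr' fun t => imp_congr_left ?_
  have h : s • (tangentCoord e u).2 + t • chartDeriv e u.proj X =
      chartDeriv e u.proj (s • u.2 + t • X) := by
    rw [map_add, map_smul, map_smul]; rfl
  rw [h]
  exact ⟨fun h0 => chartDeriv_injective he hu (h0.trans (map_zero _).symm),
    fun h0 => by rw [h0, map_zero]⟩

/-- In every chart the curvature is a multiple of `p ∧ Id`, where `p = 2 yᵢ dxⁱ` is the
momentum of `F²`. -/
def IsIsotropic : Prop :=
  ∀ e ∈ IsManifold.maximalAtlas (𝓡 n) ∞ M, ∀ z ∈ slitDomain e.target, ∃ ρ : ℝ, ∀ a b,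
    curv (F.localEnergy e) z a b =
      ρ • (momentum (F.localEnergy e) z a • b - momentum (F.localEnergy e) z b • a)

variable {F}

/-- The flag curvature determines the curvature, which is isotropic with factor `κ / 2`: the
momentum `∂F²/∂yⁱ` is `2 g_{ij} yʲ`. -/
lemma HasConstantFlagCurvature.isIsotropic (hn : 2 < n) (h : F.HasConstantFlagCurvature) :
    F.IsIsotropic := by
  obtain ⟨κ, hκ⟩ := h
  rintro e he ⟨x, y⟩ hz
  have hL := F.isFinslerEnergy he
  have hE : 1 < Module.finrank ℝ 𝔼 := by
    rw [finrank_euclideanSpace_fin]; omega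
  refine ⟨κ / 2, hL.curv_eq_of_fibre hz.1 (fun y' hy' v => ?_) hz.2⟩
  have hz' : (x, y') ∈ slitDomain e.target := ⟨hz.1, hy'⟩
  refine hL.curv_eq_of_quadratic hz' (fun v hv => ?_) v
  have hu := tangentCoordSymm_proj_mem (e := e) (z := (x, y')) hz'.1
  have hs := tangentCoordSymm_mem_slit he hz'
  obtain ⟨X, rfl⟩ := chartDeriv_surjective he hu v
  have hpos := hL.flag_denominator_pos hE hz' hv
  have h1 := F.flagCurvature_eq he (u := tangentCoordSymm e (x, y')) hu hs X
  rw [hκ _ hs X ((linearIndependent_chartDeriv_iff he hu X).1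
    (by rw [tangentCoord_symm he hz'.1]; exact hv)), tangentCoord_symm he hz'.1,
    eq_div_iff hpos.ne'] at h1
  exact h1.symm

/-- By the Schur lemma, the flag curvature of an isotropic metric is locally constant. -/
lemma IsIsotropic.exists_flagCurvature_eq (hn : 2 < n) (h : F.IsIsotropic) (x : M) :
    ∃ W ∈ 𝓝 x, ∃ k : ℝ, ∀ u ∈ slit n M, u.proj ∈ W → ∀ X : TangentSpace (𝓡 n) u.proj,
      LinearIndependent ℝ ![u.2, X] → F.flagCurvature u X = k := by
  have hE : 2 < Module.finrank ℝ 𝔼 := by rwa [finrank_euclideanSpace_fin]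
  have he := chartAt_mem_maximalAtlas (n := n) x
  set e := chartAt 𝔼 x
  have hx : x ∈ e.source := mem_chart_source _ _
  have hL := F.isFinslerEnergy he
  choose! ρ hρ using h e he
  obtain ⟨W, hW, k, hk⟩ := hL.factor_locally_const hE hρ (e.map_source hx)
  refine ⟨e.source ∩ e ⁻¹' W, inter_mem (e.open_source.mem_nhds hx)
    ((e.continuousAt hx).preimage_mem_nhds hW), 2 * k, fun u hs hu X hX => ?_⟩
  have hz := tangentCoord_mem_slitDomain he hu.1 hs
  have hpos := hL.flag_denominator_pos (by omega) hz
    ((linearIndependent_chartDeriv_iff he hu.1 X).2 hX)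
  rw [F.flagCurvature_eq he hu.1 hs, div_eq_iff hpos.ne', hρ _ hz]
  have hk' : ρ (tangentCoord e u) = k := hk _ hu.2 _ hz.2
  simp only [map_smul, map_sub, hL.momentum_self hz, hL.vertHess_self_right hz, smul_eq_mul, hk']
  ring

/-- A locally constant flag curvature is constant, as the manifold is connected. -/
lemma IsIsotropic.hasConstantFlagCurvature [ConnectedSpace M] (hn : 2 < n) (h : F.IsIsotropic) :
    F.HasConstantFlagCurvature := by
  let y₀ : 𝔼 := EuclideanSpace.single ⟨0, by omega⟩ 1
  let X₀ : 𝔼 := EuclideanSpace.single ⟨1, by omega⟩ 1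
  have hy₀ : y₀ ≠ 0 := by simp [y₀]
  have hind : LinearIndependent ℝ ![y₀, X₀] := by
    rw [LinearIndependent.pair_iff]
    intro s t hst
    have h0 := congrArg (fun v : 𝔼 => v ⟨0, by omega⟩) hst
    have h1 := congrArg (fun v : 𝔼 => v ⟨1, by omega⟩) hst
    simp [y₀, X₀] at h0 h1
    exact ⟨h0, h1⟩
  let K : M → ℝ := fun x => F.flagCurvature (⟨x, y₀⟩ : TM n M) X₀
  have hK : ∀ x, ∃ W ∈ 𝓝 x, ∀ u ∈ slit n M, u.proj ∈ W → ∀ X : TangentSpace (𝓡 n) u.proj,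
      LinearIndependent ℝ ![u.2, X] → F.flagCurvature u X = K x := by
    intro x
    obtain ⟨W, hW, k, hk⟩ := h.exists_flagCurvature_eq hn x
    refine ⟨W, hW, fun u hs hu X hX => ?_⟩
    rw [hk u hs hu X hX]
    exact (hk ⟨x, y₀⟩ hy₀ (mem_of_mem_nhds hW) X₀ hind).symm
  have hloc : IsLocallyConstant K := by
    rw [IsLocallyConstant.iff_eventually_eq]
    intro x
    obtain ⟨W, hW, hk⟩ := hK x
    filter_upwards [hW] with x' hx' using hk ⟨x', y₀⟩ hy₀ hx' X₀ hind
  obtain ⟨x₀⟩ := (inferInstance : Nonempty M)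
  refine ⟨K x₀, fun u hs X hX => ?_⟩
  obtain ⟨W, hW, hk⟩ := hK u.proj
  rw [hk u hs (mem_of_mem_nhds hW) X hX]
  exact hloc.apply_eq_of_preconnectedSpace _ _

/-- For isotropic curvature the six terms of `i_R η` cancel in pairs, as `η(JX, Y)` is symmetric. -/
lemma IsIsotropic.algebraicCondition (h : F.IsIsotropic) : F.AlgebraicCondition := by
  intro η hη X Y Z hX hY hZ u hs
  have he := chartAt_mem_maximalAtlas (n := n) u.proj
  set e := chartAt 𝔼 u.proj
  have hu : u.proj ∈ e.source := mem_chart_source _ _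
  obtain ⟨ρ, hρ⟩ := h e he _ (tangentCoord_mem_slitDomain he hu hs)
  let p : TTM u → ℝ := fun v =>
    momentum (F.localEnergy e) (tangentCoord e u) (coordDeriv e u v).1
  have hR : ∀ {X Y : VField n M}, SmoothField X → SmoothField Y → F.R X Y u =
      (ρ * p (X u)) • vertEnd u (Y u) + (-(ρ * p (Y u))) • vertEnd u (X u) := by
    intro X Y hX hY
    refine coordDeriv_injective he hu ?_
    rw [F.coordDeriv_R he hu hs (hX.contDiffAt_rep he hu hs) (hY.contDiffAt_rep he hu hs), hρ,
      map_add, map_smul, map_smul, coordDeriv_vertEnd he hu, coordDeriv_vertEnd he hu]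
    refine Prod.ext (by simp) ?_
    simp only [p, Prod.snd_add, Prod.smul_snd]
    module
  have hsym : ∀ v w : TTM u, η.toFun u ![vertEnd u v, w] = η.toFun u ![vertEnd u w, v] := by
    intro v w
    have h1 : η.toFun u ![vertEnd u v, w] + η.toFun u ![v, vertEnd u w] = 0 := hη u hs v w
    rw [alternating_two_swap _ v] at h1
    linarith
  rw [iR, hR hX hY, hR hZ hX, hR hY hZ]
  simp only [alternating_two_add, alternating_two_smul]
  rw [hsym (Z u) (Y u), hsym (Z u) (X u), hsym (Y u) (X u)]
  ring

/-- The condition in coordinates results from evaluating `i_R (b_{ij} dyⁱ ∧ dxʲ)` on coordinate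
vector fields. -/
lemma AlgebraicCondition.localAlgebraicCondition (h : F.AlgebraicCondition) :
    F.LocalAlgebraicCondition := by
  intro e he u hs hu b hb i j k
  obtain ⟨η, hη, hJ⟩ := exists_twoForm he hu hb
  have hext := fun l : Fin n =>
    exists_smoothField_eq_coordField he hu ((EuclideanSpace.single l 1, 0) : 𝔼 × 𝔼)
  choose X hX hXc using hext
  have hval : ∀ l, coordDeriv e u (X l u) = (EuclideanSpace.single l 1, 0) := fun l => by
    rw [(hXc l).self_of_nhds, coordDeriv_coordField he _ hu]
  have key := h η (fun u _ v w => hJ u v w) (X i) (X j) (X k) (hX i) (hX j) (hX k) u hs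
  have hterm : ∀ i j k, η.toFun u ![F.R (X i) (X j) u, X k u] = ∑ m, b k m * F.Rcomp e u m i j := by
    intro i j k
    rw [hη, F.coordDeriv_R he hu hs ((hX i).contDiffAt_rep he hu hs)
      ((hX j).contDiffAt_rep he hu hs), hval, hval, hval, flatForm_apply, matrixForm_zero_left,
      sub_zero, matrixForm_single_right]
    refine Finset.sum_congr rfl fun m _ => ?_
    rw [Rcomp, F.coordR_eq he hu hs, hb.apply k m]
  rw [iR, hterm, hterm, hterm] at key
  rw [Finset.sum_add_distrib, Finset.sum_add_distrib]
  linarith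

/-- The cyclic identity in a chart forces isotropy. -/
lemma LocalAlgebraicCondition.isIsotropic (hn : 2 < n) (h : F.LocalAlgebraicCondition) :
    F.IsIsotropic := by
  intro e he z hz
  refine (F.isFinslerEnergy he).exists_factor hn hz fun b hb i j k => ?_
  have hu := tangentCoordSymm_proj_mem hz.1
  have hs := tangentCoordSymm_mem_slit he hz
  have h1 := h e he _ hs hu b hb i j k
  simp only [Rcomp, F.coordR_eq he hu hs, tangentCoord_symm he hz.1] at h1
  exact h1

end FinslerMetric

end Equivalence

end FinslerGeom

end

theorem theorem1p1 {n : ℕ} (hn : 2 < n) {M : Type*} [TopologicalSpace M] [T2Space M]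
    [ConnectedSpace M] [ChartedSpace (EuclideanSpace ℝ (Fin n)) M] [IsManifold (𝓡 n) ∞ M]
    (F : FinslerGeom.FinslerMetric n M) :
    (F.HasConstantFlagCurvature ↔ F.AlgebraicCondition) ∧
      (F.AlgebraicCondition ↔ F.LocalAlgebraicCondition) := by
  have hbc : F.AlgebraicCondition → F.LocalAlgebraicCondition :=
    fun h => h.localAlgebraicCondition
  exact ⟨⟨fun h => (h.isIsotropic hn).algebraicCondition,
    fun h => ((hbc h).isIsotropic hn).hasConstantFlagCurvature hn⟩,
    ⟨hbc, fun h => (h.isIsotropic hn).algebraicCondition⟩⟩
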